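/- Setting. Let $G$ be a connected undirected graph with vertex set $\{1,\dots,m\}$ and diameter $d$; player $i$ sits at vertex $i$ and holds a vector $X_i\in\{0,1,\dots,M\}^n$. Put $\mathcal X=\sum_{i=1}^m X_i$ and $F_p=\sum_{j=1}^n|\mathcal X_j|^p$. A (public-coin) protocol in the message-passing model on $G$ runs in rounds. A schedule fixed in advance says which players send in a given round, each to one of its neighbours in $G$; a message is a bit string that depends only on the sender's input, on a finite string of uniform random bits shared by all players, and on the messages the sender received in earlier rounds, and it is seen only by its recipient. At the end a distinguished player $\mathcal C$ outputs a real number computed from its input, the shared bits and the messages it received. The protocol is one-shot if every player other than $\mathcal C$ sends exactly one message, all messages it receives arrive in the round immediately before the one in which it sends, $\mathcal C$ sends nothing, and all messages to $\mathcal C$ arrive in a single round. The max-communication is the largest number of bits sent across an edge (in both directions together) during the execution, and the total communication is the number of bits in all messages. Theorem. For every constant $c\in\mathbb N$ there is a constant $K>0$, depending only on $c$, such that for all $p\in(1,2]$, $\epsilon\in(0,1)$, all $n,M,m$ with $m\le c\,n^c$ and $M\le c\,n^c$, and every connected graph $G$ on $m$ vertices with diameter $d$, there is a one-shot protocol on $G$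 which, for all inputs $X_1,\dots,X_m\in\{0,\dots,M\}^n$, outputs a number in $[(1-\epsilon)F_p,(1+\epsilon)F_p]$ with probability at least $3/4$, and which, for all such inputs and all outcomes of the random bits, has max-communication at most $$B=\frac{K}{\epsilon^{2}}\Big(\log\log (n+3)+\log d+\log\frac1\epsilon\Big)$$ bits and total communication at most $mB$ bits. Moreover, there is an absolute constant $K>0$ such that the same holds for all $n,M,m$, without the assumptions $m\le c\,n^c$ and $M\le c\,n^c$, when $\log\log(n+3)$ is replaced by $\log\log(mnM+3)$. (For $m=1$, where $d=0$, the term $\log d$ is read as $0$; the shift by $3$ only keeps the iterated logarithm positive for small arguments.) -/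

import Mathlib

namespace MsgPassing

/-- What a player has received so far: the entry at position `t` of the list tells, for each player
`i`, which bit string (if any) was received from `i` in round `t`. -/
abbrev View (m : ℕ) : Type := List (Fin m → Option (List Bool))

/-- A public-coin protocol in the message passing model on the graph `G`, whose `m` players sit at
the vertices of `G` and hold vectors with `n` non-negative integer entries. The schedule (who sends
to whom in which round) is fixed in advance; the content of a message may depend only on the
sender's own input, the shared random bits, and the messages the sender received in earlier
rounds. -/
structure Protocol {m : ℕ} (G : SimpleGraph (Fin m)) (n : ℕ) where
  /-- the number of shared random bits -/
  coins : ℕ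
  /-- the number of rounds; the rounds are `0, …, rounds - 1` -/
  rounds : ℕ
  /-- `target t i = some j`: in round `t` player `i` sends a message to player `j`;
  `target t i = none`: in round `t` player `i` sends nothing -/
  target : ℕ → Fin m → Option (Fin m)
  /-- messages travel along edges only -/
  target_adj : ∀ t i j, target t i = some j → G.Adj i j
  /-- the message of player `i` in round `t` (if the schedule lets it send one) -/
  message : ℕ → Fin m → (Fin n → ℕ) → (Fin coins → Bool) → View m → List Bool
  /-- the distinguished player, who holds the estimate at the end -/
  center : Fin m
  /-- the estimate, a function of the center's input, the shared bits and the center's view -/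
  output : (Fin n → ℕ) → (Fin coins → Bool) → View m → ℝ

namespace Protocol

variable {m n : ℕ} {G : SimpleGraph (Fin m)} (P : Protocol G n)

/-- `P.view X ω t j`: everything player `j` has received in the first `t` rounds, when the inputs
are `X` and the shared random bits are `ω`. -/
def view (X : Fin m → Fin n → ℕ) (ω : Fin P.coins → Bool) : ℕ → Fin m → View m
  | 0, _ => []
  | t + 1, j => view X ω t j ++ [fun i =>
      if P.target t i = some j then some (P.message t i (X i) ω (view X ω t i)) else none]

/-- The number of bits sent from player `i` to player `j` over the whole execution. -/
def bitsSent (X : Fin m → Fin n → ℕ) (ω : Fin P.coins → Bool) (i j : Fin m) : ℕ :=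
  ∑ t ∈ Finset.range P.rounds,
    if P.target t i = some j then (P.message t i (X i) ω (P.view X ω t i)).length else 0

/-- The number of bits sent over the whole execution across the busiest edge, both directions
counted together (pairs that are not edges contribute `0`). -/
def maxComm (X : Fin m → Fin n → ℕ) (ω : Fin P.coins → Bool) : ℕ :=
  Finset.univ.sup fun e : Fin m × Fin m => P.bitsSent X ω e.1 e.2 + P.bitsSent X ω e.2 e.1

/-- The number of bits in all messages of the execution. -/
def totalComm (X : Fin m → Fin n → ℕ) (ω : Fin P.coins → Bool) : ℕ :=
  ∑ i, ∑ j, P.bitsSent X ω i j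

/-- The value held by the center at the end of the execution. -/
def result (X : Fin m → Fin n → ℕ) (ω : Fin P.coins → Bool) : ℝ :=
  P.output (X P.center) ω (P.view X ω P.rounds P.center)

/-- One-shot protocols: every player other than the center sends exactly one message, to one
neighbour, and whatever it receives arrives in the round right before; the center never sends,
and whatever it receives arrives in a single round. -/
def IsOneShot : Prop :=
  (∀ i, i ≠ P.center → ∃ t < P.rounds,
    (P.target t i).isSome ∧
    (∀ t' < P.rounds, t' ≠ t → P.target t' i = none) ∧
    (∀ s < P.rounds, ∀ u, P.target s u = some i → s + 1 = t)) ∧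
  (∀ t < P.rounds, P.target t P.center = none) ∧
  (∃ t, ∀ s < P.rounds, ∀ u, P.target s u = some P.center → s = t)

end Protocol

/-- The probability of an event under `R` independent fair coin tosses. -/
noncomputable def coinProb {R : ℕ} (E : Set (Fin R → Bool)) : ℝ :=
  (E.ncard : ℝ) / 2 ^ R

/-- The moment `F_p = ∑ⱼ |𝒳ⱼ|^p` of the aggregate vector `𝒳 = ∑ᵢ Xᵢ`. -/
noncomputable def Fp {m n : ℕ} (p : ℝ) (X : Fin m → Fin n → ℕ) : ℝ :=
  ∑ j, |∑ i, (X i j : ℝ)| ^ p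

/-- There is a one-shot protocol on `G` which, for all inputs `X₁, …, X_m ∈ {0, …, M}ⁿ`, outputs a
`(1 ± ε)`-approximation of `F_p` with probability at least `3/4`, and which, for all such inputs
and all outcomes of the coins, has max-communication at most `B` and total communication at most
`m * B` bits. -/
def HasOneShotFpProtocol {m : ℕ} (G : SimpleGraph (Fin m)) (n M : ℕ) (p ε B : ℝ) : Prop :=
  ∃ P : Protocol G n, P.IsOneShot ∧
    ∀ X : Fin m → Fin n → ℕ, (∀ i j, X i j ≤ M) →
      3 / 4 ≤ coinProb {ω | P.result X ω ∈ Set.Icc ((1 - ε) * Fp p X) ((1 + ε) * Fp p X)} ∧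
      ∀ ω, (P.maxComm X ω : ℝ) ≤ B ∧ (P.totalComm X ω : ℝ) ≤ m * B

end MsgPassing

/-! The sketch consists of `k = Θ(1/ε²)` linear forms `∑ⱼ zⱼ 𝒳ⱼ` with independent symmetric
`p`-stable coefficients drawn from the shared bits. By stability each form is distributed as
`F_p^{1/p}` times one stable variable (`IsStable.map_pi`). The average of the powers `|·|^{1/4}`
therefore concentrates around `c · F_p^{1/(4p)}`: moments of order `1/2` are finite, so Chebyshev
applies (`IsStable.measure_deviation_le`). Dividing by `c` and raising to the power `4p` recovers
`F_p`. All moment bounds are uniform in `p ∈ [1, 2]`, which keeps the final constant independent of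
`p`.

The forms are linear, so they are summed along a shortest-path spanning tree. Each vertex sends its
partial sum to its parent, rounded to a floating point number with `b = O(log (d/ε))` bits of
mantissa. The rounding is randomized and unbiased. The error at a vertex is centred given the shifts
of all other vertices that influence it, so the errors are uncorrelated
(`Rooting.integral_err_mul_err`) and variances add up instead of the errors themselves. For fixed
`z`, the accumulated variance is at most `4^{-b}` times the sum over vertices of the squared partial
sums, up to a factor `2` and a tiny cutoff term (`Rooting.sum_integral_noisy_sq_le`).

For `p < 2` stable variables have infinite variance, so this square function of `z` is controlled
only in a low moment. A Khintchine inequality replaces it by random signed sums, which are again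
stable forms (`IsStable.lintegral_sum_sq_le`). Inputs are nonnegative and a vertex has at most `d +
1` ancestors, so the `p`-th powers of the norms of all partial sums add up to at most `(d + 1) F_p`
(`Rooting.sum_subsum_le_Fp`). The loss is polynomial in `d`, not in `m`, and extra mantissa bits pay
for it.

Markov's inequality bounds all intermediate values by a polynomial in `m`, `n`, `M`, `d`, `1/ε` with
high probability. Hence the binary exponent takes `O(log (mnMd/ε))` values and costs an iterated
logarithm in bits. Numbers out of range are replaced by `0`, so message lengths hold for every
outcome of the coins. Finally, only finitely many inputs occur, so the continuous randomness can be
simulated by finitely many fair coins (`exists_coins_simulation`). -/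

namespace MsgPassing

open MeasureTheory ProbabilityTheory Filter Topology

/-! ### Symmetric stable laws -/

/-- If characteristic functions converge pointwise to a function that is continuous at `0`, the
limit is the characteristic function of a probability measure. -/
lemma exists_charFun_eq_of_tendsto {μ : ℕ → ProbabilityMeasure ℝ} {f : ℝ → ℂ}
    (hf : ContinuousAt f 0)
    (h : ∀ t, Tendsto (fun n ↦ charFun (μ n : Measure ℝ) t) atTop (𝓝 (f t))) :
    ∃ ν : ProbabilityMeasure ℝ, ∀ t, charFun (ν : Measure ℝ) t = f t := by
  have h_tight : IsTightMeasureSet (Set.range fun n ↦ (μ n : Measure ℝ)) :=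
    isTightMeasureSet_of_tendsto_charFun hf h
  have h_compact : IsCompact (closure (Set.range μ)) := by
    apply isCompact_closure_of_isTightMeasureSet
    convert h_tight using 1
    ext ν
    simp
  -- A limit along an ultrafilter is enough: the characteristic functions already converge along
  -- `atTop`, so no subsequence is needed to identify the limit.
  let U : Ultrafilter ℕ := Ultrafilter.of atTop
  obtain ⟨ν, -, hν⟩ := h_compact.ultrafilter_le_nhds (U.map μ)
    (le_principal_iff.2 (mem_of_superset (by simp) subset_closure))
  have hν' : Tendsto μ U (𝓝 ν) := hν
  refine ⟨ν, fun t ↦ ?_⟩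
  rw [ProbabilityMeasure.tendsto_iff_forall_integral_rclike_tendsto ℂ] at hν'
  have h1 := hν' (BoundedContinuousFunction.innerProbChar t)
  simp_rw [← charFun_eq_integral_innerProbChar] at h1
  exact tendsto_nhds_unique h1 ((h t).mono_left (Ultrafilter.of_le _))

/-- The `N`-fold convolution of a measure with itself. -/
noncomputable def convPow (μ : Measure ℝ) : ℕ → Measure ℝ
  | 0 => Measure.dirac 0
  | N + 1 => convPow μ N ∗ μ

instance (μ : Measure ℝ) [IsProbabilityMeasure μ] (N : ℕ) : IsProbabilityMeasure (convPow μ N) := by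
  induction N with
  | zero => simp only [convPow]; infer_instance
  | succ N ih => simp only [convPow]; infer_instance

lemma charFun_convPow (μ : Measure ℝ) [IsProbabilityMeasure μ] (N : ℕ) (t : ℝ) :
    charFun (convPow μ N) t = charFun μ t ^ N := by
  induction N with
  | zero => simp [convPow, charFun_dirac]
  | succ N ih => simp only [convPow]; rw [charFun_conv, ih, pow_succ]

/-- Near `0` the factor `1 - cos u ≤ u²` leaves `u^(1-p)`, integrable because `p < 2`. At infinity
the factor is at most `2` and `p > 0` suffices. -/
lemma integrableOn_one_sub_cos_mul_rpow {p : ℝ} (hp : 0 < p) (hp2 : p < 2) :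
    IntegrableOn (fun u : ℝ ↦ (1 - Real.cos u) * u ^ (-(p + 1))) (Set.Ioi 0) := by
  rw [← Set.Ioc_union_Ioi_eq_Ioi (zero_le_one' ℝ)]
  have hm : Measurable (fun u : ℝ ↦ (1 - Real.cos u) * u ^ (-(p + 1))) := by fun_prop
  refine IntegrableOn.union ?_ ?_
  · have h1 : IntegrableOn (fun u : ℝ ↦ u ^ (1 - p)) (Set.Ioc 0 1) := by
      have := (intervalIntegral.intervalIntegrable_rpow' (a := 0) (b := 1)
        (show -1 < 1 - p by linarith))
      rwa [intervalIntegrable_iff_integrableOn_Ioc_of_le zero_le_one] at this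
    refine h1.mono' hm.aestronglyMeasurable ?_
    refine (ae_restrict_mem measurableSet_Ioc).mono fun u hu ↦ ?_
    have hu0 : 0 < u := hu.1
    have hc : 0 ≤ 1 - Real.cos u := by linarith [Real.cos_le_one u]
    have hc2 : 1 - Real.cos u ≤ u ^ 2 := by
      nlinarith [Real.one_sub_sq_div_two_le_cos (x := u), sq_nonneg u]
    rw [Real.norm_of_nonneg (mul_nonneg hc (Real.rpow_nonneg hu0.le _))]
    calc (1 - Real.cos u) * u ^ (-(p + 1)) ≤ u ^ 2 * u ^ (-(p + 1)) := by gcongr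
      _ = u ^ (1 - p) := by
        rw [← Real.rpow_natCast, ← Real.rpow_add hu0]; congr 1; push_cast; ring
  · have h1 : IntegrableOn (fun u : ℝ ↦ 2 * u ^ (-(p + 1))) (Set.Ioi 1) :=
      (integrableOn_Ioi_rpow_of_lt (by linarith) one_pos).const_mul 2
    refine h1.mono' hm.aestronglyMeasurable ?_
    refine (ae_restrict_mem measurableSet_Ioi).mono fun u hu ↦ ?_
    have hu0 : 0 < u := one_pos.trans hu
    have hc : 0 ≤ 1 - Real.cos u := by linarith [Real.cos_le_one u]
    have hc2 : 1 - Real.cos u ≤ 2 := by linarith [Real.neg_one_le_cos u]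
    rw [Real.norm_of_nonneg (mul_nonneg hc (Real.rpow_nonneg hu0.le _))]
    gcongr

lemma integral_one_sub_cos_mul_rpow_pos {p : ℝ} (hp : 0 < p) (hp2 : p < 2) :
    0 < ∫ u in Set.Ioi (0 : ℝ), (1 - Real.cos u) * u ^ (-(p + 1)) := by
  have hnn : ∀ u ∈ Set.Ioi (0 : ℝ), 0 ≤ (1 - Real.cos u) * u ^ (-(p + 1)) := fun u hu ↦
    mul_nonneg (by linarith [Real.cos_le_one u]) (Real.rpow_nonneg (le_of_lt hu) _)
  rw [setIntegral_pos_iff_support_of_nonneg_ae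
    ((ae_restrict_mem measurableSet_Ioi).mono hnn) (integrableOn_one_sub_cos_mul_rpow hp hp2)]
  refine lt_of_lt_of_le ?_ (measure_mono (s := Set.Ioo 0 1) ?_)
  · simp
  · intro u hu
    refine ⟨(mul_pos ?_ (Real.rpow_pos_of_pos hu.1 _)).ne', hu.1⟩
    have := Real.cos_lt_cos_of_nonneg_of_le_pi le_rfl (hu.2.le.trans (by linarith [Real.pi_gt_three]))
      hu.1
    rw [Real.cos_zero] at this
    linarith

lemma tendsto_setIntegral_Ioi_zero {g : ℝ → ℝ} (hg : IntegrableOn g (Set.Ioi 0)) {a : ℕ → ℝ}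
    (ha : ∀ n, 0 ≤ a n) (h : Tendsto a atTop (𝓝 0)) :
    Tendsto (fun n ↦ ∫ u in Set.Ioi (a n), g u) atTop (𝓝 (∫ u in Set.Ioi 0, g u)) := by
  have h1 (n : ℕ) : ∫ u in Set.Ioi (a n), g u
      = ∫ u in Set.Ioi (0 : ℝ), (Set.Ioi (a n)).indicator g u := by
    rw [setIntegral_indicator measurableSet_Ioi, Set.inter_eq_self_of_subset_right]
    exact Set.Ioi_subset_Ioi (ha n)
  simp_rw [h1]
  refine tendsto_integral_of_dominated_convergence (fun u ↦ ‖g u‖) ?_ hg.norm ?_ ?_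
  · exact fun n ↦ hg.aestronglyMeasurable.indicator measurableSet_Ioi
  · exact fun n ↦ ae_of_all _ fun u ↦ norm_indicator_le_norm_self _ _
  · refine (ae_restrict_mem measurableSet_Ioi).mono fun u hu ↦ ?_
    refine tendsto_const_nhds.congr' ?_
    filter_upwards [h.eventually (gt_mem_nhds hu)] with n hn
    rw [Set.indicator_of_mem (by exact hn)]

/-- The symmetrization of a probability measure on the real line. -/
noncomputable def symmetrize (μ : Measure ℝ) : Measure ℝ :=
  (2 : ENNReal)⁻¹ • (μ + μ.map (fun x ↦ -x))

instance (μ : Measure ℝ) [IsProbabilityMeasure μ] : IsProbabilityMeasure (symmetrize μ) := by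
  have : IsProbabilityMeasure (μ.map (fun x ↦ -x)) :=
    Measure.isProbabilityMeasure_map (by fun_prop)
  constructor
  simp only [symmetrize, Measure.smul_apply, Measure.add_apply, measure_univ, smul_eq_mul]
  rw [one_add_one_eq_two]
  exact ENNReal.inv_mul_cancel (by simp) (by simp)

lemma charFun_symmetrize (μ : Measure ℝ) [IsProbabilityMeasure μ] (t : ℝ) :
    charFun (symmetrize μ) t = ((∫ x, Real.cos (t * x) ∂μ : ℝ) : ℂ) := by
  have : IsProbabilityMeasure (μ.map (fun x ↦ -x)) :=
    Measure.isProbabilityMeasure_map (by fun_prop)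
  have hi (ν : Measure ℝ) [IsProbabilityMeasure ν] (s : ℝ) :
      Integrable (fun x : ℝ ↦ Complex.exp (s * x * Complex.I)) ν := by
    refine Integrable.of_bound (by fun_prop) 1 (ae_of_all _ fun x ↦ ?_)
    rw [← Complex.ofReal_mul, Complex.norm_exp_ofReal_mul_I]
  rw [charFun_apply_real, symmetrize, integral_smul_measure,
    integral_add_measure (hi _ t) (hi _ t), integral_map (by fun_prop) (by fun_prop),
    ← integral_add (hi _ t) (by simpa using hi μ (-t)), ← integral_complex_ofReal,
    ← integral_smul]
  refine integral_congr_ae (ae_of_all _ fun x ↦ ?_)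
  simp only [Complex.ofReal_cos, Complex.cos]
  push_cast
  simp only [ENNReal.toReal_inv, ENNReal.toReal_ofNat, Complex.real_smul]
  push_cast
  ring_nf

/-- The substitution `u = t x` pulls out `t ^ p`. What remains depends on `t` only through the lower
limit, which tends to `0` in the limit theorem. -/
lemma integral_one_sub_cos_pareto {p : ℝ} (hp : 0 < p) {t : ℝ} (ht : 0 < t) :
    ∫ x, (1 - Real.cos (t * x)) ∂(paretoMeasure 1 p)
      = p * t ^ p * ∫ u in Set.Ioi t, (1 - Real.cos u) * u ^ (-(p + 1)) := by
  have hm : Measurable (paretoPDF 1 p) := (measurable_paretoPDFReal 1 p).ennreal_ofReal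
  rw [paretoMeasure, integral_withDensity_eq_integral_toReal_smul hm
    (ae_of_all _ fun x ↦ ENNReal.ofReal_lt_top)]
  have h1 : (fun x ↦ (paretoPDF 1 p x).toReal • (1 - Real.cos (t * x)))
      = (Set.Ici (1 : ℝ)).indicator
        (fun x ↦ p * x ^ (-(p + 1)) * (1 - Real.cos (t * x))) := by
    ext x
    rw [paretoPDF, ENNReal.toReal_ofReal (paretoPDFReal_nonneg zero_le_one hp.le x),
      paretoPDFReal]
    by_cases hx : 1 ≤ x
    · simp [Set.indicator, hx]
    · simp [Set.indicator, hx]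
  rw [h1, integral_indicator measurableSet_Ici, integral_Ici_eq_integral_Ioi]
  have h2 : ∫ x in Set.Ioi (1 : ℝ), p * x ^ (-(p + 1)) * (1 - Real.cos (t * x))
      = ∫ x in Set.Ioi (1 : ℝ), (p * t ^ (p + 1)) *
        ((fun u : ℝ ↦ (1 - Real.cos u) * u ^ (-(p + 1))) (t * x)) := by
    refine setIntegral_congr_fun measurableSet_Ioi fun x hx ↦ ?_
    have hx0 : (0 : ℝ) < x := one_pos.trans hx
    simp only
    rw [Real.mul_rpow ht.le hx0.le, Real.rpow_neg ht.le]
    have : t ^ (p + 1) ≠ 0 := (Real.rpow_pos_of_pos ht _).ne'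
    field_simp
  rw [h2, integral_const_mul, integral_comp_mul_left_Ioi
    (fun u : ℝ ↦ (1 - Real.cos u) * u ^ (-(p + 1))) _ ht, mul_one, Real.rpow_add_one ht.ne',
    smul_eq_mul]
  field_simp

lemma integral_cos_pareto {p : ℝ} (hp : 0 < p) (t : ℝ) :
    ∫ x, Real.cos (t * x) ∂(paretoMeasure 1 p)
      = 1 - p * |t| ^ p * ∫ u in Set.Ioi |t|, (1 - Real.cos u) * u ^ (-(p + 1)) := by
  have := isProbabilityMeasure_paretoMeasure one_pos hp
  rcases eq_or_ne t 0 with rfl | ht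
  · simp [Real.zero_rpow hp.ne']
  rw [← integral_one_sub_cos_pareto hp (abs_pos.2 ht), integral_sub (by simp) ?_]
  · have : ∀ x, Real.cos (|t| * x) = Real.cos (t * x) := fun x ↦ by
      rcases abs_choice t with h | h
      · rw [h]
      · rw [h, neg_mul, Real.cos_neg]
    simp [this]
  · refine Integrable.of_bound (by fun_prop) 1 (ae_of_all _ fun x ↦ ?_)
    exact Real.abs_cos_le_one _

/-- Existence of the symmetric `p`-stable law. -/
theorem exists_stable {p : ℝ} (hp : 0 < p) (hp2 : p ≤ 2) :
    ∃ ν : Measure ℝ, IsProbabilityMeasure ν ∧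
      ∀ t, charFun ν t = ((Real.exp (-|t| ^ p) : ℝ) : ℂ) := by
  rcases hp2.eq_or_lt with rfl | hp2
  -- At `p = 2` the integral defining `κ` diverges at `0`; the Gaussian of variance `2` has the
  -- required characteristic function.
  · refine ⟨gaussianReal 0 2, inferInstance, fun t ↦ ?_⟩
    rw [charFun_gaussianReal]
    push_cast
    congr 1
    have : |t| ^ (2 : ℝ) = t ^ 2 := by rw [Real.rpow_two, sq_abs]
    rw [this]
    push_cast
    simp
  have := isProbabilityMeasure_paretoMeasure one_pos hp
  set g : ℝ → ℝ := fun u ↦ (1 - Real.cos u) * u ^ (-(p + 1)) with hgdef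
  have hg := integrableOn_one_sub_cos_mul_rpow hp hp2
  set κ : ℝ := p * ∫ u in Set.Ioi (0 : ℝ), g u with hκ
  have hκ0 : 0 < κ := mul_pos hp (integral_one_sub_cos_mul_rpow_pos hp hp2)
  -- Chosen so that `N * κ * r N ^ p = 1`: the characteristic function of one rescaled summand is
  -- then `1 - |t| ^ p / N` to first order.
  let r : ℕ → ℝ := fun N ↦ ((N : ℝ) * κ) ^ (-p⁻¹)
  have hr0 : ∀ N, 0 ≤ r N := fun N ↦ by positivity
  have hr : Tendsto r atTop (𝓝 0) :=
    (tendsto_rpow_neg_atTop (inv_pos.2 hp)).comp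
      (tendsto_natCast_atTop_atTop.atTop_mul_const hκ0)
  let μ : ℕ → Measure ℝ := fun N ↦ (convPow (symmetrize (paretoMeasure 1 p)) N).map (r N * ·)
  have hμ : ∀ N, IsProbabilityMeasure (μ N) := fun N ↦
    Measure.isProbabilityMeasure_map (by fun_prop)
  have hlim (t : ℝ) : Tendsto (fun N ↦ charFun (μ N) t) atTop
      (𝓝 ((Real.exp (-|t| ^ p) : ℝ) : ℂ)) := by
    have h1 (N : ℕ) : charFun (μ N) t = (((1 + -(p * |r N * t| ^ p *
        ∫ u in Set.Ioi |r N * t|, g u)) ^ N : ℝ) : ℂ) := by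
      simp only [μ]
      rw [charFun_map_mul, charFun_convPow, charFun_symmetrize, integral_cos_pareto hp]
      push_cast
      ring
    simp_rw [h1]
    refine (Complex.continuous_ofReal.tendsto _).comp
      (Real.tendsto_one_add_pow_exp_of_tendsto ?_)
    have h2 : Tendsto (fun N : ℕ ↦ ∫ u in Set.Ioi |r N * t|, g u) atTop
        (𝓝 (∫ u in Set.Ioi 0, g u)) := by
      refine tendsto_setIntegral_Ioi_zero hg (fun _ ↦ abs_nonneg _) ?_
      simpa using (hr.mul_const t).abs
    have h3 := (h2.const_mul (-(p * κ⁻¹ * |t| ^ p)))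
    have h4 : -(p * κ⁻¹ * |t| ^ p) * ∫ u in Set.Ioi 0, g u = -|t| ^ p := by
      have : p * ∫ u in Set.Ioi 0, g u = κ := rfl
      calc _ = -(κ⁻¹ * |t| ^ p * (p * ∫ u in Set.Ioi 0, g u)) := by ring
        _ = _ := by rw [this]; field_simp
    rw [h4] at h3
    refine h3.congr' ?_
    filter_upwards [eventually_gt_atTop 0] with N hN
    have hN' : (0 : ℝ) < N := by exact_mod_cast hN
    have h5 : |r N * t| ^ p = (N : ℝ)⁻¹ * κ⁻¹ * |t| ^ p := by
      rw [abs_mul, abs_of_nonneg (hr0 N), Real.mul_rpow (hr0 N) (abs_nonneg _)]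
      simp only [r]
      rw [← Real.rpow_mul (by positivity), neg_mul, inv_mul_cancel₀ hp.ne', Real.rpow_neg_one,
        mul_inv]
    rw [h5]
    field_simp
  have hcont : Continuous fun t : ℝ ↦ ((Real.exp (-|t| ^ p) : ℝ) : ℂ) := by
    have : Continuous fun t : ℝ ↦ |t| ^ p := continuous_abs.rpow_const fun _ ↦ Or.inr hp.le
    fun_prop
  obtain ⟨ν, hν⟩ := exists_charFun_eq_of_tendsto (μ := fun N ↦ ⟨μ N, hμ N⟩)
    hcont.continuousAt hlim
  exact ⟨ν, inferInstance, hν⟩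

end MsgPassing

/-! ### Moments of stable laws and of stable linear forms, uniformly in `p` -/

namespace MsgPassing

open MeasureTheory ProbabilityTheory Filter Topology

/-- `ν` is the symmetric `p`-stable law, normalized to have characteristic function
`exp (-|t| ^ p)`. -/
def IsStable (p : ℝ) (ν : Measure ℝ) : Prop :=
  ∀ t, charFun ν t = ((Real.exp (-|t| ^ p) : ℝ) : ℂ)

lemma measurable_abs_rpow (q : ℝ) : Measurable fun x : ℝ ↦ |x| ^ q := by fun_prop

lemma measurable_dot {n : ℕ} (y : Fin n → ℝ) : Measurable fun z : Fin n → ℝ ↦ ∑ j, z j * y j := by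
  fun_prop

section

variable {p : ℝ} {ν : Measure ℝ} [IsProbabilityMeasure ν]

/-- For `|t| ≤ 1` one has `1 - exp (-|t| ^ p) ≤ |t| ^ p ≤ |t|`, and the tail beyond `r` is
controlled by the average of `1 - charFun` over `|t| ≤ 2 / r`. For `r < 2` the bound exceeds `1`. -/
lemma IsStable.tail_le (h : IsStable p ν) (hp : 1 ≤ p) {r : ℝ} (hr : 0 < r) :
    ν.real {x | r < |x|} ≤ 4 / r := by
  rcases lt_or_ge r 2 with hr2 | hr2
  · refine measureReal_le_one.trans ?_
    rw [le_div_iff₀ hr]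
    linarith
  have h1 := measureReal_abs_gt_le_integral_charFun (μ := ν) hr
  have h2 : ‖∫ t in (-2 * r⁻¹)..(2 * r⁻¹), 1 - charFun ν t‖
      ≤ 2 * r⁻¹ * |2 * r⁻¹ - (-2 * r⁻¹)| := by
    refine intervalIntegral.norm_integral_le_of_norm_le_const fun t ht ↦ ?_
    have h3 : |t| ≤ 2 * r⁻¹ := by
      rw [Set.uIoc_of_le (by have := inv_pos.2 hr; linarith)] at ht
      exact abs_le.2 ⟨by linarith [ht.1], ht.2⟩
    have h4 : 2 * r⁻¹ ≤ 1 := by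
      rw [← div_eq_mul_inv, div_le_one hr]; exact hr2
    rw [h t, ← Complex.ofReal_one, ← Complex.ofReal_sub, Complex.norm_real, Real.norm_of_nonneg]
    · have h5 := Real.add_one_le_exp (-|t| ^ p)
      have h6 : |t| ^ p ≤ |t| ^ (1 : ℝ) :=
        Real.rpow_le_rpow_of_exponent_ge_of_imp (abs_nonneg t) (h3.trans h4) hp (by grind)
      rw [Real.rpow_one] at h6
      linarith
    · have : Real.exp (-|t| ^ p) ≤ 1 := Real.exp_le_one_iff.2 (by
        have := Real.rpow_nonneg (abs_nonneg t) p; linarith)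
      linarith
  rw [abs_of_nonneg (by have := inv_pos.2 hr; linarith)] at h2
  calc _ ≤ 2⁻¹ * r * (2 * r⁻¹ * (2 * r⁻¹ - (-2 * r⁻¹))) := by
        refine h1.trans ?_; gcongr
    _ = 4 / r := by field_simp; ring

/-- Layer cake: on `(0, 1]` the tail is at most `1`, contributing `2`; beyond `1` the tail `4 / t`
contributes `8`; the prefactor `1 / 2` gives `5`. -/
lemma IsStable.lintegral_rpow_half_le (h : IsStable p ν) (hp : 1 ≤ p) :
    ∫⁻ x, ENNReal.ofReal (|x| ^ (1 / 2 : ℝ)) ∂ν ≤ 5 := by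
  rw [lintegral_rpow_eq_lintegral_meas_lt_mul ν (ae_of_all _ fun x ↦ abs_nonneg x)
    (by fun_prop) (by norm_num : (0 : ℝ) < 1 / 2), ← Set.Ioc_union_Ioi_eq_Ioi (zero_le_one' ℝ),
    lintegral_union measurableSet_Ioi (Set.Ioc_disjoint_Ioi le_rfl)]
  have h1 : ∫⁻ t in Set.Ioc (0 : ℝ) 1, ν {a | t < |a|} * ENNReal.ofReal (t ^ (1 / 2 - 1 : ℝ)) ≤
      2 := by
    calc _ ≤ ∫⁻ t in Set.Ioc (0 : ℝ) 1, ENNReal.ofReal (t ^ (1 / 2 - 1 : ℝ)) := by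
          refine lintegral_mono fun t ↦ ?_
          exact mul_le_of_le_one_left zero_le prob_le_one
      _ = ENNReal.ofReal (∫ t in Set.Ioc (0 : ℝ) 1, t ^ (1 / 2 - 1 : ℝ)) := by
          rw [ofReal_integral_eq_lintegral_ofReal]
          · have := (intervalIntegral.intervalIntegrable_rpow' (a := 0) (b := 1)
              (show (-1 : ℝ) < 1 / 2 - 1 by norm_num))
            rwa [intervalIntegrable_iff_integrableOn_Ioc_of_le zero_le_one] at this
          · exact (ae_restrict_mem measurableSet_Ioc).mono fun t ht ↦ Real.rpow_nonneg ht.1.le _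
      _ = 2 := by
          rw [← intervalIntegral.integral_of_le zero_le_one,
            integral_rpow (Or.inl (by norm_num))]
          norm_num
  have h2 : ∫⁻ t in Set.Ioi (1 : ℝ), ν {a | t < |a|} * ENNReal.ofReal (t ^ (1 / 2 - 1 : ℝ)) ≤
      8 := by
    calc _ ≤ ∫⁻ t in Set.Ioi (1 : ℝ), ENNReal.ofReal (4 * t ^ (-3 / 2 : ℝ)) := by
          refine setLIntegral_mono (by fun_prop) fun t ht ↦ ?_
          have ht0 : (0 : ℝ) < t := one_pos.trans ht
          have := h.tail_le hp ht0
          rw [← ofReal_measureReal, ← ENNReal.ofReal_mul measureReal_nonneg]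
          apply ENNReal.ofReal_le_ofReal
          calc _ ≤ 4 / t * t ^ (1 / 2 - 1 : ℝ) := by gcongr
            _ = 4 * t ^ (-3 / 2 : ℝ) := by
              rw [show (-3 / 2 : ℝ) = (1 / 2 - 1) - 1 by norm_num, Real.rpow_sub_one ht0.ne' (1 / 2 - 1)]
              ring
      _ = ENNReal.ofReal (∫ t in Set.Ioi (1 : ℝ), 4 * t ^ (-3 / 2 : ℝ)) := by
          rw [ofReal_integral_eq_lintegral_ofReal]
          · exact (integrableOn_Ioi_rpow_of_lt (by norm_num) one_pos).const_mul 4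
          · exact (ae_restrict_mem measurableSet_Ioi).mono fun t ht ↦
              mul_nonneg (by norm_num) (Real.rpow_nonneg (one_pos.trans ht).le _)
      _ = 8 := by
          rw [integral_const_mul, integral_Ioi_rpow_of_lt (by norm_num) one_pos]
          norm_num
  calc _ ≤ ENNReal.ofReal (1 / 2) * (2 + 8) := by gcongr
    _ = 5 := by
      rw [show (2 + 8 : ENNReal) = ENNReal.ofReal 10 by norm_num,
        ← ENNReal.ofReal_mul (by norm_num)]
      norm_num

lemma IsStable.integrable_rpow_half (h : IsStable p ν) (hp : 1 ≤ p) :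
    Integrable (fun x ↦ |x| ^ (1 / 2 : ℝ)) ν := by
  refine ⟨(measurable_abs_rpow _).aestronglyMeasurable, ?_⟩
  rw [hasFiniteIntegral_iff_ofReal (ae_of_all _ fun x ↦ by positivity)]
  exact (h.lintegral_rpow_half_le hp).trans_lt (by simp)

lemma IsStable.integral_rpow_half_le (h : IsStable p ν) (hp : 1 ≤ p) :
    ∫ x, |x| ^ (1 / 2 : ℝ) ∂ν ≤ 5 := by
  rw [integral_eq_lintegral_of_nonneg_ae (ae_of_all _ fun x ↦ by positivity)
    (measurable_abs_rpow _).aestronglyMeasurable]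
  exact ENNReal.toReal_le_of_le_ofReal (by norm_num)
    ((h.lintegral_rpow_half_le hp).trans (by simp))

lemma IsStable.integrable_rpow_quarter (h : IsStable p ν) (hp : 1 ≤ p) :
    Integrable (fun x ↦ |x| ^ (1 / 4 : ℝ)) ν := by
  refine Integrable.mono' ((integrable_const 1).add (h.integrable_rpow_half hp))
    (measurable_abs_rpow _).aestronglyMeasurable (ae_of_all _ fun x ↦ ?_)
  rw [Real.norm_of_nonneg (by positivity)]
  simp only [Pi.add_apply]
  have h1 : |x| ^ (1 / 2 : ℝ) = (|x| ^ (1 / 4 : ℝ)) ^ 2 := by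
    rw [← Real.rpow_natCast, ← Real.rpow_mul (abs_nonneg x)]; norm_num
  nlinarith [sq_nonneg (|x| ^ (1 / 4 : ℝ) - 1)]

/-- The absolute moment of order `1 / 4`. -/
noncomputable def quarterMoment (ν : Measure ℝ) : ℝ := ∫ x, |x| ^ (1 / 4 : ℝ) ∂ν

lemma IsStable.quarterMoment_le (h : IsStable p ν) (hp : 1 ≤ p) : quarterMoment ν ≤ 6 := by
  have h2 : quarterMoment ν ≤ ∫ x, (1 + |x| ^ (1 / 2 : ℝ)) ∂ν := by
    refine integral_mono (h.integrable_rpow_quarter hp)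
      ((integrable_const 1).add (h.integrable_rpow_half hp)) fun x ↦ ?_
    have h1 : |x| ^ (1 / 2 : ℝ) = (|x| ^ (1 / 4 : ℝ)) ^ 2 := by
      rw [← Real.rpow_natCast, ← Real.rpow_mul (abs_nonneg x)]; norm_num
    simp only
    nlinarith [sq_nonneg (|x| ^ (1 / 4 : ℝ) - 1)]
  rw [integral_add (by simp) (h.integrable_rpow_half hp)] at h2
  have := h.integral_rpow_half_le hp
  simp at h2 this
  linarith

/-- Evaluating the characteristic function at `1` gives `∫ (1 - cos x) = 1 - e⁻¹ > 1 / 2`, and `1 -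
cos x ≤ 2 |x| ^ (1/4)` pointwise. -/
lemma IsStable.le_quarterMoment (h : IsStable p ν) (hp : 1 ≤ p) : 1 / 4 ≤ quarterMoment ν := by
  have h1 : ∫ x, Real.cos x ∂ν = Real.exp (-1) := by
    have h2 := congrArg Complex.re (h 1)
    rw [charFun_apply_real, ← RCLike.re_eq_complex_re, ← integral_re] at h2
    · simp only [Complex.ofReal_one, one_mul, RCLike.re_eq_complex_re, Complex.exp_ofReal_mul_I_re,
        abs_one, Real.one_rpow, Complex.ofReal_re] at h2
      exact h2
    · refine Integrable.of_bound (by fun_prop) 1 (ae_of_all _ fun x ↦ ?_)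
      rw [← Complex.ofReal_mul, Complex.norm_exp_ofReal_mul_I]
  have hcos : Integrable Real.cos ν :=
    Integrable.of_bound (by fun_prop) 1 (ae_of_all _ fun x ↦ Real.abs_cos_le_one x)
  have h3 : ∫ x, (1 - Real.cos x) ∂ν ≤ ∫ x, 2 * |x| ^ (1 / 4 : ℝ) ∂ν := by
    refine integral_mono ((integrable_const 1).sub hcos)
      ((h.integrable_rpow_quarter hp).const_mul 2) fun x ↦ ?_
    simp only
    rcases le_total |x| 1 with hx | hx
    · have h4 : |x| ^ (2 : ℝ) ≤ |x| ^ (1 / 4 : ℝ) :=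
        Real.rpow_le_rpow_of_exponent_ge_of_imp (abs_nonneg x) hx (by norm_num) (by norm_num)
      rw [Real.rpow_two, sq_abs] at h4
      have := Real.one_sub_sq_div_two_le_cos (x := x)
      nlinarith [sq_nonneg x]
    · have h4 : 1 ≤ |x| ^ (1 / 4 : ℝ) := Real.one_le_rpow hx (by norm_num)
      linarith [Real.neg_one_le_cos x]
  rw [integral_sub (by simp) hcos, h1, integral_const_mul] at h3
  simp only [integral_const, probReal_univ, smul_eq_mul, mul_one] at h3
  have h5 := Real.exp_neg_one_lt_half
  unfold quarterMoment
  linarith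

/-- The defining property of stable laws. -/
lemma IsStable.map_pi (h : IsStable p ν) (hp : 0 < p) {n : ℕ} (y : Fin n → ℝ) :
    (Measure.pi fun _ : Fin n ↦ ν).map (fun z ↦ ∑ j, z j * y j)
      = ν.map (fun z ↦ (∑ j, |y j| ^ p) ^ p⁻¹ * z) := by
  have : IsProbabilityMeasure ((Measure.pi fun _ : Fin n ↦ ν).map (fun z ↦ ∑ j, z j * y j)) :=
    Measure.isProbabilityMeasure_map (measurable_dot y).aemeasurable
  have : IsProbabilityMeasure (ν.map (fun z ↦ (∑ j, |y j| ^ p) ^ p⁻¹ * z)) :=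
    Measure.isProbabilityMeasure_map (by fun_prop)
  refine Measure.ext_of_charFun (funext fun t ↦ ?_)
  have hF : 0 ≤ ∑ j, |y j| ^ p := by positivity
  rw [charFun_map_mul, h, charFun_apply_real,
    integral_map (measurable_dot y).aemeasurable (by fun_prop)]
  have h1 (z : Fin n → ℝ) : Complex.exp (t * (∑ j, z j * y j : ℝ) * Complex.I)
      = ∏ j, Complex.exp ((t * y j : ℝ) * z j * Complex.I) := by
    rw [← Complex.exp_sum]
    congr 1
    push_cast
    rw [Finset.mul_sum, Finset.sum_mul]
    exact Finset.sum_congr rfl fun j _ ↦ by ring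
  simp_rw [h1]
  rw [integral_fintype_prod_eq_prod (fun j (x : ℝ) ↦ Complex.exp ((t * y j : ℝ) * x * Complex.I))]
  simp_rw [← charFun_apply_real, h _]
  rw [← Complex.ofReal_prod, ← Real.exp_sum, abs_mul, abs_of_nonneg (by positivity),
    Real.mul_rpow (by positivity) (abs_nonneg t), ← Real.rpow_mul hF, inv_mul_cancel₀ hp.ne',
    Real.rpow_one, Finset.sum_neg_distrib, Finset.sum_mul]
  congr 4
  funext j
  rw [abs_mul, Real.mul_rpow (abs_nonneg _) (abs_nonneg _), mul_comm]

lemma IsStable.integral_pi (h : IsStable p ν) (hp : 0 < p) {n : ℕ} (y : Fin n → ℝ) {q : ℝ} :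
    ∫ z, |∑ j, z j * y j| ^ q ∂(Measure.pi fun _ : Fin n ↦ ν)
      = (∑ j, |y j| ^ p) ^ (q / p) * ∫ x, |x| ^ q ∂ν := by
  have hF : 0 ≤ ∑ j, |y j| ^ p := by positivity
  have h1 : ∫ z, |∑ j, z j * y j| ^ q ∂(Measure.pi fun _ : Fin n ↦ ν)
      = ∫ x, |x| ^ q ∂((Measure.pi fun _ : Fin n ↦ ν).map (fun z ↦ ∑ j, z j * y j)) := by
    rw [integral_map (measurable_dot y).aemeasurable (measurable_abs_rpow q).aestronglyMeasurable]
  rw [h1, h.map_pi hp, integral_map (by fun_prop) (measurable_abs_rpow q).aestronglyMeasurable,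
    ← integral_const_mul]
  congr with x
  rw [abs_mul, abs_of_nonneg (by positivity), Real.mul_rpow (by positivity) (abs_nonneg _),
    ← Real.rpow_mul hF, inv_mul_eq_div]

lemma IsStable.integrable_pi (h : IsStable p ν) (hp : 0 < p) {n : ℕ} (y : Fin n → ℝ) {q : ℝ}
    (hq : Integrable (fun x ↦ |x| ^ q) ν) :
    Integrable (fun z ↦ |∑ j, z j * y j| ^ q) (Measure.pi fun _ : Fin n ↦ ν) := by
  have hF : 0 ≤ ∑ j, |y j| ^ p := by positivity
  have h1 : Integrable (fun x ↦ |x| ^ q)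
      ((Measure.pi fun _ : Fin n ↦ ν).map (fun z ↦ ∑ j, z j * y j)) := by
    rw [h.map_pi hp, integrable_map_measure (measurable_abs_rpow q).aestronglyMeasurable (by fun_prop)]
    refine (hq.const_mul ((∑ j, |y j| ^ p) ^ (q / p))).congr (ae_of_all _ fun x ↦ ?_)
    simp only [Function.comp]
    rw [abs_mul, abs_of_nonneg (a := (∑ j, |y j| ^ p) ^ p⁻¹) (by positivity),
      Real.mul_rpow (by positivity) (abs_nonneg _), ← Real.rpow_mul hF, inv_mul_eq_div]
  rwa [integrable_map_measure (measurable_abs_rpow q).aestronglyMeasurable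
    (measurable_dot y).aemeasurable] at h1

end

end MsgPassing

namespace MsgPassing

open MeasureTheory ProbabilityTheory Filter Topology

/-! ### Random signs and square functions -/

/-- A substitute for Jensen's inequality: if `l` bounds the mean of `x`, averaging bounds the mean
of `x ^ s` by `2 * l ^ s`. -/
lemma rpow_le_mul_one_add_div {x l s : ℝ} (hx : 0 ≤ x) (hl : 0 < l) (hs : 0 ≤ s) (hs1 : s ≤ 1) :
    x ^ s ≤ l ^ s * (1 + x / l) := by
  have h1 : x ^ s = l ^ s * (x / l) ^ s := by
    rw [← Real.mul_rpow hl.le (by positivity)]; congr 1; field_simp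
  rw [h1]
  gcongr
  have h0 : 0 ≤ x / l := by positivity
  rcases le_total (x / l) 1 with h | h
  · linarith [Real.rpow_le_one h0 h hs]
  · have := Real.rpow_le_rpow_of_exponent_le h hs1
    rw [Real.rpow_one] at this
    linarith

/-- The sum of the numbers `a v` with the signs prescribed by `s`. -/
def signSum {m : ℕ} (a : Fin m → ℝ) (s : Fin m → Bool) : ℝ :=
  ∑ v, (if s v then 1 else -1) * a v

lemma sum_comp_signSum_succ {m : ℕ} (a : Fin (m + 1) → ℝ) (f : ℝ → ℝ) :
    ∑ s, f (signSum a s) = ∑ s, (f (a 0 + signSum (Fin.tail a) s)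
      + f (-a 0 + signSum (Fin.tail a) s)) := by
  rw [← (Fin.consEquiv fun _ ↦ Bool).sum_comp, Fintype.sum_prod_type, Fintype.sum_bool,
    ← Finset.sum_add_distrib]
  refine Finset.sum_congr rfl fun s _ ↦ ?_
  simp [signSum, Fin.consEquiv, Fin.sum_univ_succ, Fin.tail]

lemma sum_signSum_sq {m : ℕ} (a : Fin m → ℝ) :
    ∑ s, signSum a s ^ 2 = 2 ^ m * ∑ v, a v ^ 2 := by
  induction m with
  | zero => simp [signSum]
  | succ m ih =>
    rw [sum_comp_signSum_succ a (· ^ 2), Fin.sum_univ_succ]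
    have := ih (Fin.tail a)
    calc _ = ∑ s, (2 * a 0 ^ 2 + 2 * signSum (Fin.tail a) s ^ 2) := by
          refine Finset.sum_congr rfl fun s _ ↦ ?_; ring
      _ = _ := by
          simp only [Finset.sum_add_distrib, ← Finset.mul_sum]
          rw [this]
          simp [Fin.tail]
          ring

/-- Averaging over the first sign leaves `a⁴ + 6 a² S² + S⁴`. Against `3 (a² + Q)²`, where `Q` is
the remaining sum of squares, the mixed terms match exactly and the slack is in `a⁴`. -/
lemma sum_signSum_pow_four_le {m : ℕ} (a : Fin m → ℝ) :
    ∑ s, signSum a s ^ 4 ≤ 3 * 2 ^ m * (∑ v, a v ^ 2) ^ 2 := by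
  induction m with
  | zero => simp [signSum]
  | succ m ih =>
    rw [sum_comp_signSum_succ a (· ^ 4), Fin.sum_univ_succ]
    have h1 := ih (Fin.tail a)
    have h2 := sum_signSum_sq (Fin.tail a)
    have h3 : ∑ v, Fin.tail a v ^ 2 = ∑ v : Fin m, a v.succ ^ 2 := rfl
    rw [h3] at h1 h2
    calc _ = ∑ s, (2 * a 0 ^ 4 + 12 * a 0 ^ 2 * signSum (Fin.tail a) s ^ 2
            + 2 * signSum (Fin.tail a) s ^ 4) := by
          refine Finset.sum_congr rfl fun s _ ↦ ?_; ring
      _ ≤ _ := by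
          simp only [Finset.sum_add_distrib, ← Finset.mul_sum]
          rw [h2]
          simp only [Finset.sum_const, Finset.card_univ, Fintype.card_pi, Fintype.card_bool,
            Finset.prod_const, Fintype.card_fin, nsmul_eq_mul]
          push_cast
          have : (0 : ℝ) < 2 ^ m := by positivity
          have h4 : 0 ≤ 2 ^ m * a 0 ^ 4 := by positivity
          rw [pow_succ 2 m]
          nlinarith

/-- A Khintchine inequality for the moment of order `1 / 4`. -/
lemma rpow_sum_sq_le_sum_signSum {m : ℕ} (a : Fin m → ℝ) :
    (∑ v, a v ^ 2) ^ (1 / 8 : ℝ) ≤ 4 / 2 ^ m * ∑ s, |signSum a s| ^ (1 / 4 : ℝ) := by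
  set Q := ∑ v, a v ^ 2 with hQ
  have hQ0 : 0 ≤ Q := Finset.sum_nonneg fun v _ ↦ sq_nonneg _
  rcases hQ0.eq_or_lt with h0 | hpos
  · rw [← h0, Real.zero_rpow (by norm_num)]
    positivity
  -- With `x = r² / Q` this is `x - x² / 4 ≤ x ^ (1/8)`: for `x ≤ 1` because `x ≤ x ^ (1/8)`, for `x
  -- ≥ 1` because the left side never exceeds `1`. Averaging with the second and fourth moments
  -- gives at least `1 - 3/4 = 1/4`, hence the factor `4`.
  have key (r : ℝ) : Q ^ (1 / 8 : ℝ) * (r ^ 2 / Q - r ^ 4 / Q ^ 2 / 4) ≤ |r| ^ (1 / 4 : ℝ) := by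
    set x := r ^ 2 / Q with hx
    have hx0 : 0 ≤ x := by positivity
    have h1 : |r| ^ (1 / 4 : ℝ) = Q ^ (1 / 8 : ℝ) * x ^ (1 / 8 : ℝ) := by
      rw [← Real.mul_rpow hQ0 hx0, hx, mul_div_cancel₀ _ hpos.ne', ← sq_abs, ← Real.rpow_two,
        ← Real.rpow_mul (abs_nonneg _)]
      norm_num
    have h2 : r ^ 4 / Q ^ 2 = x ^ 2 := by rw [hx]; ring
    rw [h1, h2]
    gcongr
    rcases le_total x 1 with h | h
    · have := Real.rpow_le_rpow_of_exponent_ge_of_imp hx0 h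
        (by norm_num : (1 / 8 : ℝ) ≤ 1) (by norm_num)
      rw [Real.rpow_one] at this
      nlinarith [sq_nonneg x]
    · have : 1 ≤ x ^ (1 / 8 : ℝ) := Real.one_le_rpow h (by norm_num)
      nlinarith [sq_nonneg (x - 2)]
  have hsum : Q ^ (1 / 8 : ℝ) * (2 ^ m / 4) ≤ ∑ s, |signSum a s| ^ (1 / 4 : ℝ) := by
    calc _ ≤ Q ^ (1 / 8 : ℝ) * ((∑ s, signSum a s ^ 2) / Q - (∑ s, signSum a s ^ 4) / Q ^ 2 / 4) := by
          gcongr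
          have h4 := sum_signSum_pow_four_le a
          rw [sum_signSum_sq, ← hQ, mul_div_cancel_right₀ _ hpos.ne']
          have : (∑ s, signSum a s ^ 4) / Q ^ 2 ≤ 3 * 2 ^ m := by
            rw [div_le_iff₀ (by positivity)]; exact h4
          linarith
      _ = ∑ s, Q ^ (1 / 8 : ℝ) * (signSum a s ^ 2 / Q - signSum a s ^ 4 / Q ^ 2 / 4) := by
          rw [← Finset.mul_sum, Finset.sum_sub_distrib, Finset.sum_div, Finset.sum_div,
            Finset.sum_div]
      _ ≤ _ := Finset.sum_le_sum fun s _ ↦ key _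
  rw [div_mul_eq_mul_div, le_div_iff₀ (by positivity)]
  linarith

lemma rpow_sum_le_sum_rpow {ι : Type*} (t : Finset ι) (f : ι → ℝ) (hf : ∀ i, 0 ≤ f i) {s : ℝ}
    (hs : 0 < s) (hs1 : s ≤ 1) : (∑ i ∈ t, f i) ^ s ≤ ∑ i ∈ t, f i ^ s := by
  classical
  induction t using Finset.induction_on with
  | empty => simp [Real.zero_rpow hs.ne']
  | insert i t hi ih =>
    rw [Finset.sum_insert hi, Finset.sum_insert hi]
    exact (Real.rpow_add_le_add_rpow (hf i) (Finset.sum_nonneg fun j _ ↦ hf j) hs.le hs1).trans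
      (by gcongr)

/-- The second moment controls the `p`-th one by concavity of `x ^ (p/2)`, and subadditivity of the
same power turns the `ℓ²` norm into an `ℓᵖ` sum. -/
lemma sum_abs_signSum_rpow_le {m : ℕ} (a : Fin m → ℝ) {p : ℝ} (hp : 0 < p) (hp2 : p ≤ 2) :
    ∑ s, |signSum a s| ^ p ≤ 2 * 2 ^ m * ∑ v, |a v| ^ p := by
  have hpow (r : ℝ) : |r| ^ p = (r ^ 2) ^ (p / 2) := by
    rw [← sq_abs, ← Real.rpow_two, ← Real.rpow_mul (abs_nonneg r)]; congr 1; ring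
  simp_rw [hpow]
  set Q := ∑ v, a v ^ 2 with hQ
  have hQ0 : 0 ≤ Q := Finset.sum_nonneg fun v _ ↦ sq_nonneg _
  have h1 : Q ^ (p / 2) ≤ ∑ v, (a v ^ 2) ^ (p / 2) :=
    rpow_sum_le_sum_rpow _ _ (fun _ ↦ sq_nonneg _) (by positivity) (by linarith)
  have h2 := sum_signSum_sq a
  rcases hQ0.eq_or_lt with h0 | hpos
  · rw [← hQ, ← h0, mul_zero, Finset.sum_eq_zero_iff_of_nonneg (fun _ _ ↦ sq_nonneg _)] at h2
    rw [Finset.sum_congr rfl fun s hs ↦ by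
      rw [h2 s hs, Real.zero_rpow (by positivity : p / 2 ≠ 0)]]
    simp only [Finset.sum_const_zero]
    positivity
  calc _ ≤ ∑ s, Q ^ (p / 2) * (1 + signSum a s ^ 2 / Q) :=
        Finset.sum_le_sum fun s _ ↦
          rpow_le_mul_one_add_div (sq_nonneg _) hpos (by positivity) (by linarith)
    _ = 2 * 2 ^ m * Q ^ (p / 2) := by
        rw [← Finset.mul_sum, Finset.sum_add_distrib, ← Finset.sum_div, h2, ← hQ,
          mul_div_cancel_right₀ _ hpos.ne']
        simp only [Finset.sum_const, Finset.card_univ, Fintype.card_pi, Fintype.card_bool,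
          Finset.prod_const, Fintype.card_fin, nsmul_eq_mul]
        push_cast
        ring
    _ ≤ _ := by gcongr

/-- The square function of stable linear forms is bounded in the moment of order `1 / 4`. -/
lemma IsStable.lintegral_sum_sq_le {p : ℝ} {ν : Measure ℝ} [IsProbabilityMeasure ν]
    (h : IsStable p ν) (hp : 1 ≤ p) (hp2 : p ≤ 2) {m n : ℕ} (x : Fin m → Fin n → ℝ) :
    ∫⁻ z, ENNReal.ofReal ((∑ v, (∑ j, z j * x v j) ^ 2) ^ (1 / 8 : ℝ))
        ∂(Measure.pi fun _ : Fin n ↦ ν)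
      ≤ ENNReal.ofReal (12 * quarterMoment ν * (∑ v, ∑ j, |x v j| ^ p) ^ (1 / 4 / p)) := by
  have hp0 : 0 < p := by linarith
  -- For fixed signs the signed sum of linear forms is one linear form in `z`, so stability computes
  -- its moment exactly.
  have hsw (z : Fin n → ℝ) (s : Fin m → Bool) : signSum (fun v ↦ ∑ j, z j * x v j) s
      = ∑ j, z j * signSum (fun v ↦ x v j) s := by
    simp only [signSum, Finset.mul_sum]
    rw [Finset.sum_comm]
    exact Finset.sum_congr rfl fun j _ ↦ Finset.sum_congr rfl fun v _ ↦ by ring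
  have hintg (s : Fin m → Bool) := h.integrable_pi hp0 (fun j ↦ signSum (fun v ↦ x v j) s)
    (h.integrable_rpow_quarter hp)
  have hq0 : 0 ≤ quarterMoment ν := by have := h.le_quarterMoment hp; linarith
  calc _ ≤ ∫⁻ z, ENNReal.ofReal (4 / 2 ^ m *
          ∑ s, |∑ j, z j * signSum (fun v ↦ x v j) s| ^ (1 / 4 : ℝ))
          ∂(Measure.pi fun _ : Fin n ↦ ν) := by
        refine lintegral_mono fun z ↦ ENNReal.ofReal_le_ofReal ?_
        simp_rw [← hsw]
        exact rpow_sum_sq_le_sum_signSum _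
    _ = ENNReal.ofReal (4 / 2 ^ m * ∑ s,
          (∑ j, |signSum (fun v ↦ x v j) s| ^ p) ^ (1 / 4 / p) * quarterMoment ν) := by
        rw [← ofReal_integral_eq_lintegral_ofReal
          ((integrable_finsetSum _ fun s _ ↦ hintg s).const_mul _)
          (ae_of_all _ fun z ↦ by positivity), integral_const_mul,
          integral_finsetSum _ fun s _ ↦ hintg s]
        simp_rw [h.integral_pi hp0]
        rfl
    _ ≤ _ := by
        apply ENNReal.ofReal_le_ofReal
        set l := ∑ v, ∑ j, |x v j| ^ p with hl
        have hl0 : 0 ≤ l := by positivity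
        have hN0 (s : Fin m → Bool) : 0 ≤ ∑ j, |signSum (fun v ↦ x v j) s| ^ p := by positivity
        have hN : ∑ s, ∑ j, |signSum (fun v ↦ x v j) s| ^ p ≤ 2 * 2 ^ m * l := by
          have hl' : l = ∑ j, ∑ v, |x v j| ^ p := Finset.sum_comm
          rw [Finset.sum_comm, hl', Finset.mul_sum]
          exact Finset.sum_le_sum fun j _ ↦ sum_abs_signSum_rpow_le _ hp0 hp2
        -- The power `1/4/p ≤ 1` is concave, so the bound `2 * l` on the average over signs gives `1
        -- + 2 = 3`; the Khintchine factor `4` then makes `12`.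
        have h1 : ∑ s, (∑ j, |signSum (fun v ↦ x v j) s| ^ p) ^ (1 / 4 / p)
            ≤ 3 * 2 ^ m * l ^ (1 / 4 / p) := by
          rcases hl0.eq_or_lt with h0 | hpos
          · rw [← h0, mul_zero] at hN
            have hz := (Finset.sum_eq_zero_iff_of_nonneg (fun s _ ↦ hN0 s)).1
              (le_antisymm hN (Finset.sum_nonneg fun s _ ↦ hN0 s))
            rw [Finset.sum_congr rfl fun s hs ↦ by
              rw [hz s hs, Real.zero_rpow (by positivity : 1 / 4 / p ≠ 0)]]
            simp only [Finset.sum_const_zero]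
            positivity
          · calc _ ≤ ∑ s : Fin m → Bool, l ^ (1 / 4 / p) *
                  (1 + (∑ j, |signSum (fun v ↦ x v j) s| ^ p) / l) :=
                  Finset.sum_le_sum fun s _ ↦ rpow_le_mul_one_add_div (hN0 s) hpos (by positivity)
                    (by rw [div_le_one hp0]; linarith)
              _ = l ^ (1 / 4 / p) *
                  (2 ^ m + (∑ s, ∑ j, |signSum (fun v ↦ x v j) s| ^ p) / l) := by
                  rw [← Finset.mul_sum, Finset.sum_add_distrib, ← Finset.sum_div]
                  simp
              _ ≤ l ^ (1 / 4 / p) * (2 ^ m + 2 * 2 ^ m) := by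
                  gcongr
                  rwa [div_le_iff₀ hpos]
              _ = _ := by ring
        rw [← Finset.sum_mul]
        calc _ ≤ 4 / 2 ^ m * (3 * 2 ^ m * l ^ (1 / 4 / p) * quarterMoment ν) := by gcongr
          _ = _ := by field_simp; ring

end MsgPassing

namespace MsgPassing

open MeasureTheory ProbabilityTheory Filter Topology

/-! ### Unbiased floating point rounding -/

/-- The binary exponent of `y`, cut off at `-A`. -/
noncomputable def expo (A : ℕ) (y : ℝ) : ℤ := max ⌊Real.logb 2 |y|⌋ (-A)

/-- The spacing of the floating point numbers with `b` bits of mantissa near `y`. -/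
noncomputable def spacing (A b : ℕ) (y : ℝ) : ℝ := 2 ^ (expo A y - b)

/-- Floating point rounding of `y` with shift `u`; unbiased for uniformly distributed `u`. -/
noncomputable def fround (A b : ℕ) (y u : ℝ) : ℝ :=
  spacing A b y * ⌊y / spacing A b y + Int.fract u⌋

/-- The uniform distribution on the unit interval. -/
noncomputable def unif : Measure ℝ := volume.restrict (Set.Ico 0 1)

instance : IsProbabilityMeasure unif := ⟨by simp [unif]⟩

variable {A b : ℕ} {y u : ℝ}

lemma spacing_pos : 0 < spacing A b y := by unfold spacing; positivity

@[simp] lemma fround_zero : fround A b 0 u = 0 := by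
  simp [fround]

lemma abs_lt_two_zpow_expo : |y| < 2 ^ (expo A y + 1) := by
  rcases eq_or_ne y 0 with rfl | hy
  · simp only [abs_zero]; positivity
  rw [← Real.rpow_intCast, ← Real.logb_lt_iff_lt_rpow one_lt_two (abs_pos.2 hy)]
  refine (Int.lt_floor_add_one _).trans_le ?_
  push_cast
  gcongr
  exact_mod_cast le_max_left _ _

lemma abs_fround_sub_le : |fround A b y u - y| ≤ spacing A b y := by
  have hs := spacing_pos (A := A) (b := b) (y := y)
  set s := spacing A b y
  have h1 : fround A b y u - y = s * (⌊y / s + Int.fract u⌋ - y / s) := by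
    unfold fround; rw [mul_sub, mul_div_cancel₀ _ hs.ne']
  rw [h1, abs_mul, abs_of_pos hs]
  refine mul_le_of_le_one_right hs.le ?_
  have h2 := Int.floor_le (y / s + Int.fract u)
  have h3 := Int.lt_floor_add_one (y / s + Int.fract u)
  have h4 := Int.fract_nonneg u
  have h5 := Int.fract_lt_one u
  exact abs_le.2 ⟨by linarith, by linarith⟩

/-- Above the cutoff the spacing is at most `2^(-b) |y|`, below it the spacing is `2^(-b-A)`; the
sum covers both cases. -/
lemma sq_fround_sub_le : (fround A b y u - y) ^ 2 ≤ (1 / 4) ^ b * (y ^ 2 + (1 / 4) ^ A) := by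
  -- At `0` the convention `log 0 = 0` makes the spacing `2^(-b)`, too coarse for the bound, but `0`
  -- is rounded to itself.
  rcases eq_or_ne y 0 with rfl | hy
  · simp only [fround_zero]; norm_num
  rw [← sq_abs]
  have h1 : spacing A b y ^ 2 ≤ (1 / 4) ^ b * (y ^ 2 + (1 / 4) ^ A) := by
    have h2 : spacing A b y = 2 ^ expo A y * (1 / 2) ^ b := by
      rw [spacing, zpow_sub₀ two_ne_zero, zpow_natCast, div_eq_mul_inv, one_div, inv_pow]
    have h3 : ((1 / 2 : ℝ) ^ b) ^ 2 = (1 / 4) ^ b := by rw [← pow_mul, mul_comm, pow_mul]; norm_num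
    rw [h2, mul_pow, h3, mul_comm]
    gcongr
    rcases le_total ⌊Real.logb 2 |y|⌋ (-A : ℤ) with h | h
    · rw [expo, max_eq_right h]
      have : ((2 : ℝ) ^ (-A : ℤ)) ^ 2 = (1 / 4) ^ A := by
        rw [zpow_neg, zpow_natCast, ← inv_pow, ← pow_mul, mul_comm, pow_mul]; norm_num
      rw [this]
      linarith [sq_nonneg y]
    · rw [expo, max_eq_left h]
      have h4 : (2 : ℝ) ^ ⌊Real.logb 2 |y|⌋ ≤ |y| := by
        rw [← Real.rpow_intCast, ← Real.le_logb_iff_rpow_le one_lt_two (abs_pos.2 hy)]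
        exact Int.floor_le _
      have h5 : ((2 : ℝ) ^ ⌊Real.logb 2 |y|⌋) ^ 2 ≤ |y| ^ 2 := by gcongr
      rw [sq_abs] at h5
      have : (0 : ℝ) ≤ (1 / 4) ^ A := by positivity
      linarith
  refine le_trans ?_ h1
  have := abs_fround_sub_le (A := A) (b := b) (y := y) (u := u)
  gcongr

lemma measurable_fround (A b : ℕ) : Measurable fun x : ℝ × ℝ ↦ fround A b x.1 x.2 := by
  have h1 : Measurable fun y : ℝ ↦ expo A y := by
    unfold expo
    have : Measurable fun y : ℝ ↦ Real.logb 2 |y| := by unfold Real.logb; fun_prop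
    exact (Int.measurable_floor.comp this).max measurable_const
  have h2 : Measurable fun y : ℝ ↦ spacing A b y :=
    (measurable_from_top (f := fun k : ℤ ↦ (2 : ℝ) ^ (k - b))).comp h1
  have h3 : Measurable fun x : ℝ × ℝ ↦ spacing A b x.1 := h2.comp measurable_fst
  have h4 : Measurable fun x : ℝ × ℝ ↦ x.1 / spacing A b x.1 + Int.fract x.2 :=
    (measurable_fst.div h3).add (measurable_fract.comp measurable_snd)
  unfold fround
  exact h3.mul ((measurable_from_top (f := fun k : ℤ ↦ (k : ℝ))).comp (Int.measurable_floor.comp h4))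

/-- The floor jumps from `⌊x⌋` to `⌊x⌋ + 1` at `u = 1 - fract x`, so it takes the larger value on a
set of measure `fract x`. -/
lemma integral_floor_add_fract (x : ℝ) : ∫ u, (⌊x + Int.fract u⌋ : ℝ) ∂unif = x := by
  have h1 : ∫ u, (⌊x + Int.fract u⌋ : ℝ) ∂unif
      = ∫ u in Set.Ico (0 : ℝ) 1, ((⌊x⌋ : ℝ) +
        (Set.Ici (1 - Int.fract x)).indicator (fun _ ↦ (1 : ℝ)) u) := by
    refine setIntegral_congr_fun measurableSet_Ico fun u hu ↦ ?_
    rw [Int.fract_eq_self.2 hu]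
    have hx := Int.floor_add_fract x
    have hx0 := Int.fract_nonneg x
    have hx1 := Int.fract_lt_one x
    by_cases h : 1 - Int.fract x ≤ u
    · rw [Set.indicator_of_mem (by exact h), show ⌊x + u⌋ = ⌊x⌋ + 1 by
        rw [Int.floor_eq_iff]; push_cast; constructor <;> linarith [hu.2]]
      push_cast; rfl
    · rw [Set.indicator_of_notMem (by exact h), show ⌊x + u⌋ = ⌊x⌋ by
        rw [Int.floor_eq_iff]; constructor <;> linarith [hu.1]]
      simp
  have hx0 := Int.fract_nonneg x
  have hx1 := Int.fract_lt_one x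
  rw [h1, integral_add (by simp) (by
    exact (integrable_const (1 : ℝ)).indicator measurableSet_Ici), setIntegral_indicator
    measurableSet_Ici]
  have h2 : Set.Ico (0 : ℝ) 1 ∩ Set.Ici (1 - Int.fract x) = Set.Ico (1 - Int.fract x) 1 := by
    ext u
    simp only [Set.mem_inter_iff, Set.mem_Ico, Set.mem_Ici]
    constructor
    · rintro ⟨⟨_, h⟩, h'⟩; exact ⟨h', h⟩
    · rintro ⟨h, h'⟩; exact ⟨⟨by linarith, h'⟩, h⟩
  rw [h2]
  simp [hx0]

lemma integral_fround_sub (A b : ℕ) (y : ℝ) : ∫ u, (fround A b y u - y) ∂unif = 0 := by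
  have hs := spacing_pos (A := A) (b := b) (y := y)
  have hi : Integrable (fun u ↦ fround A b y u) unif := by
    refine Integrable.of_bound ((measurable_fround A b).comp
      (measurable_const.prodMk measurable_id)).aestronglyMeasurable (|y| + spacing A b y)
      (ae_of_all _ fun u ↦ ?_)
    have := abs_fround_sub_le (A := A) (b := b) (y := y) (u := u)
    have h2 := abs_sub_abs_le_abs_sub (fround A b y u) y
    rw [Real.norm_eq_abs]
    linarith
  rw [integral_sub hi (by simp)]
  unfold fround
  rw [integral_const_mul, integral_floor_add_fract, mul_div_cancel₀ _ hs.ne']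
  simp

/-- The floating point numbers with exponent between `-A` and `A'` and `b` bits of mantissa. -/
noncomputable def grid (A A' b : ℕ) : Finset ℝ :=
  (Finset.Icc (-A : ℤ) A' ×ˢ Finset.Icc (-(2 ^ (b + 1) + 1) : ℤ) (2 ^ (b + 1) + 1)).image
    fun x ↦ (2 : ℝ) ^ (x.1 - b : ℤ) * x.2

lemma card_grid_le (A A' b : ℕ) : (grid A A' b).card ≤ (A + A' + 1) * 2 ^ (b + 3) := by
  refine Finset.card_image_le.trans ?_
  rw [Finset.card_product, Int.card_Icc, Int.card_Icc]
  have h1 : ((A' : ℤ) + 1 - -A).toNat = A + A' + 1 := by omega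
  have h2 : ((2 : ℤ) ^ (b + 1) + 1 + 1 - -(2 ^ (b + 1) + 1)).toNat ≤ 2 ^ (b + 3) := by
    have : (1 : ℤ) ≤ 2 ^ b := by exact_mod_cast Nat.one_le_two_pow
    rw [Int.toNat_le]
    push_cast
    rw [pow_add 2 b 1, pow_add 2 b 3]
    linarith
  rw [h1]
  gcongr

lemma zero_mem_grid (A A' b : ℕ) : (0 : ℝ) ∈ grid A A' b := by
  refine Finset.mem_image.2 ⟨(0, 0), ?_, by simp⟩
  have : (0 : ℤ) ≤ 2 ^ (b + 1) := by positivity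
  simp only [Finset.mem_product, Finset.mem_Icc]
  omega

lemma fround_mem_grid {A' : ℕ} (hy : |y| ≤ 2 ^ A') : fround A b y u ∈ grid A A' b := by
  have hs := spacing_pos (A := A) (b := b) (y := y)
  refine Finset.mem_image.2 ⟨(expo A y, ⌊y / spacing A b y + Int.fract u⌋), ?_, rfl⟩
  rw [Finset.mem_product, Finset.mem_Icc, Finset.mem_Icc]
  refine ⟨⟨le_max_right _ _, max_le ?_ (by omega)⟩, ?_⟩
  · rcases eq_or_ne y 0 with rfl | hy0
    · simp
    · rw [← Int.cast_le (R := ℝ)]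
      refine (Int.floor_le _).trans ?_
      rw [Real.logb_le_iff_le_rpow one_lt_two (abs_pos.2 hy0)]
      push_cast
      rwa [Real.rpow_natCast]
  -- The shift moves the scaled value by less than `1`; the extra `1` in the mantissa range of
  -- `grid` leaves room for it.
  · have h1 : |y / spacing A b y| < 2 ^ (b + 1) := by
      rw [abs_div, abs_of_pos hs, div_lt_iff₀ hs]
      refine (abs_lt_two_zpow_expo (A := A)).trans_le (le_of_eq ?_)
      rw [spacing, ← zpow_natCast, ← zpow_add₀ two_ne_zero]
      congr 1
      push_cast
      ring
    rw [abs_lt] at h1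
    have h4 := Int.fract_nonneg u
    have h5 := Int.fract_lt_one u
    constructor
    · rw [Int.le_floor]
      push_cast
      linarith
    · refine Int.le_of_lt_add_one (Int.floor_lt.2 ?_)
      push_cast
      linarith

end MsgPassing

namespace MsgPassing

open MeasureTheory ProbabilityTheory Filter Topology

/-! ### Rooted trees -/

/-- A rooted tree on the vertex set `Fin m`, given by its parent map. -/
structure Rooting (m : ℕ) where
  root : Fin m
  parent : Fin m → Fin m
  depth : Fin m → ℕ
  depth_eq_zero : ∀ v, depth v = 0 ↔ v = root
  depth_parent : ∀ v, v ≠ root → depth (parent v) + 1 = depth v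

namespace Rooting

variable {m : ℕ} (T : Rooting m)

/-- `w` is a child of `v`. -/
def IsChild (w v : Fin m) : Prop := T.depth w = T.depth v + 1 ∧ T.parent w = v

/-- `u` is a descendant of `v` (possibly `v` itself). -/
def Desc (u v : Fin m) : Prop :=
  T.depth v ≤ T.depth u ∧ T.parent^[T.depth u - T.depth v] u = v

instance (w v : Fin m) : Decidable (T.IsChild w v) := inferInstanceAs (Decidable (_ ∧ _))

instance (w v : Fin m) : Decidable (T.Desc w v) := inferInstanceAs (Decidable (_ ∧ _))

lemma depth_iterate (u : Fin m) {k : ℕ} (hk : k ≤ T.depth u) :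
    T.depth (T.parent^[k] u) + k = T.depth u := by
  induction k with
  | zero => simp
  | succ k ih =>
    have h1 := ih (by omega)
    rw [Function.iterate_succ_apply']
    have h2 : T.parent^[k] u ≠ T.root := fun h ↦ by
      have := (T.depth_eq_zero _).2 h
      omega
    have := T.depth_parent _ h2
    omega

lemma desc_self (v : Fin m) : T.Desc v v := by simp [Desc]

lemma desc_root (u : Fin m) : T.Desc u T.root := by
  have h0 := (T.depth_eq_zero T.root).2 rfl
  refine ⟨by omega, ?_⟩
  rw [h0, Nat.sub_zero, ← T.depth_eq_zero]
  have := T.depth_iterate u le_rfl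
  omega

lemma desc_of_depth_le {u v : Fin m} (h : T.depth u ≤ T.depth v) : T.Desc u v ↔ u = v := by
  constructor
  · rintro ⟨h1, h2⟩
    rwa [Nat.sub_eq_zero_of_le h] at h2
  · rintro rfl; exact T.desc_self _

/-- The sum of `f` over the descendants of `v`. -/
def subsum (f : Fin m → ℝ) (v : Fin m) : ℝ := ∑ u, if T.Desc u v then f u else 0

/-- A proper descendant of `v` lies below exactly one child of `v`, namely its ancestor one level
below `v`. -/
lemma ite_desc_eq (f : Fin m → ℝ) (u v : Fin m) :
    (if T.Desc u v then f u else 0) = (if u = v then f u else 0)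
      + ∑ w, if T.IsChild w v then (if T.Desc u w then f u else 0) else 0 := by
  rcases le_or_gt (T.depth u) (T.depth v) with h | h
  · rw [Finset.sum_eq_zero, add_zero]
    · simp only [T.desc_of_depth_le h]
    · intro w _
      split_ifs with h1 h2
      · have := h2.1
        have := h1.1
        omega
      · rfl
      · rfl
  · have huv : u ≠ v := by rintro rfl; omega
    set w₀ := T.parent^[T.depth u - T.depth v - 1] u with hw₀
    have hd : T.depth w₀ = T.depth v + 1 := by
      have := T.depth_iterate u (k := T.depth u - T.depth v - 1) (by omega)
      rw [← hw₀] at this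
      omega
    have hpar : T.parent w₀ = T.parent^[T.depth u - T.depth v] u := by
      rw [hw₀, ← Function.iterate_succ_apply' T.parent, show
        (T.depth u - T.depth v - 1).succ = T.depth u - T.depth v by omega]
    have hdesc : T.Desc u w₀ := ⟨by omega, by rw [hd, hw₀, Nat.sub_sub]⟩
    rw [if_neg huv, zero_add, Finset.sum_eq_single w₀]
    · rw [if_pos hdesc]
      congr 1
      simp only [Desc, IsChild, hd, hpar, h.le, true_and]
    · intro w _ hw
      split_ifs with h1 h2
      · refine absurd ?_ hw
        have h3 := h2.2
        rw [h1.1, ← Nat.sub_sub] at h3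
        exact h3.symm
      · rfl
      · rfl
    · simp

lemma subsum_eq (f : Fin m → ℝ) (v : Fin m) :
    T.subsum f v = f v + ∑ w, if T.IsChild w v then T.subsum f w else 0 := by
  unfold subsum
  rw [Finset.sum_congr rfl fun u _ ↦ T.ite_desc_eq f u v, Finset.sum_add_distrib]
  congr 1
  · simp
  · rw [Finset.sum_comm]
    refine Finset.sum_congr rfl fun w _ ↦ ?_
    split_ifs <;> simp

lemma subsum_root (f : Fin m → ℝ) : T.subsum f T.root = ∑ u, f u := by
  simp [subsum, T.desc_root]

/-- An ancestor of `u` is determined by its depth. This is the only source of the factor depth plus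
one in the error bounds. -/
lemma card_ancestors_le (u : Fin m) :
    (Finset.univ.filter fun v ↦ T.Desc u v).card ≤ T.depth u + 1 := by
  rw [← Finset.card_range (T.depth u + 1)]
  refine Finset.card_le_card_of_injOn T.depth ?_ ?_
  · intro v hv
    have := (Finset.mem_filter.1 hv).2.1
    simp; omega
  · intro v hv w hw h
    have h1 := (Finset.mem_filter.1 hv).2.2
    have h2 := (Finset.mem_filter.1 hw).2.2
    rw [← h1, ← h2, h]

lemma sum_subsum_le {D : ℕ} (hD : ∀ v, T.depth v ≤ D) {f : Fin m → ℝ} (hf : ∀ v, 0 ≤ f v) :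
    ∑ v, T.subsum f v ≤ (D + 1) * ∑ u, f u := by
  unfold subsum
  rw [Finset.sum_comm, Finset.mul_sum]
  refine Finset.sum_le_sum fun u _ ↦ ?_
  rw [← Finset.sum_filter, Finset.sum_const, nsmul_eq_mul]
  gcongr
  · exact hf u
  · have := T.card_ancestors_le u
    have := hD u
    exact_mod_cast (by omega : (Finset.univ.filter fun v ↦ T.Desc u v).card ≤ D + 1)

lemma subsum_nonneg {f : Fin m → ℝ} (hf : ∀ v, 0 ≤ f v) (v : Fin m) : 0 ≤ T.subsum f v :=
  Finset.sum_nonneg fun u _ ↦ by split_ifs <;> simp [hf]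

lemma subsum_le {f : Fin m → ℝ} (hf : ∀ v, 0 ≤ f v) (v : Fin m) : T.subsum f v ≤ ∑ u, f u :=
  Finset.sum_le_sum fun u _ ↦ by split_ifs <;> simp [hf]

/-- Without cancellation a partial sum is at most the total, so `p - 1` of its powers can be
replaced by powers of the total. The remaining first powers are counted once per ancestor. -/
lemma sum_subsum_rpow_le {D : ℕ} (hD : ∀ v, T.depth v ≤ D) {f : Fin m → ℝ} (hf : ∀ v, 0 ≤ f v)
    {p : ℝ} (hp : 1 ≤ p) : ∑ v, T.subsum f v ^ p ≤ (D + 1) * (∑ u, f u) ^ p := by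
  have hS : 0 ≤ ∑ u, f u := Finset.sum_nonneg fun u _ ↦ hf u
  have key {x : ℝ} (hx : 0 ≤ x) : x ^ p = x * x ^ (p - 1) := by
    rcases hx.eq_or_lt with rfl | h
    · rw [Real.zero_rpow (by linarith), zero_mul]
    · rw [Real.rpow_sub_one h.ne']; field_simp
  calc _ ≤ ∑ v, T.subsum f v * (∑ u, f u) ^ (p - 1) := by
        refine Finset.sum_le_sum fun v _ ↦ ?_
        rw [key (T.subsum_nonneg hf v)]
        have := T.subsum_nonneg hf v
        gcongr
        exact T.subsum_le hf v
    _ ≤ ((D + 1) * ∑ u, f u) * (∑ u, f u) ^ (p - 1) := by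
        rw [← Finset.sum_mul]
        gcongr
        exact T.sum_subsum_le hD hf
    _ = _ := by rw [key hS]; ring

/-! ### Aggregation along a tree -/

/-- The value at the vertex `v` after `t` steps of aggregation, when the value of a vertex is
transformed by `ρ w` before it is sent to the parent of `w`. -/
def agg (ρ : Fin m → ℝ → ℝ) (x : Fin m → ℝ) : ℕ → Fin m → ℝ
  | 0, v => x v
  | t + 1, v => x v + ∑ w, if T.IsChild w v then ρ w (agg ρ x t w) else 0

/-- Values at depth `D` are final from the start, and each step makes one more level final. -/
lemma agg_succ_eq {D : ℕ} (hD : ∀ v, T.depth v ≤ D) (ρ : Fin m → ℝ → ℝ) (x : Fin m → ℝ) (t : ℕ)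
    (v : Fin m) (h : D ≤ T.depth v + t) : T.agg ρ x (t + 1) v = T.agg ρ x t v := by
  induction t generalizing v with
  | zero =>
    simp only [agg]
    rw [Finset.sum_eq_zero, add_zero]
    intro w _
    rw [if_neg]
    rintro ⟨h1, _⟩
    have := hD w
    omega
  | succ t ih =>
    rw [agg, agg]
    congr 1
    refine Finset.sum_congr rfl fun w _ ↦ ?_
    split_ifs with hw
    · rw [ih w (by have := hw.1; omega)]
    · rfl

/-- The result of the aggregation satisfies the defining recursion along the tree. -/
lemma agg_eq {D : ℕ} (hD : ∀ v, T.depth v ≤ D) (ρ : Fin m → ℝ → ℝ) (x : Fin m → ℝ) (v : Fin m) :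
    T.agg ρ x D v = x v + ∑ w, if T.IsChild w v then ρ w (T.agg ρ x D w) else 0 := by
  rw [← T.agg_succ_eq hD ρ x D v (by omega), agg]

lemma induction_depth {D : ℕ} (hD : ∀ v, T.depth v ≤ D) {P : Fin m → Prop}
    (h : ∀ v, (∀ w, T.IsChild w v → P w) → P v) (v : Fin m) : P v := by
  suffices ∀ t v, D ≤ T.depth v + t → P v from this D v (by omega)
  intro t
  induction t with
  | zero => exact fun v hv ↦ h v fun w hw ↦ by have := hw.1; have := hD w; omega
  | succ t ih => exact fun v hv ↦ h v fun w hw ↦ ih w (by have := hw.1; omega)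

/-- Writing `ρ` as identity plus error makes the aggregation linear: inputs and errors of the
subtree just add up. -/
lemma agg_add_eq_subsum {D : ℕ} (hD : ∀ v, T.depth v ≤ D) (ρ : Fin m → ℝ → ℝ) (x : Fin m → ℝ)
    (v : Fin m) :
    T.agg ρ x D v + (ρ v (T.agg ρ x D v) - T.agg ρ x D v)
      = T.subsum (fun w ↦ x w + (ρ w (T.agg ρ x D w) - T.agg ρ x D w)) v := by
  induction v using T.induction_depth hD with
  | h v ih =>
    rw [T.subsum_eq]
    have h1 : ∑ w, (if T.IsChild w v then
        T.subsum (fun w ↦ x w + (ρ w (T.agg ρ x D w) - T.agg ρ x D w)) w else 0)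
        = ∑ w, if T.IsChild w v then ρ w (T.agg ρ x D w) else 0 := by
      refine Finset.sum_congr rfl fun w _ ↦ ?_
      split_ifs with hw
      · rw [← ih w hw]; ring
      · rfl
    have h2 := T.agg_eq hD ρ x v
    rw [h1]
    linarith

lemma agg_eq_subsum {D : ℕ} (hD : ∀ v, T.depth v ≤ D) (ρ : Fin m → ℝ → ℝ) (x : Fin m → ℝ)
    (v : Fin m) :
    T.agg ρ x D v = T.subsum x v + ∑ w ∈ Finset.univ.filter (fun w ↦ T.Desc w v ∧ w ≠ v),
      (ρ w (T.agg ρ x D w) - T.agg ρ x D w) := by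
  have h := T.agg_add_eq_subsum hD ρ x v
  set e : Fin m → ℝ := fun w ↦ ρ w (T.agg ρ x D w) - T.agg ρ x D w with he
  have h1 : T.subsum (fun w ↦ x w + e w) v = T.subsum x v + T.subsum e v := by
    unfold subsum
    rw [← Finset.sum_add_distrib]
    exact Finset.sum_congr rfl fun u _ ↦ by split_ifs <;> simp
  have h2 : T.subsum e v = e v + ∑ w ∈ Finset.univ.filter (fun w ↦ T.Desc w v ∧ w ≠ v), e w := by
    unfold subsum
    rw [← Finset.sum_filter, ← Finset.add_sum_erase _ _ (a := v) (by simp [T.desc_self])]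
    congr 1
    refine Finset.sum_congr ?_ fun _ _ ↦ rfl
    ext w
    simp [and_comm]
  have h3 : T.agg ρ x D v + e v = T.subsum (fun w ↦ x w + e w) v := h
  change _ = _ + ∑ w ∈ Finset.univ.filter (fun w ↦ T.Desc w v ∧ w ≠ v), e w
  linarith

/-- Only the values actually met matter. This later identifies rounding confined to the grid with
plain rounding when nothing overflows. -/
lemma agg_congr {D : ℕ} (hD : ∀ v, T.depth v ≤ D) {ρ ρ' : Fin m → ℝ → ℝ} {x : Fin m → ℝ}
    (h : ∀ v, ρ' v (T.agg ρ x D v) = ρ v (T.agg ρ x D v)) (v : Fin m) :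
    T.agg ρ' x D v = T.agg ρ x D v := by
  induction v using T.induction_depth hD with
  | h v ih =>
    rw [T.agg_eq hD, T.agg_eq hD ρ]
    congr 1
    refine Finset.sum_congr rfl fun w _ ↦ ?_
    split_ifs with hw
    · rw [ih w hw, h]
    · rfl

/-- The value at `v` does not depend on what happens at vertices that are not strictly deeper. -/
lemma agg_congr_of_depth (ρ ρ' : Fin m → ℝ → ℝ) (x : Fin m → ℝ) (t : ℕ) (v : Fin m)
    (h : ∀ w, T.depth v < T.depth w → ρ' w = ρ w) : T.agg ρ' x t v = T.agg ρ x t v := by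
  induction t generalizing v with
  | zero => rfl
  | succ t ih =>
    rw [agg, agg]
    congr 1
    refine Finset.sum_congr rfl fun w _ ↦ ?_
    split_ifs with hw
    · have := hw.1
      rw [ih w fun w' hw' ↦ h w' (by omega), h w (by omega)]
    · rfl

end Rooting

end MsgPassing

namespace MsgPassing

open MeasureTheory ProbabilityTheory Filter Topology

/-! ### Second moments of the rounding errors -/

/-- Resampling one coordinate does not change the product law; this replaces conditioning on the
other coordinates. -/
lemma measurePreserving_update {m : ℕ} (μ : Measure ℝ) [IsProbabilityMeasure μ] (i : Fin m) :
    MeasurePreserving (fun q : (Fin m → ℝ) × ℝ ↦ Function.update q.1 i q.2)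
      ((Measure.pi fun _ ↦ μ).prod μ) (Measure.pi fun _ ↦ μ) := by
  have hmeas : Measurable fun q : (Fin m → ℝ) × ℝ ↦ Function.update q.1 i q.2 := by
    refine measurable_pi_lambda _ fun j ↦ ?_
    by_cases h : j = i
    · subst h; simpa using measurable_snd
    · simp only [Function.update_of_ne h]
      exact (measurable_pi_apply j).comp measurable_fst
  refine ⟨hmeas, (Measure.pi_eq fun s hs ↦ ?_).symm⟩
  rw [Measure.map_apply hmeas (MeasurableSet.univ_pi hs)]
  have h1 : (fun q : (Fin m → ℝ) × ℝ ↦ Function.update q.1 i q.2) ⁻¹' (Set.pi Set.univ s)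
      = (Set.pi Set.univ (Function.update s i Set.univ)) ×ˢ s i := by
    ext q
    simp only [Set.mem_preimage, Set.mem_pi, Set.mem_univ, true_implies, Set.mem_prod]
    constructor
    · intro h
      refine ⟨fun j ↦ ?_, by simpa using h i⟩
      by_cases hj : j = i
      · subst hj; simp
      · simpa [Function.update_of_ne hj] using h j
    · rintro ⟨h, h'⟩ j
      by_cases hj : j = i
      · subst hj; simpa using h'
      · simpa [Function.update_of_ne hj] using h j
  have h2 (j : Fin m) : μ (Function.update s i Set.univ j)
      = Function.update (fun j ↦ μ (s j)) i 1 j := by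
    by_cases hj : j = i
    · subst hj; simp
    · simp [Function.update_of_ne hj]
  rw [h1, Measure.prod_prod, Measure.pi_pi]
  simp_rw [h2]
  rw [Finset.prod_update_of_mem (Finset.mem_univ i), one_mul,
    ← Finset.prod_mul_prod_compl {i} fun j ↦ μ (s j), Finset.prod_singleton, mul_comm,
    Finset.compl_eq_univ_sdiff]

lemma integral_sq_add_sum_of_orthogonal {Ω ι : Type*} [MeasurableSpace Ω] {μ : Measure Ω}
    [IsProbabilityMeasure μ] (a : ℝ) (e : ι → Ω → ℝ) (he : ∀ i, MemLp (e i) 2 μ)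
    (h0 : ∀ i, ∫ ω, e i ω ∂μ = 0) (h1 : ∀ i j, i ≠ j → ∫ ω, e i ω * e j ω ∂μ = 0) (S : Finset ι) :
    ∫ ω, (a + ∑ i ∈ S, e i ω) ^ 2 ∂μ = a ^ 2 + ∑ i ∈ S, ∫ ω, e i ω ^ 2 ∂μ := by
  classical
  induction S using Finset.induction_on with
  | empty => simp
  | insert i S hi ih =>
    have hS : MemLp (fun ω ↦ a + ∑ j ∈ S, e j ω) 2 μ :=
      (memLp_const a).add (memLp_finsetSum S fun j _ ↦ he j)
    have hintg (j : ι) : Integrable (fun ω ↦ e i ω * e j ω) μ := (he i).integrable_mul (he j)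
    have hcross : ∫ ω, e i ω * (a + ∑ j ∈ S, e j ω) ∂μ = 0 := by
      simp_rw [mul_add, Finset.mul_sum]
      rw [integral_add (((he i).integrable (by norm_num)).mul_const a)
        (integrable_finsetSum _ fun j _ ↦ hintg j), integral_mul_const, h0,
        integral_finsetSum _ fun j _ ↦ hintg j, Finset.sum_eq_zero, zero_mul, zero_add]
      exact fun j hj ↦ h1 i j fun h ↦ hi (h ▸ hj)
    have hx : Integrable (fun ω ↦ e i ω * (a + ∑ j ∈ S, e j ω)) μ := (he i).integrable_mul hS
    calc _ = ∫ ω, (e i ω ^ 2 + 2 * (e i ω * (a + ∑ j ∈ S, e j ω))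
            + (a + ∑ j ∈ S, e j ω) ^ 2) ∂μ := by
          congr with ω
          rw [Finset.sum_insert hi]
          ring
      _ = ∫ ω, e i ω ^ 2 ∂μ + 0 + (a ^ 2 + ∑ i ∈ S, ∫ ω, e i ω ^ 2 ∂μ) := by
          have hx2 : Integrable (fun ω ↦ e i ω ^ 2 + 2 * (e i ω * (a + ∑ j ∈ S, e j ω))) μ :=
            (he i).integrable_sq.add (hx.const_mul 2)
          rw [integral_add hx2 hS.integrable_sq,
            integral_add (he i).integrable_sq (hx.const_mul 2), ih, integral_const_mul, hcross,
            mul_zero]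
      _ = _ := by rw [Finset.sum_insert hi]; ring

lemma measurable_fround_comp {α : Type*} [MeasurableSpace α] (A b : ℕ) {f g : α → ℝ}
    (hf : Measurable f) (hg : Measurable g) : Measurable fun a ↦ fround A b (f a) (g a) := by
  have h := (measurable_fround A b).comp (hf.prodMk hg)
  simpa only [Function.comp_def] using h

namespace Rooting

variable {m : ℕ} (T : Rooting m) (A b D : ℕ)

/-- The values at the vertices when aggregation is done with floating point rounding. -/
noncomputable def noisy (x u : Fin m → ℝ) (v : Fin m) : ℝ :=
  T.agg (fun w y ↦ fround A b y (u w)) x D v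

/-- The rounding error made at the vertex `v`. -/
noncomputable def err (x u : Fin m → ℝ) (v : Fin m) : ℝ :=
  fround A b (T.noisy A b D x u v) (u v) - T.noisy A b D x u v

lemma measurable_agg_fround (t : ℕ) (v : Fin m) : Measurable fun q : (Fin m → ℝ) × (Fin m → ℝ) ↦
    T.agg (fun w y ↦ fround A b y (q.2 w)) q.1 t v := by
  induction t generalizing v with
  | zero => exact (measurable_pi_apply v).comp measurable_fst
  | succ t ih =>
    simp only [agg]
    have h1 (w : Fin m) : Measurable fun q : (Fin m → ℝ) × (Fin m → ℝ) ↦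
        fround A b (T.agg (fun w y ↦ fround A b y (q.2 w)) q.1 t w) (q.2 w) := by
      have h2 : Measurable fun q : (Fin m → ℝ) × (Fin m → ℝ) ↦ q.2 w :=
        (measurable_pi_apply w).comp measurable_snd
      exact measurable_fround_comp A b (ih w) h2
    have h3 (w : Fin m) : Measurable fun q : (Fin m → ℝ) × (Fin m → ℝ) ↦ if T.IsChild w v then
        fround A b (T.agg (fun w y ↦ fround A b y (q.2 w)) q.1 t w) (q.2 w) else 0 := by
      by_cases h : T.IsChild w v
      · simpa only [if_pos h] using h1 w
      · simpa only [if_neg h] using measurable_const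
    have h4 : Measurable fun q : (Fin m → ℝ) × (Fin m → ℝ) ↦ q.1 v :=
      (measurable_pi_apply v).comp measurable_fst
    exact h4.add (Finset.measurable_sum _ fun w _ ↦ h3 w)

lemma measurable_noisy (v : Fin m) : Measurable fun q : (Fin m → ℝ) × (Fin m → ℝ) ↦
    T.noisy A b D q.1 q.2 v := T.measurable_agg_fround A b D v

lemma measurable_err (v : Fin m) : Measurable fun q : (Fin m → ℝ) × (Fin m → ℝ) ↦
    T.err A b D q.1 q.2 v :=
  (measurable_fround_comp A b (T.measurable_noisy A b D v)
    ((measurable_pi_apply v).comp measurable_snd)).sub (T.measurable_noisy A b D v)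

lemma abs_fround_sub_le_add_one (y u : ℝ) : |fround A b y u - y| ≤ |y| + 1 := by
  refine abs_le_of_sq_le_sq ?_ (by positivity)
  refine sq_fround_sub_le.trans ?_
  have h1 : (1 / 4 : ℝ) ^ b ≤ 1 := pow_le_one₀ (by norm_num) (by norm_num)
  have h2 : (1 / 4 : ℝ) ^ A ≤ 1 := pow_le_one₀ (by norm_num) (by norm_num)
  calc _ ≤ 1 * (y ^ 2 + 1) := by gcongr
    _ ≤ _ := by rw [← sq_abs y]; nlinarith [abs_nonneg y]

/-- A crude bound, used only for square integrability. -/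
lemma exists_abs_agg_fround_le (x : Fin m → ℝ) (t : ℕ) :
    ∃ C, ∀ (u : Fin m → ℝ) (v : Fin m), |T.agg (fun w y ↦ fround A b y (u w)) x t v| ≤ C := by
  induction t with
  | zero => exact ⟨∑ v, |x v|, fun u v ↦
      Finset.single_le_sum (f := fun v ↦ |x v|) (fun _ _ ↦ abs_nonneg _) (Finset.mem_univ v)⟩
  | succ t ih =>
    obtain ⟨C, hC⟩ := ih
    refine ⟨∑ v, |x v| + ∑ _v : Fin m, (2 * C + 1), fun u v ↦ ?_⟩
    rw [agg]
    refine (abs_add_le _ _).trans (add_le_add (Finset.single_le_sum (f := fun v ↦ |x v|)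
      (fun _ _ ↦ abs_nonneg _) (Finset.mem_univ v)) ?_)
    refine (Finset.abs_sum_le_sum_abs _ _).trans (Finset.sum_le_sum fun w _ ↦ ?_)
    have h0 := hC u w
    split_ifs
    · have h1 := abs_fround_sub_le_add_one A b (T.agg (fun w y ↦ fround A b y (u w)) x t w) (u w)
      have h2 := abs_sub_abs_le_abs_sub
        (fround A b (T.agg (fun w y ↦ fround A b y (u w)) x t w) (u w))
        (T.agg (fun w y ↦ fround A b y (u w)) x t w)
      linarith
    · rw [abs_zero]
      have := abs_nonneg (T.agg (fun w y ↦ fround A b y (u w)) x t w)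
      linarith

/-- The law of the random shifts used for rounding. -/
noncomputable abbrev shiftLaw (m : ℕ) : Measure (Fin m → ℝ) := Measure.pi fun _ ↦ unif

lemma memLp_noisy (x : Fin m → ℝ) (v : Fin m) :
    MemLp (fun u ↦ T.noisy A b D x u v) 2 (shiftLaw m) := by
  obtain ⟨C, hC⟩ := T.exists_abs_agg_fround_le A b x D
  exact MemLp.of_bound ((T.measurable_noisy A b D v).comp
    (measurable_const.prodMk measurable_id)).aestronglyMeasurable C (ae_of_all _ fun u ↦ hC u v)

lemma memLp_err (x : Fin m → ℝ) (v : Fin m) :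
    MemLp (fun u ↦ T.err A b D x u v) 2 (shiftLaw m) := by
  obtain ⟨C, hC⟩ := T.exists_abs_agg_fround_le A b x D
  refine MemLp.of_bound ((T.measurable_err A b D v).comp
    (measurable_const.prodMk measurable_id)).aestronglyMeasurable (C + 1) (ae_of_all _ fun u ↦ ?_)
  exact (abs_fround_sub_le_add_one A b _ _).trans (by have := hC u v; unfold noisy; linarith)

/-- The value at `v` before rounding involves only shifts of strictly deeper vertices, in particular
not the shift of `v`. -/
lemma noisy_update (x u : Fin m → ℝ) {v w : Fin m} (h : T.depth w ≤ T.depth v) (s : ℝ) :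
    T.noisy A b D x (Function.update u w s) v = T.noisy A b D x u v := by
  refine T.agg_congr_of_depth _ _ x D v fun w' hw' ↦ ?_
  have : w' ≠ w := by rintro rfl; omega
  simp [Function.update_of_ne this]

/-- After resampling the shift at `v`, the inner integral is the mean rounding error of a fixed
number, which vanishes. -/
lemma integral_mul_err (x : Fin m → ℝ) (v : Fin m) {g : (Fin m → ℝ) → ℝ}
    (hg : Integrable (fun u ↦ g u * T.err A b D x u v) (shiftLaw m))
    (h : ∀ u s, g (Function.update u v s) = g u) :
    ∫ u, g u * T.err A b D x u v ∂(shiftLaw m) = 0 := by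
  have hmp := measurePreserving_update (m := m) unif v
  have hintg : Integrable (fun q : (Fin m → ℝ) × ℝ ↦ g (Function.update q.1 v q.2) *
      T.err A b D x (Function.update q.1 v q.2) v) ((shiftLaw m).prod unif) :=
    hmp.integrable_comp_of_integrable hg
  have h1 : ∫ u, g u * T.err A b D x u v ∂(shiftLaw m)
      = ∫ q : (Fin m → ℝ) × ℝ, g (Function.update q.1 v q.2) *
        T.err A b D x (Function.update q.1 v q.2) v ∂((shiftLaw m).prod unif) := by
    have := integral_map (μ := (shiftLaw m).prod unif) hmp.measurable.aemeasurable
      (f := fun u ↦ g u * T.err A b D x u v) (by rw [hmp.map_eq]; exact hg.aestronglyMeasurable)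
    rwa [hmp.map_eq] at this
  rw [h1, integral_prod _ hintg]
  refine integral_eq_zero_of_ae (ae_of_all _ fun u ↦ ?_)
  simp only [h, err, T.noisy_update A b D x u le_rfl, Function.update_self, Pi.zero_apply]
  rw [integral_const_mul, integral_fround_sub, mul_zero]

lemma integral_err (x : Fin m → ℝ) (v : Fin m) : ∫ u, T.err A b D x u v ∂(shiftLaw m) = 0 := by
  have := T.integral_mul_err A b D x v (g := fun _ ↦ 1)
    (by simpa using (T.memLp_err A b D x v).integrable (by norm_num)) (by simp)
  simpa using this

/-- Of two distinct vertices, the error at the one that is at least as deep does not involve the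
shift of the other. -/
lemma integral_err_mul_err (x : Fin m → ℝ) {v w : Fin m} (hvw : v ≠ w) :
    ∫ u, T.err A b D x u v * T.err A b D x u w ∂(shiftLaw m) = 0 := by
  wlog h : T.depth w ≤ T.depth v generalizing v w
  · simp_rw [mul_comm (T.err A b D x _ v)]
    exact this hvw.symm (by omega)
  refine T.integral_mul_err A b D x w (g := fun u ↦ T.err A b D x u v)
    ((T.memLp_err A b D x v).integrable_mul (T.memLp_err A b D x w)) fun u s ↦ ?_
  simp only [err, T.noisy_update A b D x u h, Function.update_of_ne hvw]

variable {A b D}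

lemma integral_noisy_sq (hD : ∀ v, T.depth v ≤ D) (x : Fin m → ℝ) (v : Fin m) :
    ∫ u, T.noisy A b D x u v ^ 2 ∂(shiftLaw m) = T.subsum x v ^ 2 +
      ∑ w ∈ Finset.univ.filter (fun w ↦ T.Desc w v ∧ w ≠ v),
        ∫ u, T.err A b D x u w ^ 2 ∂(shiftLaw m) := by
  rw [← integral_sq_add_sum_of_orthogonal (T.subsum x v) (fun w u ↦ T.err A b D x u w)
    (T.memLp_err A b D x) (T.integral_err A b D x)
    (fun _ _ h ↦ T.integral_err_mul_err A b D x h)]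
  congr with u
  rw [noisy, T.agg_eq_subsum hD]
  rfl

lemma integral_err_sq_le (x : Fin m → ℝ) (v : Fin m) :
    ∫ u, T.err A b D x u v ^ 2 ∂(shiftLaw m)
      ≤ (1 / 4) ^ b * (∫ u, T.noisy A b D x u v ^ 2 ∂(shiftLaw m) + (1 / 4) ^ A) := by
  have h1 := (T.memLp_noisy A b D x v).integrable_sq
  calc _ ≤ ∫ u, (1 / 4) ^ b * (T.noisy A b D x u v ^ 2 + (1 / 4) ^ A) ∂(shiftLaw m) :=
        integral_mono (T.memLp_err A b D x v).integrable_sq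
          ((h1.add (integrable_const _)).const_mul _) fun u ↦ sq_fround_sub_le
    _ = _ := by
        rw [integral_const_mul, integral_add h1 (integrable_const _)]
        simp

/-- The sum of the second moments of all intermediate values, up to the rounding cutoff. -/
lemma sum_integral_noisy_sq_le (hD : ∀ v, T.depth v ≤ D) (hb : (1 / 4 : ℝ) ^ b * (D + 1) ≤ 1 / 2)
    (x : Fin m → ℝ) :
    ∑ v, (∫ u, T.noisy A b D x u v ^ 2 ∂(shiftLaw m) + (1 / 4) ^ A)
      ≤ 2 * ∑ v, (T.subsum x v ^ 2 + (1 / 4) ^ A) := by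
  set c : Fin m → ℝ := fun v ↦ ∫ u, T.noisy A b D x u v ^ 2 ∂(shiftLaw m) + (1 / 4) ^ A with hc
  have hc0 (v : Fin m) : 0 ≤ c v := add_nonneg (integral_nonneg fun u ↦ sq_nonneg _) (by positivity)
  -- A self-referential bound: errors feed on the noisy values below. Summed over `v`, the feedback
  -- has factor `4^(-b) (D + 1) ≤ 1/2` and is absorbed into the left side.
  have h1 (v : Fin m) : c v ≤ (T.subsum x v ^ 2 + (1 / 4) ^ A) + (1 / 4) ^ b * T.subsum c v := by
    have h2 : ∑ w ∈ Finset.univ.filter (fun w ↦ T.Desc w v ∧ w ≠ v),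
        ∫ u, T.err A b D x u w ^ 2 ∂(shiftLaw m) ≤ (1 / 4) ^ b * T.subsum c v := by
      unfold subsum
      rw [← Finset.sum_filter, Finset.mul_sum]
      refine (Finset.sum_le_sum fun w _ ↦ T.integral_err_sq_le x w).trans ?_
      refine Finset.sum_le_sum_of_subset_of_nonneg ?_ fun w _ _ ↦
        mul_nonneg (by positivity) (hc0 w)
      intro w hw
      simp only [Finset.mem_filter] at hw ⊢
      exact ⟨hw.1, hw.2.1⟩
    have h3 := T.integral_noisy_sq hD (A := A) (b := b) x v
    simp only [hc] at h2 ⊢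
    linarith
  have h4 : ∑ v, c v ≤ ∑ v, (T.subsum x v ^ 2 + (1 / 4) ^ A) + (1 / 4) ^ b * ∑ v, T.subsum c v := by
    rw [Finset.mul_sum, ← Finset.sum_add_distrib]
    exact Finset.sum_le_sum fun v _ ↦ h1 v
  have h5 : (1 / 4 : ℝ) ^ b * ∑ v, T.subsum c v ≤ 1 / 2 * ∑ v, c v := by
    have h6 := T.sum_subsum_le hD hc0
    have h7 : 0 ≤ ∑ v, c v := Finset.sum_nonneg fun v _ ↦ hc0 v
    calc _ ≤ (1 / 4 : ℝ) ^ b * ((D + 1) * ∑ v, c v) := by gcongr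
      _ = ((1 / 4 : ℝ) ^ b * (D + 1)) * ∑ v, c v := by ring
      _ ≤ _ := by gcongr
  linarith

lemma integral_noisy_sq_le (hD : ∀ v, T.depth v ≤ D) (hb : (1 / 4 : ℝ) ^ b * (D + 1) ≤ 1 / 2)
    (x : Fin m → ℝ) (v : Fin m) :
    ∫ u, T.noisy A b D x u v ^ 2 ∂(shiftLaw m) ≤ 2 * ∑ v, (T.subsum x v ^ 2 + (1 / 4) ^ A) := by
  refine le_trans ?_ (T.sum_integral_noisy_sq_le hD hb x)
  have h1 := Finset.single_le_sum
    (f := fun v ↦ ∫ u, T.noisy A b D x u v ^ 2 ∂(shiftLaw m) + (1 / 4) ^ A)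
    (fun v _ ↦ add_nonneg (integral_nonneg fun u ↦ sq_nonneg _) (by positivity)) (Finset.mem_univ v)
  have : (0 : ℝ) ≤ (1 / 4) ^ A := by positivity
  linarith

/-- The root does not round its value, so its deviation is the sum of the errors at all other
vertices. -/
lemma integral_noisy_root_sub_sq_le (hD : ∀ v, T.depth v ≤ D)
    (hb : (1 / 4 : ℝ) ^ b * (D + 1) ≤ 1 / 2) (x : Fin m → ℝ) :
    ∫ u, (T.noisy A b D x u T.root - ∑ v, x v) ^ 2 ∂(shiftLaw m)
      ≤ (1 / 4) ^ b * (2 * ∑ v, (T.subsum x v ^ 2 + (1 / 4) ^ A)) := by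
  have h1 : ∫ u, (T.noisy A b D x u T.root - ∑ v, x v) ^ 2 ∂(shiftLaw m)
      = ∑ w ∈ Finset.univ.filter (fun w ↦ T.Desc w T.root ∧ w ≠ T.root),
        ∫ u, T.err A b D x u w ^ 2 ∂(shiftLaw m) := by
    have := integral_sq_add_sum_of_orthogonal 0 (fun w u ↦ T.err A b D x u w)
      (T.memLp_err A b D x) (T.integral_err A b D x)
      (fun _ _ h ↦ T.integral_err_mul_err A b D x h)
      (Finset.univ.filter (fun w ↦ T.Desc w T.root ∧ w ≠ T.root))
    rw [zero_pow two_ne_zero, zero_add] at this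
    rw [← this]
    congr with u
    rw [noisy, T.agg_eq_subsum hD, T.subsum_root, zero_add, add_sub_cancel_left]
    rfl
  rw [h1]
  refine (Finset.sum_le_sum fun w _ ↦ T.integral_err_sq_le x w).trans ?_
  rw [← Finset.mul_sum]
  gcongr
  refine le_trans (Finset.sum_le_sum_of_subset_of_nonneg (Finset.subset_univ _) fun w _ _ ↦ ?_)
    (T.sum_integral_noisy_sq_le hD hb x)
  exact add_nonneg (integral_nonneg fun u ↦ sq_nonneg _) (by positivity)

end Rooting

end MsgPassing

namespace MsgPassing

open MeasureTheory ProbabilityTheory Filter Topology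

/-! ### Moments of order `1 / 4` of the sketch and of its error -/

lemma lintegral_rpow_quarter_le {Ω : Type*} [MeasurableSpace Ω] {μ : Measure Ω}
    [IsProbabilityMeasure μ] {f : Ω → ℝ} (hf : MemLp f 2 μ) {l : ℝ} (hl : 0 < l)
    (h : ∫ ω, f ω ^ 2 ∂μ ≤ l) :
    ∫⁻ ω, ENNReal.ofReal (|f ω| ^ (1 / 4 : ℝ)) ∂μ ≤ ENNReal.ofReal (2 * l ^ (1 / 8 : ℝ)) := by
  have hintg : Integrable (fun ω ↦ l ^ (1 / 8 : ℝ) * (1 + f ω ^ 2 / l)) μ :=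
    ((integrable_const 1).add (hf.integrable_sq.div_const l)).const_mul _
  calc _ ≤ ∫⁻ ω, ENNReal.ofReal (l ^ (1 / 8 : ℝ) * (1 + f ω ^ 2 / l)) ∂μ := by
        refine lintegral_mono fun ω ↦ ENNReal.ofReal_le_ofReal ?_
        have : |f ω| ^ (1 / 4 : ℝ) = (f ω ^ 2) ^ (1 / 8 : ℝ) := by
          rw [← sq_abs, ← Real.rpow_two, ← Real.rpow_mul (abs_nonneg _)]; norm_num
        rw [this]
        exact rpow_le_mul_one_add_div (sq_nonneg _) hl (by norm_num) (by norm_num)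
    _ = ENNReal.ofReal (l ^ (1 / 8 : ℝ) * (1 + (∫ ω, f ω ^ 2 ∂μ) / l)) := by
        rw [← ofReal_integral_eq_lintegral_ofReal hintg (ae_of_all _ fun ω ↦ by positivity),
          integral_const_mul, integral_add (integrable_const 1) (hf.integrable_sq.div_const l),
          integral_div]
        simp
    _ ≤ _ := by
        apply ENNReal.ofReal_le_ofReal
        have : (∫ ω, f ω ^ 2 ∂μ) / l ≤ 1 := by rwa [div_le_one hl]
        have h2 : 0 ≤ l ^ (1 / 8 : ℝ) := by positivity
        nlinarith

namespace Rooting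

variable {m n : ℕ} (T : Rooting m) (A b D : ℕ)

/-- The law of the randomness used for one entry of the sketch: the coefficients of the linear
form, and the shifts used for rounding. -/
noncomputable abbrev entryLaw (m n : ℕ) (ν : Measure ℝ) : Measure ((Fin n → ℝ) × (Fin m → ℝ)) :=
  (Measure.pi fun _ ↦ ν).prod (shiftLaw m)

/-- The entry of the sketch at the vertex `v`, before rounding. -/
noncomputable def entry (X : Fin m → Fin n → ℕ) (ω : (Fin n → ℝ) × (Fin m → ℝ)) (v : Fin m) : ℝ :=
  T.noisy A b D (fun v ↦ ∑ j, ω.1 j * X v j) ω.2 v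

lemma measurable_entry (X : Fin m → Fin n → ℕ) (v : Fin m) :
    Measurable fun ω ↦ T.entry A b D X ω v := by
  have h1 : Measurable fun ω : (Fin n → ℝ) × (Fin m → ℝ) ↦
      ((fun v ↦ ∑ j, ω.1 j * (X v j : ℝ) : Fin m → ℝ), ω.2) := by
    refine Measurable.prodMk (measurable_pi_lambda _ fun v ↦ ?_) measurable_snd
    exact (measurable_dot fun j ↦ (X v j : ℝ)).comp measurable_fst
  have h2 := (T.measurable_noisy A b D v).comp h1
  exact h2

variable {A b D} {p : ℝ} {ν : Measure ℝ} [IsProbabilityMeasure ν]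

lemma subsum_dot (X : Fin m → Fin n → ℕ) (z : Fin n → ℝ) (v : Fin m) :
    T.subsum (fun v ↦ ∑ j, z j * (X v j : ℝ)) v
      = ∑ j, z j * T.subsum (fun v ↦ (X v j : ℝ)) v := by
  simp only [subsum, Finset.mul_sum]
  rw [Finset.sum_comm]
  refine Finset.sum_congr rfl fun u _ ↦ ?_
  split_ifs <;> simp

lemma sum_subsum_le_Fp (hp : 1 ≤ p) (hD : ∀ v, T.depth v ≤ D) (X : Fin m → Fin n → ℕ) :
    ∑ v, ∑ j, |T.subsum (fun v ↦ (X v j : ℝ)) v| ^ p ≤ (D + 1) * Fp p X := by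
  rw [Finset.sum_comm, Fp, Finset.mul_sum]
  refine Finset.sum_le_sum fun j _ ↦ ?_
  have hX0 : ∀ v, 0 ≤ (X v j : ℝ) := fun v ↦ Nat.cast_nonneg _
  rw [abs_of_nonneg (Finset.sum_nonneg fun i _ ↦ hX0 i)]
  simp_rw [abs_of_nonneg (T.subsum_nonneg hX0 _)]
  exact T.sum_subsum_rpow_le hD hX0 hp

/-- The power of `D + 1` is rounded up to `1`, which is harmless since only its logarithm enters the
message length. -/
lemma rpow_sum_subsum_le (hp : 1 ≤ p) (hD : ∀ v, T.depth v ≤ D) (X : Fin m → Fin n → ℕ)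
    (hF : 1 ≤ Fp p X) :
    (∑ v, ∑ j, |T.subsum (fun v ↦ (X v j : ℝ)) v| ^ p) ^ (1 / 4 / p)
      ≤ (D + 1) * Fp p X ^ (1 / 4 / p) := by
  have hp0 : 0 < p := by linarith
  have hs : 1 / 4 / p ≤ 1 := by rw [div_le_one hp0]; linarith
  have hD1 : (1 : ℝ) ≤ D + 1 := by linarith [(Nat.cast_nonneg D : (0 : ℝ) ≤ D)]
  calc _ ≤ ((D + 1) * Fp p X) ^ (1 / 4 / p) :=
        Real.rpow_le_rpow (Finset.sum_nonneg fun v _ ↦ Finset.sum_nonneg fun j _ ↦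
          Real.rpow_nonneg (abs_nonneg _) _) (T.sum_subsum_le_Fp hp hD X) (by positivity)
    _ = (D + 1 : ℝ) ^ (1 / 4 / p) * Fp p X ^ (1 / 4 / p) := by
        rw [Real.mul_rpow (by positivity) (by linarith)]
    _ ≤ (D + 1 : ℝ) ^ (1 : ℝ) * Fp p X ^ (1 / 4 / p) :=
        mul_le_mul_of_nonneg_right (Real.rpow_le_rpow_of_exponent_le hD1 hs)
          (Real.rpow_nonneg (by linarith) _)
    _ = _ := by rw [Real.rpow_one]

/-- The cutoff terms sum to at most `1`, which `Fp ≥ 1` and `quarterMoment ν ≥ 1 / 4` absorb by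
raising `12` to `16`. -/
lemma lintegral_square_function_le (hν : IsStable p ν) (hp : 1 ≤ p) (hp2 : p ≤ 2)
    (hD : ∀ v, T.depth v ≤ D) (hA : m * (1 / 4 : ℝ) ^ A ≤ 1) (X : Fin m → Fin n → ℕ)
    (hF : 1 ≤ Fp p X) :
    ∫⁻ z, ENNReal.ofReal ((∑ v, (T.subsum (fun v ↦ ∑ j, z j * (X v j : ℝ)) v ^ 2
        + (1 / 4) ^ A)) ^ (1 / 8 : ℝ)) ∂(Measure.pi fun _ : Fin n ↦ ν)
      ≤ ENNReal.ofReal (16 * quarterMoment ν * (D + 1) * Fp p X ^ (1 / 4 / p)) := by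
  have hp0 : 0 < p := by linarith
  have hq := hν.le_quarterMoment hp
  have hpow := T.rpow_sum_subsum_le hp hD X hF
  simp_rw [T.subsum_dot X]
  generalize hx : (fun v j ↦ T.subsum (fun v ↦ (X v j : ℝ)) v : Fin m → Fin n → ℝ) = x
  have hx' (v : Fin m) (j : Fin n) : T.subsum (fun v ↦ (X v j : ℝ)) v = x v j := by rw [← hx]
  simp_rw [hx'] at hpow ⊢
  have hN : 1 ≤ Fp p X ^ (1 / 4 / p) := Real.one_le_rpow hF (by positivity)
  have hDN : 1 ≤ (D + 1) * Fp p X ^ (1 / 4 / p) := by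
    nlinarith [(Nat.cast_nonneg D : (0 : ℝ) ≤ D)]
  calc _ ≤ ∫⁻ z, (ENNReal.ofReal ((∑ v, (∑ j, z j * x v j) ^ 2) ^ (1 / 8 : ℝ))
          + ENNReal.ofReal 1) ∂(Measure.pi fun _ : Fin n ↦ ν) := by
        refine lintegral_mono fun z ↦ ?_
        simp only
        rw [← ENNReal.ofReal_add (by positivity) zero_le_one]
        apply ENNReal.ofReal_le_ofReal
        rw [Finset.sum_add_distrib]
        refine (Real.rpow_add_le_add_rpow (by positivity) (by positivity) (by norm_num)
          (by norm_num)).trans ?_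
        gcongr
        refine Real.rpow_le_one (by positivity) ?_ (by norm_num)
        simpa using hA
    _ ≤ ENNReal.ofReal (12 * quarterMoment ν * (∑ v, ∑ j, |x v j| ^ p) ^ (1 / 4 / p))
          + ENNReal.ofReal 1 := by
        rw [lintegral_add_right _ measurable_const]
        gcongr
        · exact hν.lintegral_sum_sq_le hp hp2 x
        · simp
    _ ≤ _ := by
        rw [← ENNReal.ofReal_add (by positivity) zero_le_one]
        apply ENNReal.ofReal_le_ofReal
        calc _ ≤ 12 * quarterMoment ν * ((D + 1) * Fp p X ^ (1 / 4 / p)) + 1 := by gcongr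
          _ ≤ _ := by nlinarith

/-- The two kinds of randomness are treated differently: second moments in the shifts for fixed `z`,
then the power `1/8` of this second moment is integrated over the heavy-tailed `z`. -/
lemma lintegral_entry_aux (hν : IsStable p ν) (hp : 1 ≤ p) (hp2 : p ≤ 2)
    (hD : ∀ v, T.depth v ≤ D) (hA : m * (1 / 4 : ℝ) ^ A ≤ 1) (X : Fin m → Fin n → ℕ)
    (hF : 1 ≤ Fp p X) {f : (Fin n → ℝ) → (Fin m → ℝ) → ℝ}
    (hfm : Measurable fun ω : (Fin n → ℝ) × (Fin m → ℝ) ↦ f ω.1 ω.2)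
    (hf : ∀ z, MemLp (f z) 2 (shiftLaw m)) {c : ℝ} (hc : 0 < c)
    (h : ∀ z, ∫ u, f z u ^ 2 ∂(shiftLaw m) ≤
      c * (2 * ∑ v, (T.subsum (fun v ↦ ∑ j, z j * (X v j : ℝ)) v ^ 2 + (1 / 4) ^ A))) :
    ∫⁻ ω, ENNReal.ofReal (|f ω.1 ω.2| ^ (1 / 4 : ℝ)) ∂(entryLaw m n ν)
      ≤ ENNReal.ofReal (64 * c ^ (1 / 8 : ℝ) * quarterMoment ν * (D + 1)
        * Fp p X ^ (1 / 4 / p)) := by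
  have hq := hν.le_quarterMoment hp
  have hm : 0 < m := T.root.pos
  have : Nonempty (Fin m) := ⟨T.root⟩
  have hfm' : Measurable fun ω : (Fin n → ℝ) × (Fin m → ℝ) ↦
      ENNReal.ofReal (|f ω.1 ω.2| ^ (1 / 4 : ℝ)) :=
    ((measurable_abs_rpow (1 / 4)).comp hfm).ennreal_ofReal
  rw [lintegral_prod _ hfm'.aemeasurable]
  set Q : (Fin n → ℝ) → ℝ := fun z ↦
    ∑ v, (T.subsum (fun v ↦ ∑ j, z j * (X v j : ℝ)) v ^ 2 + (1 / 4) ^ A) with hQ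
  have hQ0 (z : Fin n → ℝ) : 0 < Q z :=
    Finset.sum_pos (fun v _ ↦ by positivity) Finset.univ_nonempty
  calc _ ≤ ∫⁻ z, ENNReal.ofReal (4 * c ^ (1 / 8 : ℝ)) * ENNReal.ofReal (Q z ^ (1 / 8 : ℝ))
          ∂(Measure.pi fun _ : Fin n ↦ ν) := by
        refine lintegral_mono fun z ↦ ?_
        have hQz := hQ0 z
        refine (lintegral_rpow_quarter_le (hf z) (l := c * (2 * Q z)) (by positivity) (h z)).trans ?_
        rw [← ENNReal.ofReal_mul (by positivity)]
        apply ENNReal.ofReal_le_ofReal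
        rw [Real.mul_rpow hc.le (by positivity), Real.mul_rpow (by norm_num) hQz.le]
        have h2 : (2 : ℝ) ^ (1 / 8 : ℝ) ≤ 2 ^ (1 : ℝ) := by
          gcongr <;> norm_num
        rw [Real.rpow_one] at h2
        calc _ = 2 * 2 ^ (1 / 8 : ℝ) * (c ^ (1 / 8 : ℝ) * Q z ^ (1 / 8 : ℝ)) := by ring
          _ ≤ 2 * 2 * (c ^ (1 / 8 : ℝ) * Q z ^ (1 / 8 : ℝ)) := by gcongr
          _ = _ := by ring
    _ ≤ ENNReal.ofReal (4 * c ^ (1 / 8 : ℝ)) *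
          ENNReal.ofReal (16 * quarterMoment ν * (D + 1) * Fp p X ^ (1 / 4 / p)) := by
        rw [lintegral_const_mul' _ _ ENNReal.ofReal_ne_top]
        gcongr
        exact T.lintegral_square_function_le hν hp hp2 hD hA X hF
    _ = _ := by
        rw [← ENNReal.ofReal_mul (by positivity)]
        congr 1
        ring

lemma lintegral_entry_le (hν : IsStable p ν) (hp : 1 ≤ p) (hp2 : p ≤ 2)
    (hD : ∀ v, T.depth v ≤ D) (hA : m * (1 / 4 : ℝ) ^ A ≤ 1)
    (hb : (1 / 4 : ℝ) ^ b * (D + 1) ≤ 1 / 2) (X : Fin m → Fin n → ℕ)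
    (hF : 1 ≤ Fp p X) (v : Fin m) :
    ∫⁻ ω, ENNReal.ofReal (|T.entry A b D X ω v| ^ (1 / 4 : ℝ)) ∂(entryLaw m n ν)
      ≤ ENNReal.ofReal (64 * quarterMoment ν * (D + 1) * Fp p X ^ (1 / 4 / p)) := by
  have := T.lintegral_entry_aux hν hp hp2 hD hA X hF (c := 1)
    (f := fun z u ↦ T.entry A b D X (z, u) v) (T.measurable_entry A b D X v)
    (fun z ↦ T.memLp_noisy A b D (fun v ↦ ∑ j, z j * (X v j : ℝ)) v) one_pos
    (fun z ↦ by
      rw [one_mul]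
      exact T.integral_noisy_sq_le hD hb (fun v ↦ ∑ j, z j * (X v j : ℝ)) v)
  simpa only [Real.one_rpow, mul_one] using this

lemma lintegral_entry_root_sub_le (hν : IsStable p ν) (hp : 1 ≤ p) (hp2 : p ≤ 2)
    (hD : ∀ v, T.depth v ≤ D) (hA : m * (1 / 4 : ℝ) ^ A ≤ 1)
    (hb : (1 / 4 : ℝ) ^ b * (D + 1) ≤ 1 / 2) (X : Fin m → Fin n → ℕ)
    (hF : 1 ≤ Fp p X) :
    ∫⁻ ω, ENNReal.ofReal (|T.entry A b D X ω T.root - ∑ j, ω.1 j * ∑ v, (X v j : ℝ)| ^ (1 / 4 : ℝ))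
        ∂(entryLaw m n ν)
      ≤ ENNReal.ofReal (64 * ((1 / 4 : ℝ) ^ b) ^ (1 / 8 : ℝ) * quarterMoment ν * (D + 1)
        * Fp p X ^ (1 / 4 / p)) := by
  have hsw (z : Fin n → ℝ) : ∑ j, z j * ∑ v, (X v j : ℝ) = ∑ v, ∑ j, z j * (X v j : ℝ) := by
    simp_rw [Finset.mul_sum]
    exact Finset.sum_comm
  have hm : Measurable fun ω : (Fin n → ℝ) × (Fin m → ℝ) ↦ ∑ j, ω.1 j * ∑ v, (X v j : ℝ) :=
    (measurable_dot fun j ↦ ∑ v, (X v j : ℝ)).comp measurable_fst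
  refine T.lintegral_entry_aux hν hp hp2 hD hA X hF (c := (1 / 4) ^ b)
    (f := fun z u ↦ T.entry A b D X (z, u) T.root - ∑ j, z j * ∑ v, (X v j : ℝ))
    ((T.measurable_entry A b D X T.root).sub hm)
    (fun z ↦ (T.memLp_noisy A b D (fun v ↦ ∑ j, z j * (X v j : ℝ)) T.root).sub
      (memLp_const (∑ j, z j * ∑ v, (X v j : ℝ)))) (by positivity) fun z ↦ ?_
  simp_rw [hsw]
  exact T.integral_noisy_root_sub_sq_le hD hb (fun v ↦ ∑ j, z j * (X v j : ℝ))

end Rooting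

end MsgPassing

namespace MsgPassing

open MeasureTheory ProbabilityTheory Filter Topology

/-! ### Concentration of the sketch -/

lemma Fp_nonneg {m n : ℕ} (p : ℝ) (X : Fin m → Fin n → ℕ) : 0 ≤ Fp p X :=
  Finset.sum_nonneg fun _ _ ↦ Real.rpow_nonneg (abs_nonneg _) _

/-- Integrality of the inputs turns the absolute error from the exponent cutoff into a relative one.
-/
lemma Fp_eq_zero_or_one_le {m n : ℕ} {p : ℝ} (hp : 0 < p) (X : Fin m → Fin n → ℕ) :
    ((∀ i j, X i j = 0) ∧ Fp p X = 0) ∨ 1 ≤ Fp p X := by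
  by_cases h : ∀ i j, X i j = 0
  · exact Or.inl ⟨h, by simp [Fp, h, Real.zero_rpow hp.ne']⟩
  right
  push Not at h
  obtain ⟨i, j, hij⟩ := h
  have h1 : (1 : ℝ) ≤ ∑ i, (X i j : ℝ) := by
    refine le_trans ?_ (Finset.single_le_sum (f := fun i ↦ (X i j : ℝ))
      (fun _ _ ↦ Nat.cast_nonneg _) (Finset.mem_univ i))
    exact_mod_cast Nat.one_le_iff_ne_zero.2 hij
  refine le_trans ?_ (Finset.single_le_sum (f := fun j ↦ |∑ i, (X i j : ℝ)| ^ p)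
    (fun _ _ ↦ Real.rpow_nonneg (abs_nonneg _) _) (Finset.mem_univ j))
  exact Real.one_le_rpow (h1.trans (le_abs_self _)) hp.le

lemma abs_rpow_quarter_sub_le (x y : ℝ) :
    |(|x| ^ (1 / 4 : ℝ) - |y| ^ (1 / 4 : ℝ))| ≤ |x - y| ^ (1 / 4 : ℝ) := by
  have key (x y : ℝ) : |x| ^ (1 / 4 : ℝ) ≤ |y| ^ (1 / 4 : ℝ) + |x - y| ^ (1 / 4 : ℝ) := by
    refine le_trans ?_ (Real.rpow_add_le_add_rpow (abs_nonneg y) (abs_nonneg _) (by norm_num)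
      (by norm_num))
    gcongr
    calc |x| = |y + (x - y)| := by ring_nf
      _ ≤ _ := abs_add_le _ _
  have h1 := key x y
  have h2 := key y x
  rw [abs_sub_comm y x] at h2
  exact abs_le.2 ⟨by linarith, by linarith⟩

/-- Markov's inequality for a sum of functions of the coordinates of a product space. -/
lemma measure_le_sum_pi_le {Ω : Type*} [MeasurableSpace Ω] {μ : Measure Ω} [IsProbabilityMeasure μ]
    {k : ℕ} {f : Ω → ℝ} (hf : Measurable f) (hf0 : ∀ ω, 0 ≤ f ω) {B : ℝ} (hB0 : 0 ≤ B)
    (hB : ∫⁻ ω, ENNReal.ofReal (f ω) ∂μ ≤ ENNReal.ofReal B) {t : ℝ} (ht : 0 < t) :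
    (Measure.pi fun _ : Fin k ↦ μ).real {ω | t ≤ ∑ i, f (ω i)} ≤ k * B / t := by
  have hm : Measurable fun ω : Fin k → Ω ↦ ∑ i, f (ω i) :=
    Finset.measurable_sum _ fun i _ ↦ hf.comp (measurable_pi_apply i)
  have h1 : ∫⁻ ω, ENNReal.ofReal (∑ i, f (ω i)) ∂(Measure.pi fun _ : Fin k ↦ μ)
      ≤ ENNReal.ofReal (k * B) := by
    calc _ = ∑ i, ∫⁻ ω, ENNReal.ofReal (f (ω i)) ∂(Measure.pi fun _ : Fin k ↦ μ) := by
          simp_rw [ENNReal.ofReal_sum_of_nonneg fun i _ ↦ hf0 _]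
          exact lintegral_finsetSum _ fun i _ ↦ (hf.comp (measurable_pi_apply i)).ennreal_ofReal
      _ = ∑ _i : Fin k, ∫⁻ ω, ENNReal.ofReal (f ω) ∂μ := by
          refine Finset.sum_congr rfl fun i _ ↦ ?_
          exact (measurePreserving_eval (fun _ : Fin k ↦ μ) i).lintegral_comp hf.ennreal_ofReal
      _ ≤ ∑ _i : Fin k, ENNReal.ofReal B := Finset.sum_le_sum fun _ _ ↦ hB
      _ = _ := by
          rw [Finset.sum_const, Finset.card_univ, Fintype.card_fin, nsmul_eq_mul,
            ENNReal.ofReal_mul (by positivity), ENNReal.ofReal_natCast]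
  have h2 := mul_meas_ge_le_lintegral (μ := Measure.pi fun _ : Fin k ↦ μ) hm.ennreal_ofReal
    (ENNReal.ofReal t)
  have h3 : {ω : Fin k → Ω | ENNReal.ofReal t ≤ ENNReal.ofReal (∑ i, f (ω i))}
      = {ω | t ≤ ∑ i, f (ω i)} := by
    ext ω
    simp only [Set.mem_ofPred_eq]
    exact ENNReal.ofReal_le_ofReal_iff (Finset.sum_nonneg fun i _ ↦ hf0 _)
  rw [h3, ← ofReal_measureReal, ← ENNReal.ofReal_mul ht.le] at h2
  have h4 := (ENNReal.ofReal_le_ofReal_iff (by positivity)).1 (h2.trans h1)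
  rw [le_div_iff₀ ht]
  linarith

/-- Chebyshev: the square of a summand is an absolute moment of order `1/2`, with mean at most `5
N²`. The lower bound `1/4` on the quarter moment turns `5` into `5 · 16 = 80`. -/
lemma IsStable.measure_deviation_le {p : ℝ} {ν : Measure ℝ} [IsProbabilityMeasure ν]
    (hν : IsStable p ν) (hp : 1 ≤ p) {m n k : ℕ} (y : Fin n → ℝ) {N : ℝ}
    (hN : (∑ j, |y j| ^ p) ^ (1 / 4 / p) = N) (hN0 : 0 < N) {η : ℝ} (hη : 0 < η) (hk : 0 < k) :
    (Measure.pi fun _ : Fin k ↦ Rooting.entryLaw m n ν).real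
      {ω | k * (η * (quarterMoment ν * N)) ≤
        |∑ i, |∑ j, (ω i).1 j * y j| ^ (1 / 4 : ℝ) - k * (quarterMoment ν * N)|}
      ≤ 80 / (k * η ^ 2) := by
  have hp0 : 0 < p := by linarith
  have hc := hν.le_quarterMoment hp
  set c := quarterMoment ν with hcdef
  set μ := Rooting.entryLaw m n ν with hμ
  set g : (Fin n → ℝ) × (Fin m → ℝ) → ℝ := fun ω ↦ |∑ j, ω.1 j * y j| ^ (1 / 4 : ℝ) with hg
  have hgm : Measurable g :=
    (measurable_abs_rpow (1 / 4)).comp ((measurable_dot y).comp measurable_fst)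
  have hgsq (ω : (Fin n → ℝ) × (Fin m → ℝ)) : g ω ^ 2 = |∑ j, ω.1 j * y j| ^ (1 / 2 : ℝ) := by
    rw [hg, ← Real.rpow_natCast, ← Real.rpow_mul (abs_nonneg _)]; norm_num
  have hmean : ∫ ω, g ω ∂μ = c * N := by
    have := integral_fun_fst (μ := Measure.pi fun _ : Fin n ↦ ν) (ν := Rooting.shiftLaw m)
      (fun z : Fin n → ℝ ↦ |∑ j, z j * y j| ^ (1 / 4 : ℝ))
    rw [hν.integral_pi hp0, hN] at this
    rw [hg, hμ, this, hcdef, quarterMoment]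
    simp [mul_comm]
  have hsq : ∫ ω, g ω ^ 2 ∂μ ≤ 5 * N ^ 2 := by
    simp_rw [hgsq]
    have := integral_fun_fst (μ := Measure.pi fun _ : Fin n ↦ ν) (ν := Rooting.shiftLaw m)
      (fun z : Fin n → ℝ ↦ |∑ j, z j * y j| ^ (1 / 2 : ℝ))
    have h2 : (∑ j, |y j| ^ p) ^ (1 / 2 / p) = N ^ 2 := by
      rw [← hN, ← Real.rpow_natCast, ← Real.rpow_mul (by positivity)]
      congr 1
      push_cast
      ring
    rw [hν.integral_pi hp0, h2] at this
    rw [hμ, this]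
    simp only [probReal_univ, one_smul]
    have := hν.integral_rpow_half_le hp
    nlinarith [sq_nonneg N]
  have hmem : MemLp g 2 μ := by
    rw [memLp_two_iff_integrable_sq hgm.aestronglyMeasurable]
    simp_rw [hgsq]
    exact (hν.integrable_pi hp0 y (hν.integrable_rpow_half hp)).comp_fst _
  set S : (Fin k → (Fin n → ℝ) × (Fin m → ℝ)) → ℝ := ∑ i, fun ω ↦ g (ω i) with hS
  have hSapp (ω : Fin k → (Fin n → ℝ) × (Fin m → ℝ)) : S ω = ∑ i, g (ω i) := by simp [hS]
  have hgi (i : Fin k) : MemLp (fun ω : Fin k → (Fin n → ℝ) × (Fin m → ℝ) ↦ g (ω i)) 2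
      (Measure.pi fun _ : Fin k ↦ μ) :=
    hmem.comp_measurePreserving (measurePreserving_eval (fun _ : Fin k ↦ μ) i)
  have hSmem : MemLp S 2 (Measure.pi fun _ : Fin k ↦ μ) := memLp_finsetSum' _ fun i _ ↦ hgi i
  have hSmean : ∫ ω, S ω ∂(Measure.pi fun _ : Fin k ↦ μ) = k * (c * N) := by
    simp_rw [hSapp]
    rw [integral_finsetSum _ fun i _ ↦ (hgi i).integrable (by norm_num)]
    have (i : Fin k) : ∫ ω, g (ω i) ∂(Measure.pi fun _ : Fin k ↦ μ) = c * N := by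
      rw [integral_comp_eval (μ := fun _ : Fin k ↦ μ) (i := i) (f := g) hgm.aestronglyMeasurable,
        hmean]
    simp [this]
  have hvar : variance S (Measure.pi fun _ : Fin k ↦ μ) ≤ k * (5 * N ^ 2) := by
    rw [hS, variance_sum_pi fun _ ↦ hmem]
    simp only [Finset.sum_const, Finset.card_univ, Fintype.card_fin, nsmul_eq_mul]
    gcongr
    refine (variance_le_expectation_sq hgm.aestronglyMeasurable).trans ?_
    simpa using hsq
  have hk' : (0 : ℝ) < k := by exact_mod_cast hk
  have hpos : 0 < k * (η * (c * N)) := by positivity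
  have hcheb := meas_ge_le_variance_div_sq hSmem hpos
  rw [hSmean, ← ofReal_measureReal, ENNReal.ofReal_le_ofReal_iff (by
    have := variance_nonneg S (Measure.pi fun _ : Fin k ↦ μ); positivity)] at hcheb
  simp_rw [hSapp] at hcheb
  refine hcheb.trans ?_
  calc _ ≤ k * (5 * N ^ 2) / (k * (η * (c * N))) ^ 2 := by gcongr
    _ = 5 / (k * η ^ 2 * c ^ 2) := by field_simp
    _ ≤ 5 / (k * η ^ 2 * (1 / 4) ^ 2) := by gcongr
    _ = _ := by field_simp; norm_num

namespace Rooting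

variable {m n : ℕ} (T : Rooting m) (A A' b D : ℕ)

/-- The event that all intermediate values are in the range of the floating point numbers and
that the sketch determines `Fp` with relative error `O(η)`. -/
def goodEvent (ν : Measure ℝ) (p η : ℝ) (k : ℕ) (X : Fin m → Fin n → ℕ) :
    Set (Fin k → (Fin n → ℝ) × (Fin m → ℝ)) :=
  {ω | (∀ i v, |T.entry A b D X (ω i) v| ≤ 2 ^ A') ∧
    |∑ i, |T.entry A b D X (ω i) T.root| ^ (1 / 4 : ℝ)
      - k * (quarterMoment ν * Fp p X ^ (1 / 4 / p))|
      ≤ k * (2 * η * (quarterMoment ν * Fp p X ^ (1 / 4 / p)))}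

lemma measurableSet_goodEvent (ν : Measure ℝ) (p η : ℝ) (k : ℕ) (X : Fin m → Fin n → ℕ) :
    MeasurableSet (T.goodEvent A A' b D ν p η k X) := by
  have h1 (i : Fin k) (v : Fin m) :
      Measurable fun ω : Fin k → (Fin n → ℝ) × (Fin m → ℝ) ↦ T.entry A b D X (ω i) v :=
    (T.measurable_entry A b D X v).comp (measurable_pi_apply i)
  have h2 : Measurable fun ω : Fin k → (Fin n → ℝ) × (Fin m → ℝ) ↦
      ∑ i, |T.entry A b D X (ω i) T.root| ^ (1 / 4 : ℝ) :=
    Finset.measurable_sum _ fun i _ ↦ (measurable_abs_rpow (1 / 4)).comp (h1 i T.root)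
  have h3 : T.goodEvent A A' b D ν p η k X =
      (⋂ i, ⋂ v, {ω | |T.entry A b D X (ω i) v| ≤ 2 ^ A'}) ∩
      {ω | |∑ i, |T.entry A b D X (ω i) T.root| ^ (1 / 4 : ℝ)
        - k * (quarterMoment ν * Fp p X ^ (1 / 4 / p))|
        ≤ k * (2 * η * (quarterMoment ν * Fp p X ^ (1 / 4 / p)))} := by
    ext ω
    simp [goodEvent]
  rw [h3]
  refine (MeasurableSet.iInter fun i ↦ MeasurableSet.iInter fun v ↦ ?_).inter ?_
  · exact measurableSet_le (continuous_abs.measurable.comp (h1 i v)) measurable_const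
  · exact measurableSet_le (continuous_abs.measurable.comp (h2.sub measurable_const))
      measurable_const

variable {A A' b D} {p : ℝ} {ν : Measure ℝ} [IsProbabilityMeasure ν]

lemma entry_eq_zero (X : Fin m → Fin n → ℕ) (hX : ∀ i j, X i j = 0)
    (ω : (Fin n → ℝ) × (Fin m → ℝ)) (v : Fin m) : T.entry A b D X ω v = 0 := by
  simp only [entry, hX, Nat.cast_zero, mul_zero, Finset.sum_const_zero, noisy]
  suffices ∀ t v, T.agg (fun w y ↦ fround A b y (ω.2 w)) (fun _ ↦ 0) t v = 0 from this D v
  intro t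
  induction t with
  | zero => exact fun v ↦ rfl
  | succ t ih => intro v; simp [agg, ih]

/-- The good event has high probability. -/
theorem le_measure_goodEvent (hν : IsStable p ν) (hp : 1 ≤ p) (hp2 : p ≤ 2)
    (hD : ∀ v, T.depth v ≤ D) (hA : m * (1 / 4 : ℝ) ^ A ≤ 1)
    (hb : (1 / 4 : ℝ) ^ b * (D + 1) ≤ 1 / 2) {η : ℝ} (hη : 0 < η)
    (hb' : 1536 * (D + 1) * ((1 / 4 : ℝ) ^ b) ^ (1 / 8 : ℝ) ≤ η)
    {k : ℕ} (hk : 0 < k) (hk' : 1920 ≤ k * η ^ 2) (X : Fin m → Fin n → ℕ)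
    (hA' : 9216 * (k * m * (D + 1)) * Fp p X ^ (1 / 4 / p) ≤ ((2 : ℝ) ^ A') ^ (1 / 4 : ℝ)) :
    7 / 8 ≤ (Measure.pi fun _ : Fin k ↦ entryLaw m n ν).real (T.goodEvent A A' b D ν p η k X) := by
  have hp0 : 0 < p := by linarith
  have hc := hν.le_quarterMoment hp
  have hc6 := hν.quarterMoment_le hp
  have hkr : (0 : ℝ) < k := by exact_mod_cast hk
  -- If all inputs vanish, every intermediate value is exactly `0` and the event is certain.
  rcases Fp_eq_zero_or_one_le hp0 X with ⟨hX, hF⟩ | hF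
  · have : T.goodEvent A A' b D ν p η k X = Set.univ := by
      refine Set.eq_univ_of_forall fun ω ↦ ?_
      have h0 : (0 : ℝ) ^ (1 / 4 / p) = 0 := Real.zero_rpow (by positivity)
      have h1 : (0 : ℝ) ^ (1 / 4 : ℝ) = 0 := Real.zero_rpow (by norm_num)
      refine ⟨fun i v ↦ ?_, ?_⟩
      · rw [T.entry_eq_zero X hX, abs_zero]; positivity
      · simp_rw [T.entry_eq_zero X hX, hF, abs_zero, h0, h1]
        simp
    rw [this, probReal_univ]
    norm_num
  set c := quarterMoment ν with hcdef
  set N := Fp p X ^ (1 / 4 / p) with hNdef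
  have hN : 1 ≤ N := Real.one_le_rpow hF (by positivity)
  set μ := Measure.pi fun _ : Fin k ↦ entryLaw m n ν with hμ
  set y : Fin n → ℝ := fun j ↦ ∑ v, (X v j : ℝ) with hy
  -- Three failures with budget `1/24` each: deviation of the exact sketch, total rounding error at
  -- the root, and overflow (`1/(24 m)` per vertex). Hence `1920 = 24 · 80`, `1536 = 24 · 64` and
  -- `9216 = 1536 · 6`.
  set B₁ : Set (Fin k → (Fin n → ℝ) × (Fin m → ℝ)) := {ω | k * (η * (c * N)) ≤
    |∑ i, |∑ j, (ω i).1 j * y j| ^ (1 / 4 : ℝ) - k * (c * N)|} with hB₁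
  set B₂ : Set (Fin k → (Fin n → ℝ) × (Fin m → ℝ)) := {ω | k * (η * (c * N)) ≤
    ∑ i, |T.entry A b D X (ω i) T.root - ∑ j, (ω i).1 j * y j| ^ (1 / 4 : ℝ)} with hB₂
  set B₃ : Fin m → Set (Fin k → (Fin n → ℝ) × (Fin m → ℝ)) := fun v ↦
    {ω | ((2 : ℝ) ^ A') ^ (1 / 4 : ℝ) ≤
      ∑ i, |T.entry A b D X (ω i) v| ^ (1 / 4 : ℝ)} with hB₃
  have h₁ : μ.real B₁ ≤ 1 / 24 := by
    refine (hν.measure_deviation_le hp (m := m) y rfl (by positivity) hη hk).trans ?_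
    rw [div_le_div_iff₀ (by positivity) (by norm_num)]
    linarith
  have hm₀ : Measurable fun ω : (Fin n → ℝ) × (Fin m → ℝ) ↦
      |T.entry A b D X ω T.root - ∑ j, ω.1 j * y j| ^ (1 / 4 : ℝ) :=
    (measurable_abs_rpow (1 / 4)).comp ((T.measurable_entry A b D X T.root).sub
      ((measurable_dot y).comp measurable_fst))
  have h₂ : μ.real B₂ ≤ 1 / 24 := by
    refine (measure_le_sum_pi_le hm₀ (fun ω ↦ Real.rpow_nonneg (abs_nonneg _) _) (by positivity)
      (T.lintegral_entry_root_sub_le hν hp hp2 hD hA hb X hF) (by positivity)).trans ?_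
    rw [div_le_div_iff₀ (by positivity) (by norm_num)]
    calc _ = (1536 * (D + 1) * ((1 / 4 : ℝ) ^ b) ^ (1 / 8 : ℝ)) * (k * (c * N)) := by ring
      _ ≤ η * (k * (c * N)) := by gcongr
      _ = _ := by ring
  have hm : 0 < m := T.root.pos
  have hmr : (0 : ℝ) < m := by exact_mod_cast hm
  have h₃ (v : Fin m) : μ.real (B₃ v) ≤ 1 / (24 * m) := by
    refine (measure_le_sum_pi_le ((measurable_abs_rpow (1 / 4)).comp (T.measurable_entry A b D X v))
      (fun ω ↦ Real.rpow_nonneg (abs_nonneg _) _) (by positivity)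
      (T.lintegral_entry_le hν hp hp2 hD hA hb X hF v) (by positivity)).trans ?_
    rw [div_le_div_iff₀ (by positivity) (by positivity)]
    calc _ = (1536 * c) * ((k * m * (D + 1)) * N) := by ring
      _ ≤ (1536 * 6) * ((k * m * (D + 1)) * N) := by gcongr
      _ = 9216 * (k * m * (D + 1)) * N := by ring
      _ ≤ _ := by rw [one_mul]; exact hA'
  have hsub : (T.goodEvent A A' b D ν p η k X)ᶜ ⊆ (B₁ ∪ B₂) ∪ ⋃ v, B₃ v := by
    intro ω hω
    by_contra hcon
    simp only [Set.mem_union, Set.mem_iUnion, not_or, not_exists, hB₁, hB₂, hB₃,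
      Set.mem_ofPred_eq] at hcon
    obtain ⟨⟨hn₁, hn₂⟩, hn₃⟩ := hcon
    refine hω ⟨fun i v ↦ ?_, ?_⟩
    · have h1 := not_le.1 (hn₃ v)
      by_contra h2
      refine h1.not_ge (le_trans ?_ (Finset.single_le_sum
        (f := fun i ↦ |T.entry A b D X (ω i) v| ^ (1 / 4 : ℝ))
        (fun i _ ↦ Real.rpow_nonneg (abs_nonneg _) _) (Finset.mem_univ i)))
      exact Real.rpow_le_rpow (by positivity) (not_le.1 h2).le (by norm_num)
    · have h1 := not_le.1 hn₁
      have h2 := not_le.1 hn₂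
      have h4 : |∑ i, |T.entry A b D X (ω i) T.root| ^ (1 / 4 : ℝ)
          - ∑ i, |∑ j, (ω i).1 j * y j| ^ (1 / 4 : ℝ)|
          ≤ ∑ i, |T.entry A b D X (ω i) T.root - ∑ j, (ω i).1 j * y j| ^ (1 / 4 : ℝ) := by
        rw [← Finset.sum_sub_distrib]
        exact (Finset.abs_sum_le_sum_abs _ _).trans
          (Finset.sum_le_sum fun i _ ↦ abs_rpow_quarter_sub_le _ _)
      have h5 := abs_sub_le (∑ i, |T.entry A b D X (ω i) T.root| ^ (1 / 4 : ℝ))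
        (∑ i, |∑ j, (ω i).1 j * y j| ^ (1 / 4 : ℝ)) (k * (c * N))
      linarith
  have hcompl := probReal_compl_eq_one_sub (μ := μ)
    (T.measurableSet_goodEvent A A' b D ν p η k X)
  have hfin : μ.real (T.goodEvent A A' b D ν p η k X)ᶜ ≤ 1 / 24 + 1 / 24 + 1 / 24 := by
    refine (measureReal_mono hsub).trans ((measureReal_union_le _ _).trans (add_le_add
      ((measureReal_union_le _ _).trans (add_le_add h₁ h₂)) ?_))
    refine (measureReal_iUnion_fintype_le _).trans ((Finset.sum_le_sum fun v _ ↦ h₃ v).trans ?_)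
    simp only [Finset.sum_const, Finset.card_univ, Fintype.card_fin, nsmul_eq_mul]
    apply le_of_eq
    field_simp
  linarith

end Rooting

end MsgPassing

namespace MsgPassing

open MeasureTheory ProbabilityTheory Filter Topology

/-! ### Simulating a probability space by coin tosses -/

/-- Only the pattern of events containing `ω` matters, and it has finitely many values. Each pattern
of positive mass is represented by one sample point, and its mass is rounded down to a multiple of
`2^(-R)`. -/
lemma exists_coins_simulation {Ω ι : Type*} [MeasurableSpace Ω] (μ : Measure Ω)
    [IsProbabilityMeasure μ] [Finite ι] (E : ι → Set Ω) (hE : ∀ i, MeasurableSet (E i))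
    (h : ∀ i, 7 / 8 ≤ μ.real (E i)) :
    ∃ (R : ℕ) (f : (Fin R → Bool) → Ω), ∀ i, 3 / 4 ≤ coinProb {ω | f ω ∈ E i} := by
  classical
  have := Fintype.ofFinite ι
  have hΩ : Nonempty Ω := nonempty_of_isProbabilityMeasure μ
  let pat : Ω → ι → Bool := fun ω i ↦ decide (ω ∈ E i)
  have hpat : Measurable pat := measurable_pi_lambda _ fun i ↦ measurable_to_bool (by
    have : (fun ω ↦ pat ω i) ⁻¹' {true} = E i := by ext ω; simp [pat]
    rw [this]; exact hE i)
  have : IsProbabilityMeasure (μ.map pat) := Measure.isProbabilityMeasure_map hpat.aemeasurable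
  let w : (ι → Bool) → ℝ := fun s ↦ (μ.map pat).real {s}
  have hw0 : ∀ s, 0 ≤ w s := fun s ↦ measureReal_nonneg
  have hw1 : ∑ s, w s = 1 := by
    simp only [w]
    rw [sum_measureReal_singleton]
    simp
  have hwE (i : ι) : ∑ s ∈ Finset.univ.filter (fun s : ι → Bool ↦ s i = true), w s
      = μ.real (E i) := by
    simp only [w]
    rw [sum_measureReal_singleton, map_measureReal_apply hpat (Finset.measurableSet _)]
    congr 1
    ext ω
    simp [pat]
  set t := Fintype.card (ι → Bool) with ht
  -- Rounding loses at most `t / 2^R ≤ 2^t / 2^(t+3) = 1/8`, the gap between `7/8` and `3/4`.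
  let R : ℕ := t + 3
  let c : (ι → Bool) → ℕ := fun s ↦ ⌊w s * 2 ^ R⌋₊
  have hc : Fintype.card (Σ s, Fin (c s)) ≤ Fintype.card (Fin R → Bool) := by
    simp only [Fintype.card_sigma, Fintype.card_fin, Fintype.card_pi, Fintype.card_bool,
      Finset.prod_const, Finset.card_univ]
    have : ((∑ s, c s : ℕ) : ℝ) ≤ 2 ^ R := by
      push_cast
      calc _ ≤ ∑ s, w s * 2 ^ R :=
            Finset.sum_le_sum fun s _ ↦ Nat.floor_le (mul_nonneg (hw0 s) (by positivity))
        _ = _ := by rw [← Finset.sum_mul, hw1, one_mul]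
    exact_mod_cast this
  obtain ⟨emb⟩ := Function.Embedding.nonempty_of_card_le hc
  let rep : (ι → Bool) → Ω := fun s ↦ if h : ∃ ω, pat ω = s then h.choose else Classical.arbitrary Ω
  have hrep (s : ι → Bool) (hs : 0 < c s) : pat (rep s) = s := by
    have h1 : ∃ ω, pat ω = s := by
      by_contra hcon
      have h2 : pat ⁻¹' {s} = ∅ := by
        ext ω
        simp only [Set.mem_preimage, Set.mem_singleton_iff, Set.mem_empty_iff_false, iff_false]
        exact fun h ↦ hcon ⟨ω, h⟩
      have h3 : w s = 0 := by
        simp only [w]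
        rw [map_measureReal_apply hpat (measurableSet_singleton s), h2, measureReal_empty]
      simp [c, h3] at hs
    simp only [rep, dif_pos h1]
    exact h1.choose_spec
  refine ⟨R, Function.extend emb (fun s ↦ rep s.1) fun _ ↦ Classical.arbitrary Ω, fun i ↦ ?_⟩
  set S := {ω | Function.extend emb (fun s ↦ rep s.1) (fun _ ↦ Classical.arbitrary Ω) ω ∈ E i}
    with hS
  have hsub : (((Finset.univ.filter (fun s : ι → Bool ↦ s i = true)).sigma
      fun s ↦ (Finset.univ : Finset (Fin (c s)))).map emb : Set (Fin R → Bool)) ⊆ S := by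
    intro ω hω
    simp only [Finset.coe_map, Set.mem_image, Finset.mem_coe, Finset.mem_sigma, Finset.mem_filter,
      Finset.mem_univ, true_and, and_true] at hω
    obtain ⟨s, hs, rfl⟩ := hω
    simp only [hS, Set.mem_ofPred_eq]
    rw [emb.injective.extend_apply]
    have h1 := hrep s.1 s.2.pos
    have h2 := congrFun h1 i
    rw [hs] at h2
    simpa [pat] using h2
  have hcard : ∑ s ∈ Finset.univ.filter (fun s : ι → Bool ↦ s i = true), c s ≤ S.ncard := by
    have := Set.ncard_le_ncard hsub (Set.toFinite _)
    rw [Set.ncard_coe_finset, Finset.card_map, Finset.card_sigma] at this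
    simpa using this
  have hpow : (t : ℝ) ≤ 2 ^ t := by exact_mod_cast Nat.lt_two_pow_self.le
  have h2R : (2 : ℝ) ^ R = 2 ^ t * 8 := by simp only [R]; rw [pow_add]; norm_num
  have hreal : 2 ^ R * μ.real (E i) - t ≤ (S.ncard : ℝ) := by
    calc _ ≤ ∑ s ∈ Finset.univ.filter (fun s : ι → Bool ↦ s i = true), (w s * 2 ^ R - 1) := by
          rw [Finset.sum_sub_distrib, ← Finset.sum_mul, hwE, mul_comm]
          gcongr
          simp only [Finset.sum_const, nsmul_eq_mul, mul_one]
          exact_mod_cast Finset.card_le_univ _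
      _ ≤ ∑ s ∈ Finset.univ.filter (fun s : ι → Bool ↦ s i = true), (c s : ℝ) :=
          Finset.sum_le_sum fun s _ ↦ by
            have := Nat.lt_floor_add_one (w s * 2 ^ R)
            simp only [c]
            linarith
      _ ≤ _ := by exact_mod_cast hcard
  rw [coinProb, le_div_iff₀ (by positivity)]
  have := h i
  have h8 : (7 / 8) * (2 : ℝ) ^ R ≤ 2 ^ R * μ.real (E i) := by
    rw [mul_comm]; gcongr
  nlinarith

/-! ### Convergecast protocols -/

/-- The protocol in which every vertex, in order of decreasing depth, sends one message to its
parent, computed from its input and the messages of its children. -/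
def treeProtocol {m n : ℕ} (G : SimpleGraph (Fin m)) (T : Rooting m)
    (hadj : ∀ v, v ≠ T.root → G.Adj v (T.parent v)) (D R : ℕ)
    (msg : Fin m → (Fin n → ℕ) → (Fin R → Bool) → (Fin m → Option (List Bool)) → List Bool)
    (out : (Fin n → ℕ) → (Fin R → Bool) → (Fin m → Option (List Bool)) → ℝ) : Protocol G n where
  coins := R
  rounds := D
  target t i := if i ≠ T.root ∧ t + T.depth i = D then some (T.parent i) else none
  target_adj t i j h := by
    split_ifs at h with h1
    obtain rfl := Option.some.inj h
    exact hadj i h1.1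
  message _ i x ω V := msg i x ω (V.getLast?.getD fun _ ↦ none)
  center := T.root
  output x ω V := out x ω (V.getLast?.getD fun _ ↦ none)

section

variable {m n : ℕ} {G : SimpleGraph (Fin m)} {T : Rooting m}
  {hadj : ∀ v, v ≠ T.root → G.Adj v (T.parent v)} {D R : ℕ}
  {msg : Fin m → (Fin n → ℕ) → (Fin R → Bool) → (Fin m → Option (List Bool)) → List Bool}
  {out : (Fin n → ℕ) → (Fin R → Bool) → (Fin m → Option (List Bool)) → ℝ}

lemma treeProtocol_target (t : ℕ) (i : Fin m) :
    (treeProtocol G T hadj D R msg out).target t i =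
      if i ≠ T.root ∧ t + T.depth i = D then some (T.parent i) else none := rfl

lemma treeProtocol_isOneShot (hD : ∀ v, T.depth v ≤ D) :
    (treeProtocol G T hadj D R msg out).IsOneShot := by
  have h0 := (T.depth_eq_zero T.root).2 rfl
  have hc : (treeProtocol G T hadj D R msg out).center = T.root := rfl
  have hr : (treeProtocol G T hadj D R msg out).rounds = D := rfl
  have hsome (s : ℕ) (u i : Fin m)
      (h : (treeProtocol G T hadj D R msg out).target s u = some i) :
      s + T.depth i + 1 = D := by
    rw [treeProtocol_target] at h
    split_ifs at h with h1
    obtain rfl := Option.some.inj h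
    have := T.depth_parent u h1.1
    omega
  -- A vertex of depth `δ` sends in round `D - δ`, so the children of the root send in round `D -
  -- 1`.
  refine ⟨fun i hi ↦ ?_, fun t _ ↦ ?_, D - 1, fun s _ u hu ↦ ?_⟩
  · rw [hc] at hi
    have h1 := T.depth_parent i hi
    have h2 := hD i
    refine ⟨D - T.depth i, by rw [hr]; omega, ?_, fun t' _ ht' ↦ ?_, fun s _ u hu ↦ ?_⟩
    · rw [treeProtocol_target, if_pos ⟨hi, by omega⟩]; rfl
    · rw [treeProtocol_target, if_neg]
      rintro ⟨_, h⟩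
      omega
    · have := hsome s u i hu
      omega
  · rw [treeProtocol_target, hc, if_neg]
    simp
  · have := hsome s u _ hu
    rw [hc, h0] at this
    omega

/-- All children of `v` send in the round just before that of `v`, so the last entry of the view
holds all their messages. At depth `D` the view is empty, and there are no children. -/
lemma treeProtocol_last_view (hD : ∀ v, T.depth v ≤ D) (X : Fin m → Fin n → ℕ)
    (ω : Fin R → Bool) (S : Fin m → List Bool) (v : Fin m)
    (hS : ∀ w, T.IsChild w v → (treeProtocol G T hadj D R msg out).message (D - T.depth w) w (X w) ω
      ((treeProtocol G T hadj D R msg out).view X ω (D - T.depth w) w) = S w) :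
    (((treeProtocol G T hadj D R msg out).view X ω (D - T.depth v) v).getLast?.getD fun _ ↦ none)
      = fun w ↦ if T.IsChild w v then some (S w) else none := by
  have hv := hD v
  rcases h : D - T.depth v with _ | t
  · simp only [Protocol.view]
    ext1 w
    rw [if_neg]
    · rfl
    · rintro ⟨h1, _⟩
      have := hD w
      omega
  · simp only [Protocol.view, List.getLast?_append, List.getLast?_singleton, Option.some_or,
      Option.getD_some]
    ext1 w
    by_cases hw : T.IsChild w v
    · have h1 := hw.1
      have hroot : w ≠ T.root := fun h' ↦ by
        have := (T.depth_eq_zero w).2 h'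
        omega
      have ht : (treeProtocol G T hadj D R msg out).target t w = some v := by
        rw [treeProtocol_target, if_pos ⟨hroot, by omega⟩, hw.2]
      rw [if_pos hw, if_pos ht]
      have h2 := hS w hw
      rw [show D - T.depth w = t by omega] at h2
      rw [h2]
    · rw [if_neg hw, if_neg]
      rw [treeProtocol_target]
      intro h1
      split_ifs at h1 with h2
      refine hw ⟨?_, Option.some.inj h1⟩
      omega

lemma treeProtocol_message (hD : ∀ v, T.depth v ≤ D) (X : Fin m → Fin n → ℕ)
    (ω : Fin R → Bool) (S : Fin m → List Bool)
    (hS : ∀ v, S v = msg v (X v) ω fun w ↦ if T.IsChild w v then some (S w) else none) (v : Fin m) :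
    (treeProtocol G T hadj D R msg out).message (D - T.depth v) v (X v) ω
      ((treeProtocol G T hadj D R msg out).view X ω (D - T.depth v) v) = S v := by
  induction v using T.induction_depth hD with
  | h v ih =>
    rw [hS v, ← treeProtocol_last_view hD X ω S v ih]
    rfl

lemma treeProtocol_result (hD : ∀ v, T.depth v ≤ D) (X : Fin m → Fin n → ℕ)
    (ω : Fin R → Bool) (S : Fin m → List Bool)
    (hS : ∀ v, S v = msg v (X v) ω fun w ↦ if T.IsChild w v then some (S w) else none) :
    (treeProtocol G T hadj D R msg out).result X ω
      = out (X T.root) ω fun w ↦ if T.IsChild w T.root then some (S w) else none := by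
  rw [← treeProtocol_last_view (hadj := hadj) (out := out) hD X ω S T.root
    (fun w _ ↦ treeProtocol_message hD X ω S hS w), (T.depth_eq_zero T.root).2 rfl]
  rfl

lemma treeProtocol_bitsSent_le {L : ℕ} (hL : ∀ v x ω F, (msg v x ω F).length ≤ L)
    (X : Fin m → Fin n → ℕ) (ω : Fin R → Bool) (i j : Fin m) :
    (treeProtocol G T hadj D R msg out).bitsSent X ω i j ≤ if T.parent i = j then L else 0 := by
  have h1 (t : ℕ) : (if (treeProtocol G T hadj D R msg out).target t i = some j then
      ((treeProtocol G T hadj D R msg out).message t i (X i) ω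
        ((treeProtocol G T hadj D R msg out).view X ω t i)).length else 0)
      ≤ if t = D - T.depth i then (if T.parent i = j then L else 0) else 0 := by
    split_ifs with h1 h2 h3 h3
    · exact hL _ _ _ _
    · rw [treeProtocol_target] at h1
      split_ifs at h1
      exact absurd (Option.some.inj h1) h3
    · rw [treeProtocol_target] at h1
      split_ifs at h1
      omega
    all_goals simp
  refine (Finset.sum_le_sum fun t _ ↦ h1 t).trans ?_
  rw [Finset.sum_ite_eq']
  split_ifs <;> simp

lemma treeProtocol_maxComm_le {L : ℕ} (hL : ∀ v x ω F, (msg v x ω F).length ≤ L)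
    (X : Fin m → Fin n → ℕ) (ω : Fin R → Bool) :
    (treeProtocol G T hadj D R msg out).maxComm X ω ≤ 2 * L := by
  refine Finset.sup_le fun e _ ↦ ?_
  have h (i j : Fin m) : (treeProtocol G T hadj D R msg out).bitsSent X ω i j ≤ L :=
    (treeProtocol_bitsSent_le hL X ω i j).trans (by split_ifs <;> simp)
  have h1 := h e.1 e.2
  have h2 := h e.2 e.1
  omega

lemma treeProtocol_totalComm_le {L : ℕ} (hL : ∀ v x ω F, (msg v x ω F).length ≤ L)
    (X : Fin m → Fin n → ℕ) (ω : Fin R → Bool) :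
    (treeProtocol G T hadj D R msg out).totalComm X ω ≤ m * L := by
  calc _ ≤ ∑ i, ∑ j, (if T.parent i = j then L else 0) :=
        Finset.sum_le_sum fun i _ ↦ Finset.sum_le_sum fun j _ ↦ treeProtocol_bitsSent_le hL X ω i j
    _ = _ := by simp

end

/-- Every connected graph has a rooted spanning tree of depth at most its diameter. -/
lemma exists_rooting {m : ℕ} {G : SimpleGraph (Fin m)} (hG : G.Connected) :
    ∃ T : Rooting m, (∀ v, v ≠ T.root → G.Adj v (T.parent v)) ∧ ∀ v, T.depth v ≤ G.diam := by
  have := hG.nonempty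
  let r : Fin m := Classical.arbitrary _
  have hpar (v : Fin m) : ∃ w, v ≠ r → G.Adj v w ∧ G.dist w r + 1 = G.dist v r := by
    by_cases hv : v = r
    · exact ⟨v, fun h ↦ absurd hv h⟩
    -- The second vertex of a geodesic to `r` serves as the parent.
    obtain ⟨q, hq⟩ := hG.exists_walk_length_eq_dist v r
    cases q with
    | nil => exact absurd rfl hv
    | @cons _ w _ h q =>
      refine ⟨w, fun _ ↦ ⟨h, ?_⟩⟩
      rw [SimpleGraph.Walk.length_cons] at hq
      have h1 := SimpleGraph.dist_le q
      have h2 := hG.dist_triangle (u := v) (v := w) (w := r)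
      rw [SimpleGraph.dist_eq_one_iff_adj.2 h] at h2
      omega
  choose par hpar using hpar
  refine ⟨⟨r, par, fun v ↦ G.dist v r, fun v ↦ ?_, fun v hv ↦ (hpar v hv).2⟩,
    fun v hv ↦ (hpar v hv).1, fun v ↦ ?_⟩
  · exact hG.dist_eq_zero_iff
  · exact SimpleGraph.dist_le_diam (SimpleGraph.connected_iff_ediam_ne_top.1 hG)

end MsgPassing

namespace MsgPassing

open MeasureTheory ProbabilityTheory Filter Topology

/-! ### The sketching protocol -/

lemma exists_code {M : Type*} [Fintype M] [Nonempty M] {L : ℕ} (h : Fintype.card M ≤ 2 ^ L) :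
    ∃ (enc : M → List Bool) (dec : List Bool → M),
      (∀ s, dec (enc s) = s) ∧ ∀ s, (enc s).length = L := by
  have h' : Fintype.card M ≤ Fintype.card (Fin L → Bool) := by simpa using h
  obtain ⟨e⟩ := Function.Embedding.nonempty_of_card_le h'
  have hinj : Function.Injective fun s ↦ List.ofFn (e s) :=
    List.ofFn_injective.comp e.injective
  exact ⟨fun s ↦ List.ofFn (e s), Function.invFun _, Function.leftInverse_invFun hinj,
    fun s ↦ List.length_ofFn⟩

open Classical in
/-- Replace numbers outside the grid by `0`. -/
noncomputable def toGrid (A A' b : ℕ) (y : ℝ) : grid A A' b :=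
  if h : y ∈ grid A A' b then ⟨y, h⟩ else ⟨0, zero_mem_grid A A' b⟩

lemma toGrid_of_mem {A A' b : ℕ} {y : ℝ} (h : y ∈ grid A A' b) :
    (toGrid A A' b y : ℝ) = y := by simp [toGrid, h]

/-- Since `4 p ≤ 8`, a relative error `ε / 16` grows to about `ε / 2`: Bernoulli's inequality from
below, `exp (ε / 2) ≤ 1 + ε` from above. -/
lemma Fp_recovery {F p ε s : ℝ} (hF : 0 ≤ F) (hp : 1 ≤ p) (hp2 : p ≤ 2) (hε : 0 < ε) (hε1 : ε < 1)
    (hs : |s - F ^ (1 / 4 / p)| ≤ ε / 16 * F ^ (1 / 4 / p)) :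
    s ^ (4 * p) ∈ Set.Icc ((1 - ε) * F) ((1 + ε) * F) := by
  have hp0 : 0 < p := by linarith
  set N := F ^ (1 / 4 / p) with hN
  have hN0 : 0 ≤ N := Real.rpow_nonneg hF _
  have hNF : N ^ (4 * p) = F := by
    rw [hN, ← Real.rpow_mul hF]
    have : 1 / 4 / p * (4 * p) = 1 := by field_simp
    rw [this, Real.rpow_one]
  obtain ⟨h1, h2⟩ := abs_le.1 hs
  have hlo : (1 - ε / 16) * N ≤ s := by linarith
  have hhi : s ≤ (1 + ε / 16) * N := by linarith
  have hs0 : 0 ≤ s := le_trans (mul_nonneg (by linarith) hN0) hlo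
  constructor
  · calc (1 - ε) * F ≤ (1 - ε / 16) ^ (4 * p) * F := by
          gcongr
          have hb := one_add_mul_self_le_rpow_one_add (s := -(ε / 16)) (by linarith)
            (p := 4 * p) (by linarith)
          rw [← sub_eq_add_neg] at hb
          nlinarith
      _ = ((1 - ε / 16) * N) ^ (4 * p) := by rw [Real.mul_rpow (by linarith) hN0, hNF]
      _ ≤ s ^ (4 * p) := Real.rpow_le_rpow (mul_nonneg (by linarith) hN0) hlo (by linarith)
  · calc s ^ (4 * p) ≤ ((1 + ε / 16) * N) ^ (4 * p) := Real.rpow_le_rpow hs0 hhi (by linarith)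
      _ = (1 + ε / 16) ^ (4 * p) * F := by rw [Real.mul_rpow (by linarith) hN0, hNF]
      _ ≤ (1 + ε) * F := by
          gcongr
          calc (1 + ε / 16) ^ (4 * p) ≤ (1 + ε / 16) ^ (8 : ℝ) :=
                Real.rpow_le_rpow_of_exponent_le (by linarith) (by linarith)
            _ ≤ Real.exp (ε / 16) ^ (8 : ℝ) := by
                refine Real.rpow_le_rpow (by linarith) ?_ (by norm_num)
                linarith [Real.add_one_le_exp (ε / 16)]
            _ = Real.exp (ε / 2) := by rw [← Real.exp_mul]; congr 1; ring
            _ ≤ 1 + ε := by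
                have := Real.abs_exp_sub_one_le (x := ε / 2)
                  (by rw [abs_le]; constructor <;> linarith)
                rw [abs_of_pos (by linarith : 0 < ε / 2)] at this
                linarith [(abs_le.1 this).2]

section

variable (A A' b : ℕ) {k : ℕ} (dec : List Bool → Fin k → grid A A' b) {m n : ℕ} (T : Rooting m)
  (ω : Fin k → (Fin n → ℝ) × (Fin m → ℝ))

/-- The sum of the own contribution of a vertex to the sketch and of what it received. -/
noncomputable def gather (x : Fin n → ℕ) (inbox : Fin m → Option (List Bool)) (i : Fin k) : ℝ :=
  ∑ j, (ω i).1 j * x j + ∑ w, (inbox w).elim 0 fun l ↦ (dec l i : ℝ)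

/-- The values at the vertices when rounding is restricted to the grid. -/
noncomputable def gridEntry (D : ℕ) (X : Fin m → Fin n → ℕ) (i : Fin k) (v : Fin m) : ℝ :=
  T.agg (fun w y ↦ toGrid A A' b (fround A b y ((ω i).2 w))) (fun v ↦ ∑ j, (ω i).1 j * X v j) D v

variable {A A' b dec}

lemma gather_eq_gridEntry {D : ℕ} (hD : ∀ v, T.depth v ≤ D) (X : Fin m → Fin n → ℕ)
    (enc : (Fin k → grid A A' b) → List Bool) (hdec : ∀ s, dec (enc s) = s) (v : Fin m) :
    gather A A' b dec ω (X v) (fun w ↦ if T.IsChild w v then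
      some (enc fun i ↦ toGrid A A' b (fround A b (gridEntry A A' b T ω D X i w) ((ω i).2 w)))
      else none) = fun i ↦ gridEntry A A' b T ω D X i v := by
  funext i
  rw [gather, gridEntry, T.agg_eq hD]
  congr 1
  refine Finset.sum_congr rfl fun w _ ↦ ?_
  split_ifs with h
  · simp only [Option.elim_some, hdec]
    rfl
  · rfl

lemma gridEntry_eq_entry {D : ℕ} (hD : ∀ v, T.depth v ≤ D) (X : Fin m → Fin n → ℕ) (i : Fin k)
    (h : ∀ v, |T.entry A b D X (ω i) v| ≤ 2 ^ A') (v : Fin m) :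
    gridEntry A A' b T ω D X i v = T.entry A b D X (ω i) v :=
  T.agg_congr hD (fun v ↦ toGrid_of_mem (fround_mem_grid (h v))) v

end

/-- The protocol exists as soon as the parameters of the floating point format, the number `k` of
entries of the sketch, and the message length `L` are large enough. -/
theorem hasOneShotFpProtocol_of_parameters {m n M : ℕ} {G : SimpleGraph (Fin m)} (T : Rooting m)
    (hadj : ∀ v, v ≠ T.root → G.Adj v (T.parent v)) {D : ℕ} (hD : ∀ v, T.depth v ≤ D)
    {p ε : ℝ} (hp : 1 ≤ p) (hp2 : p ≤ 2) (hε : 0 < ε) (hε1 : ε < 1) {A A' b k L : ℕ}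
    (hA : m * (1 / 4 : ℝ) ^ A ≤ 1) (hb : (1 / 4 : ℝ) ^ b * (D + 1) ≤ 1 / 2)
    (hb' : 1536 * (D + 1) * ((1 / 4 : ℝ) ^ b) ^ (1 / 8 : ℝ) ≤ ε / 32)
    (hk : 0 < k) (hk' : 1920 ≤ k * (ε / 32) ^ 2)
    (hA' : ∀ X : Fin m → Fin n → ℕ, (∀ i j, X i j ≤ M) →
      9216 * (k * m * (D + 1)) * Fp p X ^ (1 / 4 / p) ≤ ((2 : ℝ) ^ A') ^ (1 / 4 : ℝ))
    (hL : (grid A A' b).card ^ k ≤ 2 ^ L) {B : ℝ} (hB : 2 * L ≤ B) :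
    HasOneShotFpProtocol G n M p ε B := by
  obtain ⟨ν, hν1, hν⟩ := exists_stable (p := p) (by linarith) hp2
  replace hν : IsStable p ν := hν
  have hc := hν.le_quarterMoment hp
  set c := quarterMoment ν with hcdef
  have hkr : (0 : ℝ) < k := by exact_mod_cast hk
  -- Inputs are indexed by a finite type, as the coin simulation requires. The good event allows
  -- deviation `2 η`, so `η = ε / 32` matches the `ε / 16` of `Fp_recovery`.
  let good : (Fin m → Fin n → Fin (M + 1)) → Set (Fin k → (Fin n → ℝ) × (Fin m → ℝ)) :=
    fun X ↦ T.goodEvent A A' b D ν p (ε / 32) k fun i j ↦ (X i j : ℕ)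
  obtain ⟨R, f, hf⟩ := exists_coins_simulation (Measure.pi fun _ : Fin k ↦ Rooting.entryLaw m n ν)
    good (fun X ↦ T.measurableSet_goodEvent A A' b D ν p _ k _) fun X ↦
      T.le_measure_goodEvent hν hp hp2 hD hA hb (by positivity) hb' hk hk' _
        (hA' _ fun i j ↦ Nat.lt_succ_iff.1 (X i j).2)
  have hne : Nonempty (Fin k → grid A A' b) := ⟨fun _ ↦ ⟨0, zero_mem_grid A A' b⟩⟩
  obtain ⟨enc, dec, hdec, hlen⟩ := exists_code (M := Fin k → grid A A' b) (L := L) (by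
    simpa using hL)
  let msg : Fin m → (Fin n → ℕ) → (Fin R → Bool) → (Fin m → Option (List Bool)) → List Bool :=
    fun v x ω inbox ↦ enc fun i ↦ toGrid A A' b
      (fround A b (gather A A' b dec (f ω) x inbox i) ((f ω i).2 v))
  let out : (Fin n → ℕ) → (Fin R → Bool) → (Fin m → Option (List Bool)) → ℝ :=
    fun x ω inbox ↦ ((∑ i, |gather A A' b dec (f ω) x inbox i| ^ (1 / 4 : ℝ)) / (k * c)) ^ (4 * p)
  have hmsg (v : Fin m) (x : Fin n → ℕ) (ω : Fin R → Bool) (F : Fin m → Option (List Bool)) :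
      (msg v x ω F).length ≤ L := (hlen _).le
  refine ⟨treeProtocol G T hadj D R msg out, treeProtocol_isOneShot hD, fun X hX ↦ ⟨?_, fun ω ↦ ?_⟩⟩
  · have hX' := hf fun i j ↦ ⟨X i j, Nat.lt_succ_iff.2 (hX i j)⟩
    refine hX'.trans ?_
    unfold coinProb
    refine div_le_div_of_nonneg_right ?_ (by positivity)
    refine Nat.cast_le.2 (Set.ncard_le_ncard ?_ (Set.toFinite _))
    intro ω hω
    obtain ⟨hrange, hdev⟩ := hω
    have hres := treeProtocol_result (hadj := hadj) (out := out) (msg := msg) hD X ω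
      (fun v ↦ enc fun i ↦ toGrid A A' b
        (fround A b (gridEntry A A' b T (f ω) D X i v) ((f ω i).2 v))) (fun v ↦ by
        simp only [msg]
        rw [gather_eq_gridEntry T (f ω) hD X enc hdec v])
    simp only [out] at hres
    rw [gather_eq_gridEntry T (f ω) hD X enc hdec T.root] at hres
    simp_rw [gridEntry_eq_entry T (f ω) hD X _ (hrange _)] at hres
    change (treeProtocol G T hadj D R msg out).result X ω
      ∈ Set.Icc ((1 - ε) * Fp p X) ((1 + ε) * Fp p X)
    rw [hres]
    refine Fp_recovery (Fp_nonneg p X) hp hp2 hε hε1 ?_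
    have hkc : 0 < k * c := by positivity
    have h1 : (∑ i, |T.entry A b D X (f ω i) T.root| ^ (1 / 4 : ℝ)) / (k * c)
        - Fp p X ^ (1 / 4 / p) = (∑ i, |T.entry A b D X (f ω i) T.root| ^ (1 / 4 : ℝ)
          - k * (c * Fp p X ^ (1 / 4 / p))) / (k * c) := by
      field_simp
    rw [h1, abs_div, abs_of_pos hkc, div_le_iff₀ hkc]
    refine hdev.trans (le_of_eq ?_)
    ring
  · have h1 : ((treeProtocol G T hadj D R msg out).maxComm X ω : ℝ) ≤ 2 * L := by
      exact_mod_cast treeProtocol_maxComm_le hmsg X ω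
    have h2 : ((treeProtocol G T hadj D R msg out).totalComm X ω : ℝ) ≤ m * L := by
      exact_mod_cast treeProtocol_totalComm_le hmsg X ω
    refine ⟨h1.trans hB, h2.trans ?_⟩
    gcongr
    linarith [(Nat.cast_nonneg L : (0 : ℝ) ≤ L)]

/-- When all inputs vanish, nothing needs to be communicated. -/
lemma hasOneShotFpProtocol_of_forall_eq_zero {m n M : ℕ} {G : SimpleGraph (Fin m)}
    (hG : G.Connected) {p ε B : ℝ} (hp : 0 < p) (hB : 0 ≤ B)
    (h : ∀ X : Fin m → Fin n → ℕ, (∀ i j, X i j ≤ M) → ∀ i j, X i j = 0) :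
    HasOneShotFpProtocol G n M p ε B := by
  obtain ⟨T, hadj, hD⟩ := exists_rooting hG
  refine ⟨treeProtocol G T hadj G.diam 0 (fun _ _ _ _ ↦ []) fun _ _ _ ↦ 0,
    treeProtocol_isOneShot hD, fun X hX ↦ ⟨?_, fun ω ↦ ⟨?_, ?_⟩⟩⟩
  · have hF : Fp p X = 0 := by simp [Fp, h X hX, Real.zero_rpow hp.ne']
    have hS : {ω : Fin 0 → Bool | (treeProtocol G T hadj G.diam 0 (fun _ _ _ _ ↦ [])
        fun _ _ _ ↦ 0).result X ω ∈ Set.Icc ((1 - ε) * Fp p X) ((1 + ε) * Fp p X)}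
        = Set.univ := by
      refine Set.eq_univ_of_forall fun ω ↦ ?_
      simp only [Set.mem_ofPred_eq]
      rw [hF, mul_zero, mul_zero]
      exact ⟨le_rfl, le_rfl⟩
    change 3 / 4 ≤ coinProb {ω : Fin 0 → Bool | _}
    rw [hS, coinProb, Set.ncard_univ]
    norm_num
  · have := treeProtocol_maxComm_le (G := G) (T := T) (hadj := hadj) (D := G.diam) (R := 0)
      (msg := fun _ _ _ _ ↦ []) (out := fun _ _ _ ↦ 0) (L := 0) (by simp) X ω
    rw [Nat.le_zero.1 this]
    simpa using hB
  · have := treeProtocol_totalComm_le (G := G) (T := T) (hadj := hadj) (D := G.diam) (R := 0)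
      (msg := fun _ _ _ _ ↦ []) (out := fun _ _ _ ↦ 0) (L := 0) (by simp) X ω
    rw [Nat.le_zero.1 this]
    simp only [Nat.cast_zero]
    positivity

end MsgPassing

namespace MsgPassing

open MeasureTheory ProbabilityTheory Filter Topology

/-! ### Choice of the parameters -/

lemma HasOneShotFpProtocol.mono {m n M : ℕ} {G : SimpleGraph (Fin m)} {p ε B B' : ℝ}
    (h : HasOneShotFpProtocol G n M p ε B) (hB : B ≤ B') : HasOneShotFpProtocol G n M p ε B' := by
  obtain ⟨P, hP, h⟩ := h
  refine ⟨P, hP, fun X hX ↦ ⟨(h X hX).1, fun ω ↦ ?_⟩⟩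
  obtain ⟨h1, h2⟩ := (h X hX).2 ω
  exact ⟨h1.trans hB, h2.trans (by gcongr)⟩

/-- The number of bits needed to count up to `x`. -/
noncomputable def bitLength (x : ℝ) : ℕ := ⌈Real.logb 2 x⌉₊

lemma le_two_pow_bitLength {x : ℝ} (hx : 0 < x) : x ≤ 2 ^ bitLength x := by
  rw [← Real.rpow_natCast, ← Real.logb_le_iff_le_rpow one_lt_two hx]
  exact Nat.le_ceil _

lemma bitLength_le {x : ℝ} (hx : 1 ≤ x) : (bitLength x : ℝ) ≤ 3 / 2 * Real.log x + 1 := by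
  have h0 := Real.log_nonneg hx
  have h1 : Real.logb 2 x ≤ 3 / 2 * Real.log x := by
    rw [Real.logb, div_le_iff₀ (Real.log_pos one_lt_two)]
    nlinarith [Real.log_two_gt_d9]
  refine (Nat.ceil_lt_add_one (Real.logb_nonneg one_lt_two hx)).le.trans ?_
  linarith

lemma log_le_of_le_two_pow {x : ℝ} (hx : 0 < x) {k : ℕ} (h : x ≤ 2 ^ k) :
    Real.log x ≤ k * (7 / 10) := by
  calc Real.log x ≤ Real.log (2 ^ k) := Real.log_le_log hx h
    _ = k * Real.log 2 := by rw [Real.log_pow]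
    _ ≤ _ := by gcongr; linarith [Real.log_two_lt_d9]

lemma log_one_add_le {x : ℝ} (hx : 0 ≤ x) : Real.log (1 + x) ≤ x := by
  have := Real.log_le_sub_one_of_pos (show 0 < 1 + x by linarith)
  linarith

/-- A positive lower bound on the iterated logarithm lets it absorb all additive constants in the
message length. -/
lemma quarter_le_log_log {x : ℝ} (hx : 4 ≤ x) : 1 / 4 ≤ Real.log (Real.log x) := by
  have h1 : 4 / 3 ≤ Real.log x := by
    have h2 : Real.log 4 = 2 * Real.log 2 := by
      rw [show (4 : ℝ) = 2 ^ 2 by norm_num, Real.log_pow]; norm_num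
    have h3 := Real.log_le_log (by norm_num) hx
    linarith [Real.log_two_gt_d9]
  have h4 := Real.one_sub_inv_le_log_of_pos (show (0 : ℝ) < 4 / 3 by norm_num)
  have h5 := Real.log_le_log (by norm_num) h1
  norm_num at h4
  linarith

lemma log_log_nonneg {x : ℝ} (hx : 0 ≤ x) : 0 ≤ Real.log (Real.log (x + 3)) := by
  apply Real.log_nonneg
  rw [Real.le_log_iff_exp_le (by linarith)]
  linarith [Real.exp_one_lt_d9]

lemma log_natCast_add_one_le (D : ℕ) : Real.log (D + 1) ≤ Real.log D + 7 / 10 := by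
  rcases Nat.eq_zero_or_pos D with rfl | hD
  · simp; norm_num
  have h1 : (1 : ℝ) ≤ D := by exact_mod_cast hD
  calc Real.log (D + 1) ≤ Real.log (D * 2) := Real.log_le_log (by positivity) (by linarith)
    _ = Real.log D + Real.log 2 := Real.log_mul (by positivity) (by norm_num)
    _ ≤ _ := by linarith [Real.log_two_lt_d9]

lemma Fp_rpow_le {m n M : ℕ} {p : ℝ} (hp : 1 ≤ p) (hm : 0 < m) (hn : 0 < n) (hM : 0 < M)
    (X : Fin m → Fin n → ℕ) (hX : ∀ i j, X i j ≤ M) :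
    Fp p X ^ (1 / 4 / p) ≤ m * n * M := by
  have hp0 : 0 < p := by linarith
  have hmr : (1 : ℝ) ≤ m := by exact_mod_cast hm
  have hnr : (1 : ℝ) ≤ n := by exact_mod_cast hn
  have hMr : (1 : ℝ) ≤ M := by exact_mod_cast hM
  have h1 (j : Fin n) : |∑ i, (X i j : ℝ)| ≤ m * M := by
    rw [abs_of_nonneg (Finset.sum_nonneg fun i _ ↦ Nat.cast_nonneg _)]
    calc _ ≤ ∑ _i : Fin m, (M : ℝ) := Finset.sum_le_sum fun i _ ↦ by exact_mod_cast hX i j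
      _ = _ := by simp
  have h2 : Fp p X ≤ n * (m * M) ^ p := by
    calc _ ≤ ∑ _j : Fin n, ((m : ℝ) * M) ^ p :=
          Finset.sum_le_sum fun j _ ↦ Real.rpow_le_rpow (abs_nonneg _) (h1 j) hp0.le
      _ = _ := by simp
  have h3 : Fp p X ≤ (m * n * M) ^ p := by
    have : (n : ℝ) ≤ (n : ℝ) ^ p := by
      simpa using Real.rpow_le_rpow_of_exponent_le hnr hp
    calc _ ≤ n * (m * M : ℝ) ^ p := h2
      _ ≤ (n : ℝ) ^ p * (m * M : ℝ) ^ p := by gcongr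
      _ = _ := by rw [← Real.mul_rpow (by positivity) (by positivity)]; ring_nf
  have h4 : (1 : ℝ) ≤ m * n * M := one_le_mul_of_one_le_of_one_le
    (one_le_mul_of_one_le_of_one_le hmr hnr) hMr
  calc _ ≤ ((m * n * M : ℝ) ^ p) ^ (1 / 4 / p) :=
        Real.rpow_le_rpow (Fp_nonneg p X) h3 (by positivity)
    _ = (m * n * M : ℝ) ^ (1 / 4 : ℝ) := by
        rw [← Real.rpow_mul (by positivity)]; congr 1; field_simp
    _ ≤ (m * n * M : ℝ) ^ (1 : ℝ) := Real.rpow_le_rpow_of_exponent_le h4 (by norm_num)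
    _ = _ := Real.rpow_one _

/-- The product form is chosen for its logarithm, which splits into `log ℓ` and terms at most `E`
and `d`. -/
lemma exponent_range_le {ℓ E d A s : ℝ} (hℓ : 1 ≤ ℓ) (hE : 0 ≤ E) (hd : 0 ≤ d)
    (hA : A ≤ 3 / 2 * ℓ + 1) (hs : s ≤ 3 / 2 * (25 + 2 * E + 2 * ℓ + d) + 1) :
    A + 4 * s + 1 ≤ 170 * ℓ * (1 + E) * (1 + d) := by
  have e1 : 0 ≤ E * d := mul_nonneg hE hd
  have e2 : 0 ≤ (ℓ - 1) * (E + d + E * d) := mul_nonneg (by linarith) (by linarith)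
  have e3 : 170 * ℓ * (1 + E) * (1 + d) =
      170 * ℓ + 170 * ((ℓ - 1) * (E + d + E * d)) + 170 * (E + d + E * d) := by ring
  linarith

set_option maxHeartbeats 1600000 in
/-- The protocol for general parameters, with an explicit constant. -/
theorem hasOneShotFpProtocol_general {p ε : ℝ} (hp : 1 < p) (hp2 : p ≤ 2) (hε : 0 < ε)
    (hε1 : ε < 1) (n M m : ℕ) (G : SimpleGraph (Fin m)) (hG : G.Connected) :
    HasOneShotFpProtocol G n M p ε (10 ^ 10 / ε ^ 2 *
      (Real.log (Real.log (m * n * M + 3)) + Real.log G.diam + Real.log (1 / ε))) := by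
  have hE : 0 ≤ Real.log (1 / ε) := Real.log_nonneg (by rw [le_div_iff₀ hε]; linarith)
  have hlD : 0 ≤ Real.log G.diam := Real.log_natCast_nonneg _
  have hll := log_log_nonneg (show (0 : ℝ) ≤ m * n * M by positivity)
  by_cases hz : n = 0 ∨ M = 0
  · refine hasOneShotFpProtocol_of_forall_eq_zero hG (by linarith) (by positivity) fun X hX i j ↦ ?_
    rcases hz with rfl | rfl
    · exact j.elim0
    · exact Nat.le_zero.1 (hX i j)
  push Not at hz
  obtain ⟨T, hadj, hD⟩ := exists_rooting hG
  have hm : 0 < m := T.root.pos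
  have hn : 0 < n := Nat.pos_of_ne_zero hz.1
  have hM : 0 < M := Nat.pos_of_ne_zero hz.2
  have hmr : (1 : ℝ) ≤ m := by exact_mod_cast hm
  have hnr : (1 : ℝ) ≤ n := by exact_mod_cast hn
  have hMr : (1 : ℝ) ≤ M := by exact_mod_cast hM
  set D := G.diam with hDdef
  set Q : ℝ := m * n * M with hQ
  have hmn : (m : ℝ) ≤ m * n := le_mul_of_one_le_right (by linarith) hnr
  have hmQ : (m : ℝ) ≤ Q := hmn.trans (le_mul_of_one_le_right (by positivity) hMr)
  have hQ1 : 1 ≤ Q := hmr.trans hmQ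
  have hD0 : (0 : ℝ) ≤ D := Nat.cast_nonneg _
  set ℓ := Real.log (Q + 3) with hℓ
  have hlq : 1 / 4 ≤ Real.log ℓ := quarter_le_log_log (by linarith)
  have hℓ1 : 1 ≤ ℓ := by
    rw [hℓ, Real.le_log_iff_exp_le (by linarith)]
    linarith [Real.exp_one_lt_d9]
  set d := Real.log (D + 1) with hd
  have hd0 : 0 ≤ d := Real.log_nonneg (by linarith)
  set E := Real.log (1 / ε) with hEdef
  have hEε : Real.log ε = -E := by rw [hEdef, one_div, Real.log_inv, neg_neg]
  -- the number of entries of the sketch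
  obtain ⟨k, hk1, hk2⟩ : ∃ k : ℕ, 1966080 / ε ^ 2 ≤ k ∧ (k : ℝ) ≤ 1966081 / ε ^ 2 := by
    refine ⟨⌈1966080 / ε ^ 2⌉₊, Nat.le_ceil _, (Nat.ceil_lt_add_one (by positivity)).le.trans ?_⟩
    have : 1 ≤ 1 / ε ^ 2 := by
      rw [le_div_iff₀ (by positivity)]
      nlinarith
    calc (1966080 / ε ^ 2 + 1 : ℝ) ≤ 1966080 / ε ^ 2 + 1 / ε ^ 2 := by linarith
      _ = _ := by ring
  have hkpos : (0 : ℝ) < k := lt_of_lt_of_le (by positivity) hk1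
  have hk0 : 0 < k := by exact_mod_cast hkpos
  have hlogk : Real.log k ≤ 15 + 2 * E := by
    calc Real.log k ≤ Real.log (1966081 / ε ^ 2) := Real.log_le_log hkpos hk2
      _ = Real.log 1966081 + 2 * E := by
        rw [Real.log_div (by norm_num) (by positivity), Real.log_pow, hEε]; push_cast; ring
      _ ≤ _ := by
        have := log_le_of_le_two_pow (x := 1966081) (by norm_num) (k := 21) (by norm_num)
        push_cast at this
        linarith
  -- the mantissa
  set W : ℝ := 49152 * (D + 1) / ε with hW
  have hW1 : 2 * (D + 1) ≤ W := by
    rw [hW, le_div_iff₀ hε]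
    nlinarith
  set t := bitLength W with ht
  have htW : W ≤ 2 ^ t := le_two_pow_bitLength (by linarith)
  have hthalf : (1 / 2 : ℝ) ^ t ≤ 1 / W := by
    rw [one_div_pow]
    exact one_div_le_one_div_of_le (by linarith) htW
  have hlogW : Real.log W ≤ 12 + d + E := by
    have h1 := log_le_of_le_two_pow (x := 49152) (by norm_num) (k := 16) (by norm_num)
    push_cast at h1
    rw [hW, Real.log_div (by positivity) hε.ne', Real.log_mul (by norm_num) (by positivity), hEε]
    linarith
  have htle : (t : ℝ) ≤ 3 / 2 * (12 + d + E) + 1 := by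
    have := bitLength_le (x := W) (by linarith)
    linarith
  -- the exponents
  set A := bitLength m with hAdef
  have hA : (m : ℝ) ≤ 2 ^ A := le_two_pow_bitLength (by linarith)
  have hAle : (A : ℝ) ≤ 3 / 2 * ℓ + 1 := by
    have h1 := bitLength_le hmr
    have h2 : Real.log m ≤ ℓ := Real.log_le_log (by linarith) (by linarith)
    linarith
  set V : ℝ := 9216 * (k * m * (D + 1)) * Q with hV
  have hk1' : (1 : ℝ) ≤ k := by exact_mod_cast hk0
  have hV1 : 1 ≤ V := by
    have h1 : (1 : ℝ) ≤ k * m * (D + 1) :=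
      one_le_mul_of_one_le_of_one_le (one_le_mul_of_one_le_of_one_le hk1' hmr) (by linarith)
    nlinarith
  set s := bitLength V with hs
  have hsV : V ≤ 2 ^ s := le_two_pow_bitLength (by linarith)
  have hlogV : Real.log V ≤ 25 + 2 * E + 2 * ℓ + d := by
    have h1 := log_le_of_le_two_pow (x := 9216) (by norm_num) (k := 14) (by norm_num)
    push_cast at h1
    have h2 : Real.log m ≤ ℓ := Real.log_le_log (by linarith) (by linarith)
    have h3 : Real.log Q ≤ ℓ := Real.log_le_log (by linarith) (by linarith)
    rw [hV, Real.log_mul (by positivity) (by positivity), Real.log_mul (by norm_num) (by positivity),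
      Real.log_mul (by positivity) (by positivity), Real.log_mul (by positivity) (by positivity)]
    linarith
  have hsle : (s : ℝ) ≤ 3 / 2 * (25 + 2 * E + 2 * ℓ + d) + 1 := by
    have := bitLength_le hV1
    linarith
  -- The exponent has `A + 4 s + 1` possible values, a number logarithmic in the parameters;
  -- addressing them is where the iterated logarithm arises.
  set h := bitLength (A + 4 * s + 1) with hh
  have hA0 : (0 : ℝ) ≤ A := Nat.cast_nonneg _
  have hs0 : (0 : ℝ) ≤ s := Nat.cast_nonneg _
  have hhle : (h : ℝ) ≤ 3 / 2 * (6 + Real.log ℓ + E + d) + 1 := by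
    have h1 := bitLength_le (x := A + 4 * s + 1) (by linarith)
    have h2 : (A + 4 * s + 1 : ℝ) ≤ 170 * ℓ * (1 + E) * (1 + d) :=
      exponent_range_le hℓ1 hE hd0 hAle hsle
    have h3 : Real.log (A + 4 * s + 1) ≤ 6 + Real.log ℓ + E + d := by
      refine (Real.log_le_log (by linarith) h2).trans ?_
      rw [Real.log_mul (by positivity) (by positivity), Real.log_mul (by positivity) (by positivity),
        Real.log_mul (by norm_num) (by positivity)]
      have h4 := log_le_of_le_two_pow (x := 170) (by norm_num) (k := 8) (by norm_num)
      push_cast at h4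
      have h5 := log_one_add_le hE
      have h6 := log_one_add_le hd0
      linarith
    linarith
  have hquarter (x : ℕ) : (1 / 4 : ℝ) ^ x = (1 / 2) ^ x * (1 / 2) ^ x := by
    rw [← mul_pow]; norm_num
  have hhalf1 (x : ℕ) : (1 / 2 : ℝ) ^ x ≤ 1 := pow_le_one₀ (by norm_num) (by norm_num)
  -- The factors `4` undo the small powers: `(2^(4s))^(1/4) = 2^s` and `(4^(-4t))^(1/8) = 2^(-t)`.
  -- Each of the `k` entries takes `h` bits for the exponent and `4 t + 3` for the signed mantissa.
  refine hasOneShotFpProtocol_of_parameters T hadj hD hp.le hp2 hε hε1 (A := A) (A' := 4 * s)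
    (b := 4 * t) (k := k) (L := k * (h + (4 * t + 3))) ?_ ?_ ?_ hk0 ?_ ?_ ?_ ?_
  · have h1 : (m : ℝ) * (1 / 2) ^ A ≤ 1 := by
      rw [one_div_pow, mul_one_div, div_le_one (by positivity)]; exact hA
    have h2 := hhalf1 A
    rw [hquarter, ← mul_assoc]
    exact mul_le_one₀ h1 (by positivity) h2
  · have h1 : (1 / 4 : ℝ) ^ (4 * t) ≤ (1 / 2) ^ t := by
      rw [show (1 / 4 : ℝ) ^ (4 * t) = (1 / 2) ^ (t + 7 * t) by
        rw [show (1 / 4 : ℝ) = (1 / 2) ^ 2 by norm_num, ← pow_mul]; congr 1; ring, pow_add]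
      exact mul_le_of_le_one_right (by positivity) (hhalf1 _)
    calc (1 / 4 : ℝ) ^ (4 * t) * (D + 1) ≤ 1 / W * (D + 1) := by
          gcongr; exact h1.trans hthalf
      _ ≤ 1 / 2 := by
          rw [div_mul_eq_mul_div, div_le_div_iff₀ (by linarith) (by norm_num)]; linarith
  · have h1 : ((1 / 4 : ℝ) ^ (4 * t)) ^ (1 / 8 : ℝ) = (1 / 2) ^ t := by
      rw [show (1 / 4 : ℝ) ^ (4 * t) = ((1 / 2) ^ t) ^ (8 : ℕ) by
        rw [show (1 / 4 : ℝ) = (1 / 2) ^ 2 by norm_num, ← pow_mul, ← pow_mul]; congr 1; ring,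
        ← Real.rpow_natCast, ← Real.rpow_mul (by positivity)]
      norm_num
    rw [h1]
    calc 1536 * ((D : ℝ) + 1) * (1 / 2) ^ t ≤ 1536 * (D + 1) * (1 / W) := by gcongr
      _ = ε / 32 := by rw [hW]; field_simp; norm_num
  -- `1966080 = 1920 · 32²`.
  · calc (1920 : ℝ) = 1966080 / ε ^ 2 * (ε / 32) ^ 2 := by field_simp; norm_num
      _ ≤ _ := by gcongr
  · intro X hX
    have h1 : ((2 : ℝ) ^ (4 * s)) ^ (1 / 4 : ℝ) = 2 ^ s := by
      rw [mul_comm, pow_mul, ← Real.rpow_natCast (2 ^ s), ← Real.rpow_mul (by positivity)]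
      norm_num
    rw [h1]
    refine le_trans ?_ hsV
    rw [hV]
    gcongr
    exact Fp_rpow_le hp.le hm hn hM X hX
  · rw [mul_comm k, pow_mul]
    gcongr
    refine (card_grid_le A (4 * s) (4 * t)).trans ?_
    rw [pow_add 2 h]
    gcongr
    have : (A + 4 * s + 1 : ℝ) ≤ 2 ^ h := le_two_pow_bitLength (by linarith)
    exact_mod_cast this
  · have h1 : d ≤ Real.log D + 7 / 10 := log_natCast_add_one_le D
    have h2 : (h + (4 * t + 3) : ℝ) ≤ 400 * (Real.log ℓ + Real.log D + E) := by linarith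
    push_cast
    calc 2 * ((k : ℝ) * (h + (4 * t + 3)))
        ≤ 2 * (1966081 / ε ^ 2 * (400 * (Real.log ℓ + Real.log D + E))) := by gcongr
      _ = 1572864800 / ε ^ 2 * (Real.log ℓ + Real.log D + E) := by ring
      _ ≤ 10 ^ 10 / ε ^ 2 * (Real.log ℓ + Real.log D + E) := by
        gcongr
        norm_num

end MsgPassing

/-! ### Polynomially bounded parameters and conclusion -/

theorem theorem3p4 :
    -- the bound in `log log n`, when `m` and `M` are polynomially bounded in `n`
    (∀ c : ℕ, ∃ K : ℝ, 0 < K ∧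
      ∀ (p ε : ℝ), 1 < p → p ≤ 2 → 0 < ε → ε < 1 →
      ∀ (n M m : ℕ) (G : SimpleGraph (Fin m)), G.Connected →
      m ≤ c * n ^ c → M ≤ c * n ^ c →
      MsgPassing.HasOneShotFpProtocol G n M p ε
        (K / ε ^ 2 * (Real.log (Real.log (n + 3)) + Real.log G.diam + Real.log (1 / ε)))) ∧
    -- the bound for general `m, n, M`
    (∃ K : ℝ, 0 < K ∧
      ∀ (p ε : ℝ), 1 < p → p ≤ 2 → 0 < ε → ε < 1 →
      ∀ (n M m : ℕ) (G : SimpleGraph (Fin m)), G.Connected →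
      MsgPassing.HasOneShotFpProtocol G n M p ε
        (K / ε ^ 2 * (Real.log (Real.log (m * n * M + 3)) + Real.log G.diam
          + Real.log (1 / ε)))) := by
  refine ⟨fun c ↦ ?_, 10 ^ 10, by norm_num, fun p ε hp hp2 hε hε1 n M m G hG ↦
    MsgPassing.hasOneShotFpProtocol_general hp hp2 hε hε1 n M m G hG⟩
  -- Here `mnM ≤ c² n^(2c+1)` and `c² ≤ (n+3)^(c²)`; one more factor `n + 3` absorbs the shift by
  -- `3`. Thus `J` costs only `log J` after two logarithms, absorbed as `4 log J` times an iterated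
  -- logarithm that is at least `1/4`.
  set J : ℕ := c ^ 2 + 2 * c + 2 with hJ
  have hJ1 : (1 : ℝ) ≤ J := by exact_mod_cast (by omega : 1 ≤ J)
  have hlogJ : 0 ≤ Real.log J := Real.log_nonneg hJ1
  refine ⟨10 ^ 10 * (1 + 4 * Real.log J), by positivity,
    fun p ε hp hp2 hε hε1 n M m G hG hm hM ↦
    (MsgPassing.hasOneShotFpProtocol_general hp hp2 hε hε1 n M m G hG).mono ?_⟩
  have hm0 : 0 < m := by
    have := hG.nonempty
    exact Fin.pos_iff_nonempty.2 this
  have hn : 1 ≤ n := by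
    -- For `n = 0` the bound `c * 0 ^ c` is `0` even when `c = 0`, which would leave the connected
    -- graph without vertices.
    rcases Nat.eq_zero_or_pos n with rfl | h
    · rcases Nat.eq_zero_or_pos c with rfl | hc
      · simp at hm; omega
      · rw [zero_pow hc.ne'] at hm; omega
    · exact h
  have hE : 0 ≤ Real.log (1 / ε) := Real.log_nonneg (by rw [le_div_iff₀ hε]; linarith)
  have hlD : 0 ≤ Real.log G.diam := Real.log_natCast_nonneg _
  have hnat : m * n * M + 3 ≤ (n + 3) ^ J := by
    have h1 : c ^ 2 ≤ (n + 3) ^ c ^ 2 :=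
      Nat.lt_two_pow_self.le.trans (Nat.pow_le_pow_left (by omega) _)
    have h2 : n ^ (2 * c + 1) ≤ (n + 3) ^ (2 * c + 1) := Nat.pow_le_pow_left (by omega) _
    have h3 : m * n * M ≤ (n + 3) ^ (c ^ 2 + 2 * c + 1) := by
      calc m * n * M ≤ (c * n ^ c) * n * (c * n ^ c) := by gcongr
        _ = c ^ 2 * n ^ (2 * c + 1) := by ring
        _ ≤ (n + 3) ^ c ^ 2 * (n + 3) ^ (2 * c + 1) := Nat.mul_le_mul h1 h2
        _ = _ := by ring
    have h4 : 1 ≤ (n + 3) ^ (c ^ 2 + 2 * c + 1) := Nat.one_le_pow _ _ (by omega)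
    have h5 : (n + 3) ^ J = (n + 3) ^ (c ^ 2 + 2 * c + 1) * (n + 3) := by rw [← pow_succ]
    nlinarith
  have hn3 : (4 : ℝ) ≤ n + 3 := by
    have : (1 : ℝ) ≤ n := by exact_mod_cast hn
    linarith
  have hlq := MsgPassing.quarter_le_log_log hn3
  have hlogn : 0 < Real.log (n + 3) := Real.log_pos (by linarith)
  have hle : Real.log (Real.log (m * n * M + 3))
      ≤ (1 + 4 * Real.log J) * Real.log (Real.log (n + 3)) := by
    have h1 : Real.log (m * n * M + 3) ≤ J * Real.log (n + 3) := by
      rw [← Real.log_pow]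
      exact Real.log_le_log (by positivity) (by exact_mod_cast hnat)
    have h0 : 0 < Real.log (m * n * M + 3) := Real.log_pos (by
      have : (0 : ℝ) ≤ m * n * M := by positivity
      linarith)
    calc _ ≤ Real.log (J * Real.log (n + 3)) := Real.log_le_log h0 h1
      _ = Real.log J + Real.log (Real.log (n + 3)) := Real.log_mul (by positivity) hlogn.ne'
      _ ≤ _ := by nlinarith
  calc 10 ^ 10 / ε ^ 2 * (Real.log (Real.log (m * n * M + 3)) + Real.log G.diam + Real.log (1 / ε))
      ≤ 10 ^ 10 / ε ^ 2 * ((1 + 4 * Real.log J) *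
        (Real.log (Real.log (n + 3)) + Real.log G.diam + Real.log (1 / ε))) := by
        gcongr
        nlinarith [mul_nonneg hlogJ hlD, mul_nonneg hlogJ hE]
    _ = _ := by ring
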